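/- Let $q\in\mathbb{C}^*$ be not a root of unity and let $\rho\in\mathbb{C}^*$. Write $[x,y]=xy-yx$ and $[x,y]_q=q\,xy-q^{-1}yx$. Let $O=O_q(\widehat{sl_2})$ be the unital associative $\mathbb{C}$-algebra with generators $W_{-k},W_{k+1},G_{k+1},\tilde G_{k+1}$ ($k\ge 0$) and defining relations, for all $k,l\ge 0$, $$[W_0,W_{k+1}]=[W_{-k},W_1]=\tfrac{1}{q+q^{-1}}(\tilde G_{k+1}-G_{k+1}),\qquad(1)$$ $$[W_0,G_{k+1}]_q=[\tilde G_{k+1},W_0]_q=\rho W_{-k-1}-\rho W_{k+1},\qquad(2)$$ $$[G_{k+1},W_1]_q=[W_1,\tilde G_{k+1}]_q=\rho W_{k+2}-\rho W_{-k},\qquad(3)$$ $$[W_{-k},W_{-l}]=[W_{k+1},W_{l+1}]=[G_{k+1},G_{l+1}]=[\tilde G_{k+1},\tilde G_{l+1}]=0,$$ $$[W_{-k},W_{l+1}]+[W_{k+1},W_{-l}]=0,\qquad [\tilde G_{k+1},G_{l+1}]+[G_{k+1},\tilde G_{l+1}]=0,$$ $$[W_{-k},G_{l+1}]+[G_{k+1},W_{-l}]=0,\qquad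 [W_{-k},\tilde G_{l+1}]+[\tilde G_{k+1},W_{-l}]=0,$$ $$[W_{k+1},G_{l+1}]+[G_{k+1},W_{l+1}]=0,\qquad [W_{k+1},\tilde G_{l+1}]+[\tilde G_{k+1},W_{l+1}]=0.$$ For $k\ge 0$ put $\bar k=1$ if $k$ is even, $\bar k=0$ if $k$ is odd, and $\alpha=\lfloor k/2\rfloor$. For a system $c=(a_{ij},b_{ij},e_{ij})$ of complex numbers put $$Q^{(k)}_c=\sum_{l=0}^{\alpha}\ \sum_{i+j=2l+1-\bar k}\big(a_{ij}W_{-i}W_{j+1}+b_{ij}W_{i+1}W_{-j}\big)+\sum_{l=0}^{\alpha-\bar k}\ \sum_{\substack{i+j=2l+\bar k\\ i\le j}}e_{ij}\big(q^2W_{-i}W_{-j}+q^{-2}W_{i+1}W_{j+1}+\rho^{-1}G_{j+1}\tilde G_{i+1}\big)$$ (with $i,j\ge 0$; the second sum is empty for $k=0$), and let $\tilde Q^{(k)}_c$ be obtained from $Q^{(k)}_c$ by the exchange $W_{-n}\leftrightarrow W_{n+1}$, $G_{n+1}\leftrightarrow\tilde G_{n+1}$ for all $n\ge 0$. These involve only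 $W_{-n},W_{n+1}$ with $n\le k$ and $G_{n+1},\tilde G_{n+1}$ with $n<k$. **Proposition.** For every $k\ge 0$ there is a coefficient system $c^{(k)}=(a^{(k)}_{ij},b^{(k)}_{ij},e^{(k)}_{ij})$ such that the following hold. 1. (The recursive formula, with arbitrary constants.) For every sequence $(a_k)_{k\ge 0}$ of complex numbers there are elements $W'_{-k},W'_{k+1},G'_{k+1},\tilde G'_{k+1}$ of $O$ ($k\ge0$) which satisfy all the defining relations above, with $W'_0=W_0$, $W'_1=W_1$, and for all $k\ge 0$ $$G'_{k+1}=Q^{(k)}_{c^{(k)}}(W',G',\tilde G')+a_k,\qquad \tilde G'_{k+1}=\tilde Q^{(k)}_{c^{(k)}}(W',G',\tilde G')+a_k .$$ 2. (The generators of $O$ themselves.) For every $k\ge 0$ there is a central element $z_k$ of $O$ such that $G_{k+1}=Q^{(k)}_{c^{(k)}}+z_k$ and $\tilde G_{k+1}=\tilde Q^{(k)}_{c^{(k)}}+z_k$ in $O$. 3. (Uniqueness of the coefficients up to the relations.) Let $k\ge 0$, $s\in\mathbb{C}$, let $c'=(a'_{ij},b'_{ij},e'_{ij})$ be any coefficient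 system, and put $x=Q^{(k)}_{c'}+s$, $y=\tilde Q^{(k)}_{c'}+s$. Then $x,y$ satisfy (1)–(3) in the place of $G_{k+1},\tilde G_{k+1}$, that is, $$[W_0,W_{k+1}]=[W_{-k},W_1]=\tfrac{1}{q+q^{-1}}(y-x),\qquad [W_0,x]_q=[y,W_0]_q,\qquad [x,W_1]_q=[W_1,y]_q,$$ if and only if $e'_{ij}=e^{(k)}_{ij}$ for all $(i,j)$ that occur in the second sum and $a'_{ij}-a^{(k)}_{ij}=b'_{ij}-b^{(k)}_{ij}=-(a'_{ji}-a^{(k)}_{ji})$ for all $(i,j)$ that occur in the first sum; in other words, if and only if $c'$ agrees with $c^{(k)}$ up to the relation $[W_{-i},W_{j+1}]+[W_{i+1},W_{-j}]=0$. -/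

import Mathlib

/-- The commutator `[x, y] = x y - y x`. -/
def aComm {R : Type*} [Ring R] (x y : R) : R := x * y - y * x

/-- The `q`-commutator `[x, y]_q = q x y - q⁻¹ y x`. -/
noncomputable def qComm {R : Type*} [Ring R] [Algebra ℂ R] (q : ℂ) (x y : R) : R :=
  q • (x * y) - q⁻¹ • (y * x)

/-- Four sequences of elements of `R`:
`wm k` stands for `W_{-k}`, `wp k` for `W_{k+1}`, `g k` for `G_{k+1}`, `gt k` for `G̃_{k+1}`. -/
structure CurrentFamily (R : Type*) where
  wm : ℕ → R
  wp : ℕ → R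
  g : ℕ → R
  gt : ℕ → R

/-- The exchange `W_{-k} ↔ W_{k+1}`, `G_{k+1} ↔ G̃_{k+1}`. -/
def CurrentFamily.swap {R : Type*} (X : CurrentFamily R) : CurrentFamily R where
  wm := X.wp
  wp := X.wm
  g := X.gt
  gt := X.g

/-- The defining relations of `O_q(sl₂^)`, written for a family `X` of elements of an algebra;
`CurrentRel q ρ X x y` says that `x = y` is one of these relations. -/
inductive CurrentRel {R : Type*} [Ring R] [Algebra ℂ R] (q ρ : ℂ) (X : CurrentFamily R) :
    R → R → Prop
  | w0_wp (k : ℕ) : CurrentRel q ρ X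
      (aComm (X.wm 0) (X.wp k)) ((1 / (q + q⁻¹)) • (X.gt k - X.g k))
  | wm_w1 (k : ℕ) : CurrentRel q ρ X
      (aComm (X.wm k) (X.wp 0)) ((1 / (q + q⁻¹)) • (X.gt k - X.g k))
  | w0_g (k : ℕ) : CurrentRel q ρ X
      (qComm q (X.wm 0) (X.g k)) (ρ • X.wm (k + 1) - ρ • X.wp k)
  | gt_w0 (k : ℕ) : CurrentRel q ρ X
      (qComm q (X.gt k) (X.wm 0)) (ρ • X.wm (k + 1) - ρ • X.wp k)
  | g_w1 (k : ℕ) : CurrentRel q ρ X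
      (qComm q (X.g k) (X.wp 0)) (ρ • X.wp (k + 1) - ρ • X.wm k)
  | w1_gt (k : ℕ) : CurrentRel q ρ X
      (qComm q (X.wp 0) (X.gt k)) (ρ • X.wp (k + 1) - ρ • X.wm k)
  | wm_wm (k l : ℕ) : CurrentRel q ρ X (aComm (X.wm k) (X.wm l)) 0
  | wp_wp (k l : ℕ) : CurrentRel q ρ X (aComm (X.wp k) (X.wp l)) 0
  | wm_wp (k l : ℕ) : CurrentRel q ρ X
      (aComm (X.wm k) (X.wp l) + aComm (X.wp k) (X.wm l)) 0
  | wm_g (k l : ℕ) : CurrentRel q ρ X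
      (aComm (X.wm k) (X.g l) + aComm (X.g k) (X.wm l)) 0
  | wm_gt (k l : ℕ) : CurrentRel q ρ X
      (aComm (X.wm k) (X.gt l) + aComm (X.gt k) (X.wm l)) 0
  | wp_g (k l : ℕ) : CurrentRel q ρ X
      (aComm (X.wp k) (X.g l) + aComm (X.g k) (X.wp l)) 0
  | wp_gt (k l : ℕ) : CurrentRel q ρ X
      (aComm (X.wp k) (X.gt l) + aComm (X.gt k) (X.wp l)) 0
  | g_g (k l : ℕ) : CurrentRel q ρ X (aComm (X.g k) (X.g l)) 0
  | gt_gt (k l : ℕ) : CurrentRel q ρ X (aComm (X.gt k) (X.gt l)) 0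
  | gt_g (k l : ℕ) : CurrentRel q ρ X
      (aComm (X.gt k) (X.g l) + aComm (X.g k) (X.gt l)) 0

/-- The family `X` satisfies all the defining relations of `O_q(sl₂^)`. -/
def CurrentFamily.Satisfies {R : Type*} [Ring R] [Algebra ℂ R] (X : CurrentFamily R)
    (q ρ : ℂ) : Prop :=
  ∀ x y : R, CurrentRel q ρ X x y → x = y

/-- Names of the generators `W_{-k}`, `W_{k+1}`, `G_{k+1}`, `G̃_{k+1}`. -/
inductive CurrentGen : Type
  | wm (k : ℕ)
  | wp (k : ℕ)
  | g (k : ℕ)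
  | gt (k : ℕ)

/-- The free generators. -/
def freeFamily : CurrentFamily (FreeAlgebra ℂ CurrentGen) where
  wm k := FreeAlgebra.ι ℂ (CurrentGen.wm k)
  wp k := FreeAlgebra.ι ℂ (CurrentGen.wp k)
  g k := FreeAlgebra.ι ℂ (CurrentGen.g k)
  gt k := FreeAlgebra.ι ℂ (CurrentGen.gt k)

/-- The current algebra `O_q(sl₂^)`: the unital associative `ℂ`-algebra presented by the generators
`W_{-k}`, `W_{k+1}`, `G_{k+1}`, `G̃_{k+1}` and the defining relations. -/
abbrev CurrentAlgebra (q ρ : ℂ) : Type :=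
  RingQuot (CurrentRel q ρ freeFamily)

/-- The generators of `O_q(sl₂^)`. -/
noncomputable def currentGens (q ρ : ℂ) : CurrentFamily (CurrentAlgebra q ρ) where
  wm k := RingQuot.mkAlgHom ℂ (CurrentRel q ρ freeFamily) (freeFamily.wm k)
  wp k := RingQuot.mkAlgHom ℂ (CurrentRel q ρ freeFamily) (freeFamily.wp k)
  g k := RingQuot.mkAlgHom ℂ (CurrentRel q ρ freeFamily) (freeFamily.g k)
  gt k := RingQuot.mkAlgHom ℂ (CurrentRel q ρ freeFamily) (freeFamily.gt k)

/-- The generators satisfy the defining relations. -/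
theorem currentGens_satisfies (q ρ : ℂ) : (currentGens q ρ).Satisfies q ρ := by
  intro x y h
  have key : ∀ u v, CurrentRel q ρ freeFamily u v →
      RingQuot.mkAlgHom ℂ (CurrentRel q ρ freeFamily) u =
        RingQuot.mkAlgHom ℂ (CurrentRel q ρ freeFamily) v :=
    fun u v huv => RingQuot.mkAlgHom_rel ℂ huv
  cases h
  case w0_wp k => simpa [aComm, qComm, currentGens] using key _ _ (.w0_wp k)
  case wm_w1 k => simpa [aComm, qComm, currentGens] using key _ _ (.wm_w1 k)
  case w0_g k => simpa [aComm, qComm, currentGens] using key _ _ (.w0_g k)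
  case gt_w0 k => simpa [aComm, qComm, currentGens] using key _ _ (.gt_w0 k)
  case g_w1 k => simpa [aComm, qComm, currentGens] using key _ _ (.g_w1 k)
  case w1_gt k => simpa [aComm, qComm, currentGens] using key _ _ (.w1_gt k)
  case wm_wm k l => simpa [aComm, qComm, currentGens] using key _ _ (.wm_wm k l)
  case wp_wp k l => simpa [aComm, qComm, currentGens] using key _ _ (.wp_wp k l)
  case wm_wp k l => simpa [aComm, qComm, currentGens] using key _ _ (.wm_wp k l)
  case wm_g k l => simpa [aComm, qComm, currentGens] using key _ _ (.wm_g k l)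
  case wm_gt k l => simpa [aComm, qComm, currentGens] using key _ _ (.wm_gt k l)
  case wp_g k l => simpa [aComm, qComm, currentGens] using key _ _ (.wp_g k l)
  case wp_gt k l => simpa [aComm, qComm, currentGens] using key _ _ (.wp_gt k l)
  case g_g k l => simpa [aComm, qComm, currentGens] using key _ _ (.g_g k l)
  case gt_gt k l => simpa [aComm, qComm, currentGens] using key _ _ (.gt_gt k l)
  case gt_g k l => simpa [aComm, qComm, currentGens] using key _ _ (.gt_g k l)

/-- `k̄ = 1` for `k` even and `k̄ = 0` for `k` odd. -/
def kbar (k : ℕ) : ℕ := if Even k then 1 else 0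

/-- Coefficients `a_{ij}`, `b_{ij}`, `e_{ij}` of a quadratic combination (for one fixed `k`). -/
structure QuadCoeffs where
  a : ℕ → ℕ → ℂ
  b : ℕ → ℕ → ℂ
  e : ℕ → ℕ → ℂ

/-- `A_{ij} = a_{ij} W_{-i} W_{j+1} + b_{ij} W_{i+1} W_{-j}`. -/
noncomputable def termA {R : Type*} [Ring R] [Algebra ℂ R] (c : QuadCoeffs) (X : CurrentFamily R)
    (i j : ℕ) : R :=
  c.a i j • (X.wm i * X.wp j) + c.b i j • (X.wp i * X.wm j)

/-- `F_{ij} = e_{ij} (q² W_{-i} W_{-j} + q⁻² W_{i+1} W_{j+1} + ρ⁻¹ G_{j+1} G̃_{i+1})`. -/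
noncomputable def termF {R : Type*} [Ring R] [Algebra ℂ R] (q ρ : ℂ) (c : QuadCoeffs)
    (X : CurrentFamily R) (i j : ℕ) : R :=
  c.e i j • ((q ^ 2) • (X.wm i * X.wm j) + (q⁻¹ ^ 2) • (X.wp i * X.wp j)
    + (1 / ρ) • (X.g j * X.gt i))

/-- The quadratic combination `∑_{l=0}^{α} ∑_{i+j=2l+1-k̄} A_{ij} +
∑_{l=0}^{α-k̄} ∑_{i+j=2l+k̄, i≤j} F_{ij}` with `α = ⌊k/2⌋` (the second sum is empty for `k = 0`). -/
noncomputable def quadComb {R : Type*} [Ring R] [Algebra ℂ R] (q ρ : ℂ) (k : ℕ) (c : QuadCoeffs)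
    (X : CurrentFamily R) : R :=
  (∑ l ∈ Finset.range (k / 2 + 1),
      ∑ p ∈ Finset.HasAntidiagonal.antidiagonal (2 * l + 1 - kbar k), termA c X p.1 p.2)
    + ∑ l ∈ Finset.range (k / 2 + 1 - kbar k),
        ∑ p ∈ (Finset.HasAntidiagonal.antidiagonal (2 * l + kbar k)).filter (fun p => p.1 ≤ p.2),
          termF q ρ c X p.1 p.2

/-- The elements `x`, `y`, put in the place of `G_{k+1}`, `G̃_{k+1}`, satisfy, together with
the family `X`, the relations
`[W_0, W_{k+1}] = [W_{-k}, W_1] = (y - x) / (q + q⁻¹)`, `[W_0, x]_q = [y, W_0]_q` and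
`[x, W_1]_q = [W_1, y]_q`. (The remaining members `ρ W_{-k-1} - ρ W_{k+1}` and
`ρ W_{k+2} - ρ W_{-k}` of the last two only define the next elements `W_{-k-1}` and `W_{k+2}`.) -/
def SolvesNext {R : Type*} [Ring R] [Algebra ℂ R] (q : ℂ) (X : CurrentFamily R) (k : ℕ)
    (x y : R) : Prop :=
  aComm (X.wm 0) (X.wp k) = (1 / (q + q⁻¹)) • (y - x) ∧
  aComm (X.wm k) (X.wp 0) = (1 / (q + q⁻¹)) • (y - x) ∧
  qComm q (X.wm 0) x = qComm q y (X.wm 0) ∧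
  qComm q x (X.wp 0) = qComm q (X.wp 0) y

/-- Two coefficient systems for the same `k` agree up to the relation
`W_{-i} W_{j+1} + W_{i+1} W_{-j} = W_{-j} W_{i+1} + W_{j+1} W_{-i}`, on the indices which
occur in the quadratic combination: the `e_{ij}` are equal, and the `a_{ij}` and the `b_{ij}`
differ by one and the same antisymmetric array. -/
def QuadCoeffs.Agree (k : ℕ) (c c' : QuadCoeffs) : Prop :=
  (∀ l i j : ℕ, l < k / 2 + 1 - kbar k → i + j = 2 * l + kbar k → i ≤ j → c'.e i j = c.e i j) ∧
  (∀ l i j : ℕ, l < k / 2 + 1 → i + j = 2 * l + 1 - kbar k →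
    c'.a i j - c.a i j = c'.b i j - c.b i j ∧
    c'.a i j - c.a i j = -(c'.a j i - c.a j i))

/-! Collect the generators into currents `W_-(s) = ∑ W_{-i} s^i`, `W_+(s) = ∑ W_{i+1} s^i`, `G(s) =
∑ G_i s^i`, `G̃(s) = ∑ G̃_i s^i` with `G_0 = G̃_0 = ρ/(q - q⁻¹)`. The defining relations become
linear relations with `W_0`, `W_1` at one point and bilinear relations at two points. They imply
exchange relations that move `G(t)` past `W_±(s)` and `G̃(s)`.

Let `s`, `t` run over the curve `1/s = (q x⁻¹ + q⁻¹ x)/(q + q⁻¹)`, `1/t = (q⁻¹ x⁻¹ + q x)/(q +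
q⁻¹)`. On it the quadratic expression `detForm`, of the type of a quantum determinant, is invariant
under the exchange of the two kinds of currents (`detForm_swap`) and commutes with `W_0`
(`detForm_comm_w0`) and with `G(u)` for a further point `u` (`detForm_comm_g`). Hence all
coefficients of its expansion in `x` are central (`centralSeries_commutes`).

The constant `G_0` makes the coefficient of `x^{k+1}` linear in `G_{k+1}`, `G̃_{k+1}`, with total
factor a nonzero multiple of `q^{2(k+1)} + 1`. The other terms are quadratic, are scalars, or
contain earlier `G`, so induction gives `G_{k+1}` as a quadratic combination plus a central element
(`g_mem_quadSpan`). Doing this in `O × O` for the family paired with its exchange yields the same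
coefficients and the same central element for `G̃_{k+1}`; the universal property carries the
coefficients to every solution of the relations.

For arbitrary constants, multiply all currents by a central series `f` with `f_0 = 1`. The relations
persist (`CurrentFamily.Satisfies.twist`) and the `k`-th residual changes by `G_0 f_{k+1}` plus
terms in `f_0, …, f_k`, so `f` can be chosen recursively (`exists_twist`).

For uniqueness, two solutions of (1)–(3) differ by one exchange-invariant element that commutes with
`W_0`. In a two-dimensional triangular representation, multiplied by an arbitrary scalar series `φ`,
its upper right entry must vanish. This is a quadratic identity in `φ`; polarization turns it into
linear recurrences for the coefficients, which force those on the `G G̃` terms to vanish because `q`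
is not a root of unity, and leave only the stated ambiguity in the others (`agree_of_quadComb_eq`).
-/

/-! ### Relations of the currents at one and at two points. -/

/-- Values `W_-(s)`, `W_+(s)`, `G(s)`, `G̃(s)` of the four currents at one point. -/
structure CurrentValue (B : Type*) where
  m : B
  p : B
  g : B
  h : B

/-- The linear relations between the currents at the point `s` and `W_0`, `W_1`. -/
structure PointRel {F B : Type*} [Field F] [Ring B] [Algebra F B] (q ρ : F) (W0 W1 : B) (s : F)
    (A : CurrentValue B) : Prop where
  w0m : W0 * A.m = A.m * W0
  w1p : W1 * A.p = A.p * W1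
  w0p : ((q + q⁻¹) * s) • (W0 * A.p - A.p * W0) = A.h - A.g
  mw1 : ((q + q⁻¹) * s) • (A.m * W1 - W1 * A.m) = A.h - A.g
  w0g : q • (W0 * A.g) - q⁻¹ • (A.g * W0) = ρ • (A.m - s • A.p)
  hw0 : q • (A.h * W0) - q⁻¹ • (W0 * A.h) = ρ • (A.m - s • A.p)
  gw1 : q • (A.g * W1) - q⁻¹ • (W1 * A.g) = ρ • (A.p - s • A.m)
  w1h : q • (W1 * A.h) - q⁻¹ • (A.h * W1) = ρ • (A.p - s • A.m)

/-- The bilinear relations between the currents at two points. -/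
structure PairRel {F B : Type*} [Field F] [Ring B] [Algebra F B] (s t : F)
    (A A' : CurrentValue B) : Prop where
  mm : A.m * A'.m = A'.m * A.m
  pp : A.p * A'.p = A'.p * A.p
  gg : A.g * A'.g = A'.g * A.g
  hh : A.h * A'.h = A'.h * A.h
  mp : A.m * A'.p - A'.p * A.m = A'.m * A.p - A.p * A'.m
  hg : A.h * A'.g - A'.g * A.h = A'.h * A.g - A.g * A'.h
  mg : s • (A.m * A'.g - A'.g * A.m) = t • (A'.m * A.g - A.g * A'.m)
  mh : s • (A.m * A'.h - A'.h * A.m) = t • (A'.m * A.h - A.h * A'.m)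
  pg : s • (A.p * A'.g - A'.g * A.p) = t • (A'.p * A.g - A.g * A'.p)
  ph : s • (A.p * A'.h - A'.h * A.p) = t • (A'.p * A.h - A.h * A'.p)

/-- The exchange of the two kinds of currents. -/
def CurrentValue.swap {B : Type*} (A : CurrentValue B) : CurrentValue B where
  m := A.p
  p := A.m
  g := A.h
  h := A.g

section
variable {F B : Type*} [Field F] [Ring B] [Algebra F B] {q ρ : F} {W0 W1 : B} {s t : F}
  {A A' : CurrentValue B}

theorem PointRel.swap (h : PointRel q ρ W0 W1 s A) : PointRel q ρ W1 W0 s A.swap := by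
  refine ⟨h.w1p, h.w0m, ?_, ?_, h.w1h, h.gw1, h.hw0, h.w0g⟩
  · have := h.mw1
    simp only [CurrentValue.swap]
    linear_combination (norm := module) (-1 : F) • this
  · have := h.w0p
    simp only [CurrentValue.swap]
    linear_combination (norm := module) (-1 : F) • this

theorem PairRel.swap (h : PairRel s t A A') : PairRel s t A.swap A'.swap := by
  refine ⟨h.pp, h.mm, h.hh, h.gg, ?_, ?_, h.ph, h.pg, h.mh, h.mg⟩
  · have := h.mp
    simp only [CurrentValue.swap]
    linear_combination (norm := module) this
  · have := h.hg
    simp only [CurrentValue.swap]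
    linear_combination (norm := module) this

theorem PairRel.symm (h : PairRel s t A A') : PairRel t s A' A :=
  ⟨h.mm.symm, h.pp.symm, h.gg.symm, h.hh.symm, h.mp.symm, h.hg.symm, h.mg.symm, h.mh.symm,
    h.pg.symm, h.ph.symm⟩

/-! ### Exchange relations of the currents. -/

/-- Moving `W_0` through the product `G(s) G(t)` by the `q`-commutator relation leaves these terms
as remainder. Since `G(s)` and `G(t)` commute, the remainder is symmetric in the two points. -/
theorem PairRel.qcomm_g (hρ : ρ ≠ 0) (h : PairRel s t A A') (hA : PointRel q ρ W0 W1 s A)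
    (hA' : PointRel q ρ W0 W1 t A') :
    q • ((A.m - s • A.p) * A'.g) + q⁻¹ • (A.g * (A'.m - t • A'.p)) =
      q • ((A'.m - t • A'.p) * A.g) + q⁻¹ • (A'.g * (A.m - s • A.p)) := by
  have h1 := congrArg (· * A'.g) hA.w0g
  have h2 := congrArg (A.g * ·) hA'.w0g
  have h3 := congrArg (· * A.g) hA'.w0g
  have h4 := congrArg (A'.g * ·) hA.w0g
  have h5 := congrArg (W0 * ·) h.gg
  have h6 := congrArg (· * W0) h.gg
  apply smul_right_injective B hρ
  simp only [mul_sub, sub_mul, smul_mul_assoc, mul_smul_comm, mul_assoc, smul_sub, smul_add]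
    at h1 h2 h3 h4 h5 h6 ⊢
  linear_combination (norm := module) -q • h1 - q⁻¹ • h2 + q • h3 + q⁻¹ • h4 + (q * q) • h5
    - (q⁻¹ * q⁻¹) • h6

theorem PairRel.qcomm_g' (hρ : ρ ≠ 0) (h : PairRel s t A A') (hA : PointRel q ρ W0 W1 s A)
    (hA' : PointRel q ρ W0 W1 t A') :
    q • (A.g * (A'.p - t • A'.m)) + q⁻¹ • ((A.p - s • A.m) * A'.g) =
      q • (A'.g * (A.p - s • A.m)) + q⁻¹ • ((A'.p - t • A'.m) * A.g) := by
  have h1 := congrArg (A.g * ·) hA'.gw1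
  have h2 := congrArg (· * A'.g) hA.gw1
  have h3 := congrArg (A'.g * ·) hA.gw1
  have h4 := congrArg (· * A.g) hA'.gw1
  have h5 := congrArg (· * W1) h.gg
  have h6 := congrArg (W1 * ·) h.gg
  apply smul_right_injective B hρ
  simp only [mul_sub, sub_mul, smul_mul_assoc, mul_smul_comm, mul_assoc, smul_sub, smul_add]
    at h1 h2 h3 h4 h5 h6 ⊢
  linear_combination (norm := module) -q • h1 - q⁻¹ • h2 + q • h3 + q⁻¹ • h4 + (q * q) • h5
    - (q⁻¹ * q⁻¹) • h6

/-- Exchange of `G(t)` and `W_-(s)`. -/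
theorem PairRel.g_mul_m (hq : q ≠ 0) (hρ : ρ ≠ 0) (hts : t - s ≠ 0) (h : PairRel s t A A')
    (hA : PointRel q ρ W0 W1 s A) (hA' : PointRel q ρ W0 W1 t A') :
    A'.g * A.m = A.m * A'.g + (q * (q - q⁻¹) * t / (t - s)) •
      (A.m * A'.g - A'.m * A.g - s • (A.p * A'.g) + t • (A'.p * A.g)) := by
  -- Multiply `h1` by `t` and use `h2`, `h3` to remove `G(s) W_±(t)`. The terms `G(t) W_+(s)` cancel
  -- and `G(t) W_-(s)` remains with a factor proportional to `t - s`.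
  have h1 := h.qcomm_g hρ hA hA'
  have h2 := h.mg
  have h3 := h.pg
  apply smul_right_injective B hts
  simp only [mul_sub, sub_mul, smul_mul_assoc, mul_smul_comm, smul_sub, smul_add, smul_smul,
    mul_div_cancel₀ _ hts] at h1 h2 h3 ⊢
  linear_combination (norm := skip) (-(q * t)) • h1 + h2 - t • h3
  match_scalars <;> field_simp <;> ring

/-- Exchange of `G(t)` and `W_+(s)`. -/
theorem PairRel.g_mul_p (hq : q ≠ 0) (hρ : ρ ≠ 0) (hts : t - s ≠ 0) (h : PairRel s t A A')
    (hA : PointRel q ρ W0 W1 s A) (hA' : PointRel q ρ W0 W1 t A') :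
    A'.g * A.p = A.p * A'.g - (q⁻¹ * (q - q⁻¹) * t / (t - s)) •
      (A.p * A'.g - A'.p * A.g - s • (A.m * A'.g) + t • (A'.m * A.g)) := by
  have h1 := h.qcomm_g' hρ hA hA'
  have h2 := h.mg
  have h3 := h.pg
  apply smul_right_injective B hts
  simp only [mul_sub, sub_mul, smul_mul_assoc, mul_smul_comm, smul_sub, smul_add, smul_smul,
    mul_div_cancel₀ _ hts] at h1 h2 h3 ⊢
  linear_combination (norm := skip) (-q⁻¹ * t) • h1 + h3 - t • h2
  match_scalars <;> field_simp <;> ring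

/-- This comes from moving `W_1` through the bilinear relation between `W_-` and `G`: the
`q`-commutators of `W_1` with `G` produce products of `W_-` and `W_+`, the commutators of `W_1` with
`W_-` produce `G̃ - G`. -/
theorem PairRel.g_mul_h_sub (h : PairRel s t A A')
    (hA : PointRel q ρ W0 W1 s A) (hA' : PointRel q ρ W0 W1 t A') :
    (q - q⁻¹) • (A'.g * A.h - A.g * A'.h) =
      (ρ * (q + q⁻¹) * (s - t)) • (A.m * A'.p - A'.p * A.m) := by
  have h1 := congrArg (A.m * ·) hA'.gw1
  have h2 := congrArg (· * A'.g) hA.mw1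
  have h3 := congrArg (· * A.m) hA'.gw1
  have h4 := congrArg (A'.g * ·) hA.mw1
  have h1' := congrArg (A'.m * ·) hA.gw1
  have h2' := congrArg (· * A.g) hA'.mw1
  have h3' := congrArg (· * A'.m) hA.gw1
  have h4' := congrArg (A.g * ·) hA'.mw1
  have h5 := congrArg (W1 * ·) h.mg
  have h6 := congrArg (· * W1) h.mg
  have h7 := h.gg
  have h8 := h.hg
  have h9 := h.mm
  have h10 := h.mp
  simp only [mul_sub, sub_mul, smul_mul_assoc, mul_smul_comm, mul_assoc]
    at h1 h2 h3 h4 h1' h2' h3' h4' h5 h6 h7 h8 h9 h10 ⊢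
  linear_combination (norm := skip) ((q + q⁻¹) * s) • h1 + q⁻¹ • h2 - ((q + q⁻¹) * s) • h3 - q • h4
    - ((q + q⁻¹) * t) • h1' - q⁻¹ • h2' + ((q + q⁻¹) * t) • h3' + q • h4'
    - ((q + q⁻¹) * q) • h6 + ((q + q⁻¹) * q⁻¹) • h5
    - (q + q⁻¹) • h7 + q⁻¹ • h8 - (2 * s * t * ρ * (q + q⁻¹)) • h9 + (ρ * t * (q + q⁻¹)) • h10
  match_scalars <;> ring

/-- Here `W_0` is moved through the identity `PairRel.qcomm_g'`, which itself came from `W_1`.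
Commuting `W_0` with `W_+` brings in `G̃`, and the remaining terms are products of two `W` currents.
-/
theorem PairRel.g_comm_h (hq : q ≠ 0) (hρ : ρ ≠ 0) (h : PairRel s t A A')
    (hA : PointRel q ρ W0 W1 s A) (hA' : PointRel q ρ W0 W1 t A') :
    (t - s) • (A'.g * A.h - A.h * A'.g) = (ρ * (q ^ 2 - q⁻¹ ^ 2) * s * t) •
      ((A.m - s • A.p) * (A'.p - t • A'.m) - (A'.m - t • A'.p) * (A.p - s • A.m)) := by
  have h1 := congrArg (· * (A'.p - t • A'.m)) hA.w0g
  have h2 := congrArg (A.g * ·) hA'.w0p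
  have h2m := congrArg (A.g * ·) hA'.w0m
  have h3 := congrArg (· * A'.g) hA.w0p
  have h3m := congrArg (· * A'.g) hA.w0m
  have h4 := congrArg ((A.p - s • A.m) * ·) hA'.w0g
  have h1' := congrArg (· * (A.p - s • A.m)) hA'.w0g
  have h2' := congrArg (A'.g * ·) hA.w0p
  have h2m' := congrArg (A'.g * ·) hA.w0m
  have h3' := congrArg (· * A.g) hA'.w0p
  have h3m' := congrArg (· * A.g) hA'.w0m
  have h4' := congrArg ((A'.p - t • A'.m) * ·) hA.w0g
  have h5 := congrArg (W0 * ·) (h.qcomm_g' hρ hA hA')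
  have h6 := congrArg (· * W0) (h.qcomm_g' hρ hA hA')
  have h7 := h.gg
  have h8 := h.hg
  have h9 := h.mm
  have h10 := h.mp
  have h11 := h.pp
  simp only [mul_sub, sub_mul, mul_add, add_mul, smul_mul_assoc, mul_smul_comm, mul_assoc]
    at h1 h2 h3 h4 h1' h2' h3' h4' h2m h3m h2m' h3m' h5 h6 h7 h8 h9 h10 h11 ⊢
  linear_combination (norm := skip)
    (q * s * t * (q + q⁻¹)) • h1 + s • h2 + t • h3 + (q⁻¹ * s * t * (q + q⁻¹)) • h4
    - (q * s * t * (q + q⁻¹)) • h1' - t • h2' - s • h3' - (q⁻¹ * s * t * (q + q⁻¹)) • h4'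
    - (s * t ^ 2 * (q + q⁻¹)) • h2m - (s ^ 2 * t * (q + q⁻¹)) • h3m
    + (s ^ 2 * t * (q + q⁻¹)) • h2m' + (s * t ^ 2 * (q + q⁻¹)) • h3m'
    - (q * s * t * (q + q⁻¹)) • h5 + (q⁻¹ * s * t * (q + q⁻¹)) • h6 + s • h8
    - (s + t) • h7 - (q⁻¹ * s * t * ρ * (q + q⁻¹) * (s + t)) • h9
    - (q⁻¹ * s * t * ρ * (q + q⁻¹) * (s + t)) • h11
    + (q⁻¹ * s * t * ρ * (q + q⁻¹) * (1 + s * t)) • h10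
  match_scalars <;> field_simp <;> ring
end

/-! ### The quadratic expression on the curve: exchange symmetry and commutation with `W_0`. -/

/-- The quadratic expression in the currents at two points whose coefficients are central. -/
def detForm {F B : Type*} [Field F] [Ring B] [Algebra F B] (q ρ s t : F) (A A' : CurrentValue B) :
    B :=
  (s * t) • (q ^ 2 • (A.m * A'.m) + q⁻¹ ^ 2 • (A.p * A'.p)) + ρ⁻¹ • (A.g * A'.h)
    - ((q * t - q⁻¹ * s) / (q - q⁻¹)) • (A.m * A'.p)
    - ((q * s - q⁻¹ * t) / (q - q⁻¹)) • (A.p * A'.m)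

/-- `s` and `t` are the coordinates of a generic point, with parameter `x`, of the curve
`s² + t² - (q² + q⁻²) s t + (q - q⁻¹)² s² t² = 0`. -/
structure OnCurve {F : Type*} [Field F] (q x s t : F) : Prop where
  q0 : q ≠ 0
  q1 : q ^ 2 - 1 ≠ 0
  q2 : q ^ 2 + 1 ≠ 0
  x0 : x ≠ 0
  x1 : 1 - x ^ 2 ≠ 0
  ds : q ^ 2 + x ^ 2 ≠ 0
  dt : 1 + q ^ 2 * x ^ 2 ≠ 0
  hs : s = (q ^ 2 + 1) * x / (q ^ 2 + x ^ 2)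
  ht : t = (q ^ 2 + 1) * x / (1 + q ^ 2 * x ^ 2)

section
variable {F B : Type*} [Field F] [Ring B] [Algebra F B] {q ρ : F} {W0 W1 : B} {x s t : F}
  {A A' : CurrentValue B}

theorem OnCurve.sub_eq (hc : OnCurve q x s t) : t - s =
    (q ^ 2 + 1) * (q ^ 2 - 1) * (1 - x ^ 2) * x / ((q ^ 2 + x ^ 2) * (1 + q ^ 2 * x ^ 2)) := by
  obtain ⟨q0, q1, q2, x0, x1, ds, dt, rfl, rfl⟩ := hc
  field_simp
  ring

theorem OnCurve.sub_ne (hc : OnCurve q x s t) : t - s ≠ 0 := by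
  rw [hc.sub_eq]
  have := hc.q1; have := hc.q2; have := hc.x0; have := hc.x1; have := hc.ds; have := hc.dt
  positivity

/-- Write `G̃(s) G(t) - G(s) G̃(t)` as `G(t) G̃(s) - G(s) G̃(t)` minus the commutator of `G(t)` and
`G̃(s)`. Both parts are products of two `W` currents by the exchange relations, and the curve makes
them cancel the other differences. -/
theorem detForm_swap (hρ : ρ ≠ 0) (hc : OnCurve q x s t) (h : PairRel s t A A')
    (hA : PointRel q ρ W0 W1 s A) (hA' : PointRel q ρ W0 W1 t A') :
    detForm q ρ s t A.swap A'.swap = detForm q ρ s t A A' := by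
  have he := h.g_mul_h_sub hA hA'
  have hf := h.g_comm_h hc.q0 hρ hA hA'
  have hmm := h.mm
  have hpp := h.pp
  have hmp := h.mp
  have hsub := hc.sub_eq
  have hne := hc.sub_ne
  have q0 := hc.q0; have q1 := hc.q1; have q2 := hc.q2; have x0 := hc.x0; have x1 := hc.x1
  have ds := hc.ds; have dt := hc.dt
  -- This is `1/(t - s)`, the factor that solves `hf` for the commutator.
  set r := ((q ^ 2 + x ^ 2) * (1 + q ^ 2 * x ^ 2)) /
    ((q ^ 2 + 1) * (q ^ 2 - 1) * (1 - x ^ 2) * x) with hr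
  simp only [detForm, CurrentValue.swap, mul_sub, sub_mul, smul_mul_assoc, mul_smul_comm] at he hf ⊢
  linear_combination (norm := skip) (ρ⁻¹ * q / (q ^ 2 - 1)) • he - (ρ⁻¹ * r) • hf
    + (r * (q ^ 2 - q⁻¹ ^ 2) * s ^ 2 * t) • hmm + (r * (q ^ 2 - q⁻¹ ^ 2) * s * t ^ 2) • hpp
    - (r * (q ^ 2 - q⁻¹ ^ 2) * s * t) • hmp
  rw [hr, hc.hs, hc.ht]
  match_scalars <;> field_simp <;> ring_nf

theorem OnCurve.s_ne (hc : OnCurve q x s t) : s ≠ 0 := by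
  rw [hc.hs]
  have := hc.q2; have := hc.x0; have := hc.ds
  positivity

theorem OnCurve.t_ne (hc : OnCurve q x s t) : t ≠ 0 := by
  rw [hc.ht]
  have := hc.q2; have := hc.x0; have := hc.dt
  positivity

/-- Passing `W_0` through each quadratic term leaves products of one `W` and one `G` or `G̃`. After
`e1`–`e4` bring `G(s)` and `G̃(s)` to the right of `W_±(t)`, the coefficients cancel on the curve.
-/
theorem detForm_comm_w0 (hρ : ρ ≠ 0) (hc : OnCurve q x s t) (h : PairRel s t A A')
    (hA : PointRel q ρ W0 W1 s A) (hA' : PointRel q ρ W0 W1 t A') :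
    W0 * detForm q ρ s t A A' = detForm q ρ s t A A' * W0 := by
  have hst : s - t ≠ 0 := by
    rw [← neg_sub]
    exact neg_ne_zero.2 hc.sub_ne
  have e1 := h.symm.g_mul_m hc.q0 hρ hst hA' hA
  have e2 := h.symm.g_mul_p hc.q0 hρ hst hA' hA
  have e3 := h.swap.symm.g_mul_m hc.q0 hρ hst hA'.swap hA.swap
  have e4 := h.swap.symm.g_mul_p hc.q0 hρ hst hA'.swap hA.swap
  have w1 := congrArg (· * A'.m) hA.w0m
  have w2 := congrArg (A.m * ·) hA'.w0m
  have w3 := congrArg (· * A'.p) hA.w0p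
  have w4 := congrArg (A.p * ·) hA'.w0p
  have w5 := congrArg (· * A'.h) hA.w0g
  have w6 := congrArg (A.g * ·) hA'.hw0
  have w7 := congrArg (· * A'.p) hA.w0m
  have w8 := congrArg (A.m * ·) hA'.w0p
  have w9 := congrArg (· * A'.m) hA.w0p
  have w10 := congrArg (A.p * ·) hA'.w0m
  have hsub : s - t = - _ := (neg_sub t s).symm.trans (congrArg Neg.neg hc.sub_eq)
  have s0 := hc.s_ne
  have t0 := hc.t_ne
  have q0 := hc.q0; have q1 := hc.q1; have q2 := hc.q2; have x0 := hc.x0; have x1 := hc.x1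
  have ds := hc.ds; have dt := hc.dt
  simp only [detForm, CurrentValue.swap, mul_sub, sub_mul, mul_add, add_mul, smul_mul_assoc,
    mul_smul_comm, mul_assoc, hsub] at e1 e2 e3 e4 w1 w2 w3 w4 w5 w6 w7 w8 w9 w10 ⊢
  linear_combination (norm := skip) (s * t * q ^ 2) • w1 + (s * t * q ^ 2) • w2
    + (t * q⁻¹ ^ 2 * q / (q ^ 2 + 1)) • w3 + (s * q⁻¹ ^ 2 * q / (q ^ 2 + 1)) • w4
    + (ρ⁻¹ * q⁻¹) • w5 - (ρ⁻¹ * q⁻¹) • w6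
    - ((q * t - q⁻¹ * s) * q / (q ^ 2 - 1)) • w7
    - ((q * t - q⁻¹ * s) * q / (q ^ 2 - 1) * (q / ((q ^ 2 + 1) * t))) • w8
    - ((q * s - q⁻¹ * t) * q / (q ^ 2 - 1) * (q / ((q ^ 2 + 1) * s))) • w9
    - ((q * s - q⁻¹ * t) * q / (q ^ 2 - 1)) • w10
    + (-q⁻¹ + (q * s - q⁻¹ * t) * q / (q ^ 2 - 1) * (q / ((q ^ 2 + 1) * s))) • e1
    + (-(t * q⁻¹ ^ 2 * q / (q ^ 2 + 1)) + q⁻¹ * t) • e2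
    + (t * q⁻¹ ^ 2 * q / (q ^ 2 + 1)) • e3
    - ((q * s - q⁻¹ * t) * q / (q ^ 2 - 1) * (q / ((q ^ 2 + 1) * s))) • e4
  rw [hc.hs, hc.ht]
  match_scalars <;> field_simp <;> ring_nf
end

/-! ### Commutation of the quadratic expression with a third current. -/

section
variable {F B : Type*} [Field F] [Ring B] [Algebra F B] {q ρ : F} {W0 W1 : B} {x s t u : F}
  {A A' C : CurrentValue B}

/-- A cyclic relation which follows from the exchange relations of `G` and `G̃`. -/
theorem PairRel.cyclic (hρ : ρ ≠ 0) (hq : q + q⁻¹ ≠ 0) (h1 : PairRel s t A A')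
    (h2 : PairRel t u A' C) (h3 : PairRel s u A C)
    (hA : PointRel q ρ W0 W1 s A) (hA' : PointRel q ρ W0 W1 t A') (hC : PointRel q ρ W0 W1 u C) :
    (s - t) • ((A.m * A'.p - A'.p * A.m) * C.g) + (t - u) • ((A'.m * C.p - C.p * A'.m) * A.g)
      - (s - u) • ((A.m * C.p - C.p * A.m) * A'.g) = 0 := by
  -- Each commutator of `W_-` and `W_+` is replaced by a difference of products `G G̃`; the sum of
  -- these, multiplied by the third `G`, vanishes by the `G̃ G` relation and the commutativity of
  -- the `G`.
  have e1 := congrArg (· * C.g) (h1.g_mul_h_sub hA hA')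
  have e2 := congrArg (· * A.g) (h2.g_mul_h_sub hA' hC)
  have e3 := congrArg (· * A'.g) (h3.g_mul_h_sub hA hC)
  have f1 := congrArg (· * C.g) h1.hg
  have f2 := congrArg (· * A.g) h2.hg
  have f3 := congrArg (· * A'.g) h3.hg
  have g1 := congrArg (C.h * ·) h1.gg
  have g2 := congrArg (A.h * ·) h2.gg
  have g3 := congrArg (A'.h * ·) h3.gg
  apply smul_right_injective B (mul_ne_zero hρ hq)
  simp only [sub_mul, smul_mul_assoc, mul_assoc] at e1 e2 e3 f1 f2 f3 g1 g2 g3 ⊢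
  linear_combination (norm := module) -e1 - e2 + e3 - (q - q⁻¹) • f1 - (q - q⁻¹) • f2
    + (q - q⁻¹) • f3 + (q - q⁻¹) • g1 + (q - q⁻¹) • g2 - (q - q⁻¹) • g3

/-- Exchange of `G(t)` and `W_-(s)` in a chain of products. -/
theorem exch_assoc {a b c1 c2 c3 c4 : B} {k s t : F}
    (h : a * b = b * a + k • (c1 - c2 - s • c3 + t • c4)) :
    a * b = b * a + (k • c1 - k • c2 - (k * s) • c3 + (k * t) • c4) ∧
    ∀ z, a * (b * z) = b * (a * z) + (k • (c1 * z) - k • (c2 * z) - (k * s) • (c3 * z)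
      + (k * t) • (c4 * z)) := by
  have h' : a * b = b * a + (k • c1 - k • c2 - (k * s) • c3 + (k * t) • c4) := by
    rw [h]; module
  refine ⟨h', fun z => ?_⟩
  rw [← mul_assoc, h']
  simp only [add_mul, sub_mul, smul_mul_assoc, mul_assoc]

-- All products are brought to a normal form with the `W` to the left and the `G`, `G̃` to the
-- right. The difference of the two sides then has coefficients that are rational functions of `q`,
-- `x`, `u`, and each of them vanishes.
set_option maxRecDepth 4000 in
set_option maxHeartbeats 4000000 in
theorem detForm_comm_g (hρ : ρ ≠ 0) (hc : OnCurve q x s t) (hu : u ≠ 0)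
    (hus : u * (q ^ 2 + x ^ 2) - (q ^ 2 + 1) * x ≠ 0)
    (hut : u * (1 + q ^ 2 * x ^ 2) - (q ^ 2 + 1) * x ≠ 0)
    (h : PairRel s t A A') (h' : PairRel s u A C) (h'' : PairRel t u A' C)
    (hA : PointRel q ρ W0 W1 s A) (hA' : PointRel q ρ W0 W1 t A') (hC : PointRel q ρ W0 W1 u C) :
    C.g * detForm q ρ s t A A' = detForm q ρ s t A A' * C.g := by
  have q0 := hc.q0; have q1 := hc.q1; have q2 := hc.q2; have x0 := hc.x0; have x1 := hc.x1
  have ds := hc.ds; have dt := hc.dt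
  have eus : u - s = (u * (q ^ 2 + x ^ 2) - (q ^ 2 + 1) * x) / (q ^ 2 + x ^ 2) := by
    rw [hc.hs]; field_simp
  have eut : u - t = (u * (1 + q ^ 2 * x ^ 2) - (q ^ 2 + 1) * x) / (1 + q ^ 2 * x ^ 2) := by
    rw [hc.ht]; field_simp
  have nus : u - s ≠ 0 := by rw [eus]; exact div_ne_zero hus ds
  have nut : u - t ≠ 0 := by rw [eut]; exact div_ne_zero hut dt
  have nsu : s - u ≠ 0 := by rw [← neg_sub]; exact neg_ne_zero.2 nus
  have ntu : t - u ≠ 0 := by rw [← neg_sub]; exact neg_ne_zero.2 nut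
  have nst : s - t ≠ 0 := by rw [← neg_sub]; exact neg_ne_zero.2 hc.sub_ne
  have hd : q + q⁻¹ ≠ 0 := by
    rw [show q + q⁻¹ = (q ^ 2 + 1) / q by field_simp]
    exact div_ne_zero q2 q0
  have neg_form : ∀ (a b c y : B) (k : F), a * b = b * a - k • (c - y) →
      a * b = b * a + (-k) • (c - y) := fun a b c y k e => by rw [e]; module
  have b1 := h'.g_mul_m q0 hρ nus hA hC
  have b2 := h''.g_mul_m q0 hρ nut hA' hC
  have b3 := h.symm.g_mul_m q0 hρ nst hA' hA
  have b4 := h'.symm.g_mul_m q0 hρ nsu hC hA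
  have b5 := h''.symm.g_mul_m q0 hρ ntu hC hA'
  have c1 := h'.g_mul_p q0 hρ nus hA hC
  have c2 := h''.g_mul_p q0 hρ nut hA' hC
  have c3 := h.symm.g_mul_p q0 hρ nst hA' hA
  have c4 := h'.symm.g_mul_p q0 hρ nsu hC hA
  have c5 := h''.symm.g_mul_p q0 hρ ntu hC hA'
  have f0 := h''.g_comm_h q0 hρ hA' hC
  have cyc := PairRel.cyclic hρ hd h h'' h' hA hA' hC
  have mm1 := h.mm
  have mm2 := h'.mm
  have mm3 := h''.mm
  have pp1 := h.pp
  have pp2 := h'.pp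
  have pp3 := h''.pp
  have mp1 := h.mp
  have mp2 := h'.mp
  have mp3 := h''.mp
  have gg := h'.gg
  simp only [detForm]
  generalize A.m = ms at *
  generalize A.p = ps at *
  generalize A.g = gs at *
  generalize A'.m = mt at *
  generalize A'.p = pt at *
  generalize A'.g = gt at *
  generalize A'.h = ht at *
  generalize C.m = mu at *
  generalize C.p = pu at *
  generalize C.g = gu at *
  generalize hk1 : q * (q - q⁻¹) * u / (u - s) = k1 at b1
  generalize hk2 : q * (q - q⁻¹) * u / (u - t) = k2 at b2
  generalize hk3 : q * (q - q⁻¹) * s / (s - t) = k3 at b3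
  generalize hk4 : q * (q - q⁻¹) * s / (s - u) = k4 at b4
  generalize hk5 : q * (q - q⁻¹) * t / (t - u) = k5 at b5
  generalize hl1 : q⁻¹ * (q - q⁻¹) * u / (u - s) = l1 at c1
  generalize hl2 : q⁻¹ * (q - q⁻¹) * u / (u - t) = l2 at c2
  generalize hl3 : q⁻¹ * (q - q⁻¹) * s / (s - t) = l3 at c3
  generalize hl4 : q⁻¹ * (q - q⁻¹) * s / (s - u) = l4 at c4
  generalize hl5 : q⁻¹ * (q - q⁻¹) * t / (t - u) = l5 at c5
  -- The commutator of `G(u)` and `G̃(t)`, solved for the product that occurs when `G(u)` passes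
  -- `G(s) G̃(t)`.
  have f1 : gu * ht = ht * gu + (ρ * (q ^ 2 - q⁻¹ ^ 2) * t * u / (u - t)) •
      (mt * pu - u • (mt * mu) - t • (pt * pu) + (t * u) • (pt * mu)
        - mu * pt + t • (mu * mt) + u • (pu * pt) - (t * u) • (pu * mt)) := by
    apply smul_right_injective B nut
    simp only [mul_sub, sub_mul, smul_mul_assoc, mul_smul_comm] at f0 ⊢
    linear_combination (norm := skip) f0
    match_scalars <;> field_simp <;> ring
  generalize hkf : ρ * (q ^ 2 - q⁻¹ ^ 2) * t * u / (u - t) = kf at f1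
  obtain ⟨d1, hd1⟩ : ∃ d, d = ms * pt - pt * ms := ⟨_, rfl⟩
  obtain ⟨d2, hd2⟩ : ∃ d, d = ms * pu - pu * ms := ⟨_, rfl⟩
  obtain ⟨d3, hd3⟩ : ∃ d, d = mt * pu - pu * mt := ⟨_, rfl⟩
  rw [← hd1, ← hd2, ← hd3] at cyc
  -- The three products of a commutator of `W` currents with the third `G` are linearly dependent by
  -- the cyclic relation. Without eliminating one of them the coefficients need not vanish
  -- separately.
  have r3 : d3 * gs = ((s - u) / (t - u)) • (d2 * gt) - ((s - t) / (t - u)) • (d1 * gu) := by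
    apply smul_right_injective B ntu
    linear_combination (norm := skip) cyc
    match_scalars <;> field_simp <;> ring
  have w1 : ∀ z, pt * (ms * z) = ms * (pt * z) - d1 * z := fun z => by
    rw [hd1]; simp only [sub_mul, mul_assoc]; abel
  have w2 : ∀ z, pu * (ms * z) = ms * (pu * z) - d2 * z := fun z => by
    rw [hd2]; simp only [sub_mul, mul_assoc]; abel
  have w3 : ∀ z, pu * (mt * z) = mt * (pu * z) - d3 * z := fun z => by
    rw [hd3]; simp only [sub_mul, mul_assoc]; abel
  have w4 : ∀ z, ps * (mt * z) = mt * (ps * z) - d1 * z := fun z => by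
    rw [hd1, mp1]; simp only [sub_mul, mul_assoc]; abel
  have w5 : ∀ z, ps * (mu * z) = mu * (ps * z) - d2 * z := fun z => by
    rw [hd2, mp2]; simp only [sub_mul, mul_assoc]; abel
  have w6 : ∀ z, pt * (mu * z) = mu * (pt * z) - d3 * z := fun z => by
    rw [hd3, mp3]; simp only [sub_mul, mul_assoc]; abel
  have w7 : ∀ z, mt * (ms * z) = ms * (mt * z) := fun z => by simp only [← mul_assoc, mm1]
  have w8 : ∀ z, mu * (ms * z) = ms * (mu * z) := fun z => by simp only [← mul_assoc, mm2]
  have w9 : ∀ z, mu * (mt * z) = mt * (mu * z) := fun z => by simp only [← mul_assoc, mm3]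
  have w10 : ∀ z, pt * (ps * z) = ps * (pt * z) := fun z => by simp only [← mul_assoc, pp1]
  have w11 : ∀ z, pu * (ps * z) = ps * (pu * z) := fun z => by simp only [← mul_assoc, pp2]
  have w12 : ∀ z, pu * (pt * z) = pt * (pu * z) := fun z => by simp only [← mul_assoc, pp3]
  have w13 : ∀ z, gu * (gs * z) = gs * (gu * z) := fun z => by simp only [← mul_assoc, gg]
  obtain ⟨b1, b1'⟩ := exch_assoc b1
  obtain ⟨b2, -⟩ := exch_assoc b2
  obtain ⟨b3, b3'⟩ := exch_assoc b3
  obtain ⟨b4, b4'⟩ := exch_assoc b4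
  obtain ⟨b5, -⟩ := exch_assoc b5
  rw [sub_eq_add_neg, ← neg_smul] at c1 c2 c3 c4 c5
  obtain ⟨c1, c1'⟩ := exch_assoc c1
  obtain ⟨c2, -⟩ := exch_assoc c2
  obtain ⟨c3, c3'⟩ := exch_assoc c3
  obtain ⟨c4, c4'⟩ := exch_assoc c4
  obtain ⟨c5, -⟩ := exch_assoc c5
  clear mm1 mm2 mm3 pp1 pp2 pp3 mp1 mp2 mp3 gg cyc f0 hd1 hd2 hd3
  -- The first pass moves `G` to the right of `W`; the second orders the `W` among themselves, at
  -- the cost of `d1`, `d2`, `d3`.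
  simp only [mul_add, mul_sub, add_mul, sub_mul, smul_mul_assoc, mul_smul_comm, mul_assoc,
    w13, f1, b1', b2, b3, b3', b4, b4', b5, c1', c2, c3, c3', c4, c4', c5]
  simp only [mul_add, mul_sub, add_mul, sub_mul, smul_mul_assoc, mul_smul_comm, mul_assoc,
    w1, w2, w3, w4, w5, w6, w7, w8, w9, w10, w11, w12, r3]
  rw [← sub_eq_zero]
  have k0 : q - q⁻¹ = (q ^ 2 - 1) / q := by field_simp
  have k2 : q ^ 2 - q⁻¹ ^ 2 = (q ^ 2 + 1) * (q ^ 2 - 1) / q ^ 2 := by field_simp; ring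
  have est : s - t = -_ := (neg_sub t s).symm.trans (congrArg Neg.neg hc.sub_eq)
  have esu : s - u = -_ := (neg_sub u s).symm.trans (congrArg Neg.neg eus)
  have etu : t - u = -_ := (neg_sub u t).symm.trans (congrArg Neg.neg eut)
  have es := hc.hs
  have et := hc.ht
  clear * - q0 q1 q2 x0 x1 ds dt hus hut hu hρ k0 k2 est esu etu eus eut es et hk1 hk2 hk3 hk4 hk5 hl1 hl2 hl3 hl4 hl5 hkf
  -- The nonzero factors become atoms while denominators are cleared, so that they stay factored;
  -- they are expanded only for the final polynomial identity.
  generalize hus' : u * (q ^ 2 + x ^ 2) - (q ^ 2 + 1) * x = Eus at *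
  generalize hut' : u * (1 + q ^ 2 * x ^ 2) - (q ^ 2 + 1) * x = Eut at *
  generalize hds' : q ^ 2 + x ^ 2 = Ds at *
  generalize hdt' : 1 + q ^ 2 * x ^ 2 = Dt at *
  generalize hy : 1 - x ^ 2 = y at *
  generalize ha : q ^ 2 + 1 = a at *
  generalize hb : q ^ 2 - 1 = b at *
  subst hk1 hk2 hk3 hk4 hk5 hl1 hl2 hl3 hl4 hl5 hkf
  rw [k2, k0, est, esu, etu, eus, eut, es, et]
  match_scalars
  all_goals field_simp
  all_goals subst hus' hut'
  all_goals subst hds' hdt' hy ha hb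
  all_goals ring
end

/-! ### Evaluation of sequences at power series without constant term. -/

open PowerSeries
section
variable {R : Type*} [Ring R] [Algebra ℂ R]

theorem powerSeries_map_commute (f : ℂ⟦X⟧) (b : R⟦X⟧) :
    PowerSeries.map (algebraMap ℂ R) f * b = b * PowerSeries.map (algebraMap ℂ R) f := by
  ext n
  rw [coeff_mul, coeff_mul, ← Finset.Nat.sum_antidiagonal_swap]
  refine Finset.sum_congr rfl fun p _ => ?_
  simp only [Prod.fst_swap, Prod.snd_swap, coeff_map]
  exact Algebra.commutes _ _

/-- Power series over an algebra form an algebra over the complex power series. -/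
noncomputable instance powerSeriesAlgebra : Algebra ℂ⟦X⟧ R⟦X⟧ :=
  (PowerSeries.map (algebraMap ℂ R)).toAlgebra' powerSeries_map_commute

theorem coeff_ps_smul (f : ℂ⟦X⟧) (b : R⟦X⟧) (n : ℕ) :
    coeff n (f • b) = ∑ p ∈ Finset.HasAntidiagonal.antidiagonal n, coeff p.1 f • coeff p.2 b := by
  rw [Algebra.smul_def]
  change coeff n (PowerSeries.map (algebraMap ℂ R) f * b) = _
  rw [coeff_mul]
  simp only [coeff_map, Algebra.smul_def]

theorem coeff_C_ps_smul (c : ℂ) (b : R⟦X⟧) (n : ℕ) :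
    coeff n ((C c : ℂ⟦X⟧) • b) = c • coeff n b := by
  rw [Algebra.smul_def]
  change coeff n (PowerSeries.map (algebraMap ℂ R) (C c) * b) = _
  rw [map_C, coeff_C_mul, Algebra.smul_def]

theorem coeff_pow_eq_zero {σ : ℂ⟦X⟧} (hσ : constantCoeff σ = 0) {i n : ℕ} (h : n < i) :
    coeff n (σ ^ i) = 0 :=
  X_pow_dvd_iff.1 (pow_dvd_pow_of_dvd (X_dvd_iff.2 hσ) i) n h

theorem coeff_pow_mul_pow_eq_zero {σ τ : ℂ⟦X⟧} (hσ : constantCoeff σ = 0)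
    (hτ : constantCoeff τ = 0) {i j n : ℕ} (h : n < i + j) : coeff n (σ ^ i * τ ^ j) = 0 := by
  refine X_pow_dvd_iff.1 ?_ n h
  rw [pow_add]
  exact mul_dvd_mul (pow_dvd_pow_of_dvd (X_dvd_iff.2 hσ) i) (pow_dvd_pow_of_dvd (X_dvd_iff.2 hτ) j)

/-- The value `∑ a_i σ^i`. -/
noncomputable def psEval (σ : ℂ⟦X⟧) (a : ℕ → R) : R⟦X⟧ :=
  PowerSeries.mk fun n => ∑ i ∈ Finset.range (n + 1), coeff n (σ ^ i) • a i

/-- The value `∑ M_{ij} σ^i τ^j`. -/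
noncomputable def psEval₂ (σ τ : ℂ⟦X⟧) (M : ℕ → ℕ → R) : R⟦X⟧ :=
  PowerSeries.mk fun n => ∑ i ∈ Finset.range (n + 1), ∑ j ∈ Finset.range (n + 1),
    coeff n (σ ^ i * τ ^ j) • M i j

theorem coeff_psEval {σ : ℂ⟦X⟧} (hσ : constantCoeff σ = 0) (a : ℕ → R) {n N : ℕ} (h : n < N) :
    coeff n (psEval σ a) = ∑ i ∈ Finset.range N, coeff n (σ ^ i) • a i := by
  rw [psEval, coeff_mk]
  refine Finset.sum_subset (Finset.range_subset_range.2 h) fun i _ hi => ?_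
  rw [coeff_pow_eq_zero hσ (by simpa using hi), zero_smul]

theorem coeff_psEval₂ {σ τ : ℂ⟦X⟧} (hσ : constantCoeff σ = 0) (hτ : constantCoeff τ = 0)
    (M : ℕ → ℕ → R) {n N : ℕ} (h : n < N) :
    coeff n (psEval₂ σ τ M) =
      ∑ i ∈ Finset.range N, ∑ j ∈ Finset.range N, coeff n (σ ^ i * τ ^ j) • M i j := by
  rw [psEval₂, coeff_mk]
  have hs : Finset.range (n + 1) ⊆ Finset.range N := Finset.range_subset_range.2 h
  rw [← Finset.sum_subset hs fun i _ hi => Finset.sum_eq_zero fun j _ => ?_]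
  · refine Finset.sum_congr rfl fun i _ => Finset.sum_subset hs fun j _ hj => ?_
    rw [coeff_pow_mul_pow_eq_zero hσ hτ (by simp at hj; omega), zero_smul]
  · rw [coeff_pow_mul_pow_eq_zero hσ hτ (by simp at hi; omega), zero_smul]

theorem psEval₂_swap (σ τ : ℂ⟦X⟧) (M : ℕ → ℕ → R) :
    psEval₂ σ τ M = psEval₂ τ σ fun i j => M j i := by
  ext n
  rw [psEval₂, psEval₂, coeff_mk, coeff_mk, Finset.sum_comm]
  simp only [mul_comm]

theorem psEval_mul {σ τ : ℂ⟦X⟧} (hσ : constantCoeff σ = 0) (hτ : constantCoeff τ = 0)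
    (a b : ℕ → R) : psEval σ a * psEval τ b = psEval₂ σ τ fun i j => a i * b j := by
  ext n
  rw [coeff_psEval₂ hσ hτ _ n.lt_succ_self, coeff_mul]
  have h : ∀ p ∈ Finset.HasAntidiagonal.antidiagonal n, coeff p.1 (psEval σ a) * coeff p.2 (psEval τ b) =
      ∑ i ∈ Finset.range (n + 1), ∑ j ∈ Finset.range (n + 1),
        (coeff p.1 (σ ^ i) * coeff p.2 (τ ^ j)) • (a i * b j) := by
    intro p hp
    have := Finset.HasAntidiagonal.mem_antidiagonal.1 hp
    rw [coeff_psEval hσ a (N := n + 1) (by omega), coeff_psEval hτ b (N := n + 1) (by omega),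
      Finset.sum_mul_sum]
    simp only [smul_mul_smul_comm]
  rw [Finset.sum_congr rfl h, Finset.sum_comm]
  refine Finset.sum_congr rfl fun i _ => ?_
  rw [Finset.sum_comm]
  refine Finset.sum_congr rfl fun j _ => ?_
  rw [coeff_mul, Finset.sum_smul]

theorem psEval_sub (σ : ℂ⟦X⟧) (a b : ℕ → R) :
    psEval σ (fun i => a i - b i) = psEval σ a - psEval σ b := by
  ext n
  simp only [psEval, coeff_mk, map_sub, smul_sub, Finset.sum_sub_distrib]

theorem psEval_smul (σ : ℂ⟦X⟧) (c : ℂ) (a : ℕ → R) :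
    psEval σ (fun i => c • a i) = (C c : ℂ⟦X⟧) • psEval σ a := by
  ext n
  simp only [psEval, coeff_mk, coeff_C_ps_smul, Finset.smul_sum]
  exact Finset.sum_congr rfl fun i _ => smul_comm _ _ _

theorem psEval_C_mul (σ : ℂ⟦X⟧) (r : R) (a : ℕ → R) :
    psEval σ (fun i => r * a i) = C r * psEval σ a := by
  ext n
  simp only [psEval, coeff_mk, coeff_C_mul, Finset.mul_sum, mul_smul_comm]

theorem psEval_mul_C (σ : ℂ⟦X⟧) (r : R) (a : ℕ → R) :
    psEval σ (fun i => a i * r) = psEval σ a * C r := by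
  ext n
  simp only [psEval, coeff_mk, coeff_mul_C, Finset.sum_mul, smul_mul_assoc]

theorem psEval₂_sub (σ τ : ℂ⟦X⟧) (M N : ℕ → ℕ → R) :
    psEval₂ σ τ (fun i j => M i j - N i j) = psEval₂ σ τ M - psEval₂ σ τ N := by
  ext n
  simp only [psEval₂, coeff_mk, map_sub, smul_sub, Finset.sum_sub_distrib]

theorem psEval_succ {σ : ℂ⟦X⟧} (hσ : constantCoeff σ = 0) (a : ℕ → R) :
    psEval σ a = C (a 0) + σ • psEval σ fun i => a (i + 1) := by
  ext n
  rw [coeff_psEval hσ a (Nat.lt_add_of_pos_right two_pos : n < n + 2), Finset.sum_range_succ',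
    add_comm, map_add, coeff_ps_smul]
  congr 1
  · rw [pow_zero, coeff_one, coeff_C]
    split_ifs <;> simp
  · have h : ∀ p ∈ Finset.HasAntidiagonal.antidiagonal n, coeff p.1 σ • coeff p.2 (psEval σ fun i => a (i + 1)) =
        ∑ i ∈ Finset.range (n + 1), (coeff p.1 σ * coeff p.2 (σ ^ i)) • a (i + 1) := by
      intro p hp
      have := Finset.HasAntidiagonal.mem_antidiagonal.1 hp
      rw [coeff_psEval hσ _ (N := n + 1) (by omega), Finset.smul_sum]
      simp only [smul_smul]
    rw [Finset.sum_congr rfl h, Finset.sum_comm]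
    refine Finset.sum_congr rfl fun i _ => ?_
    rw [← Finset.sum_smul, pow_succ', coeff_mul]

/-- A power series with a nonzero scalar factor vanishes only if it is zero. -/
theorem ps_smul_eq_zero {f : ℂ⟦X⟧} (hf : f ≠ 0) {b : R⟦X⟧} (h : f • b = 0) : b = 0 := by
  classical
  by_contra hb
  have hf' : ∃ k, coeff k f ≠ 0 := by
    by_contra! hh
    exact hf (PowerSeries.ext hh)
  have hb' : ∃ k, coeff k b ≠ 0 := by
    by_contra! hh
    exact hb (PowerSeries.ext hh)
  -- At the sum of the two orders only the product of the two lowest coefficients survives.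
  have key := congrArg (coeff (Nat.find hf' + Nat.find hb')) h
  rw [coeff_ps_smul, Finset.sum_eq_single (Nat.find hf', Nat.find hb'), map_zero] at key
  · exact (smul_ne_zero (Nat.find_spec hf') (Nat.find_spec hb')) key
  · rintro ⟨i, j⟩ hp hne
    have hp := Finset.HasAntidiagonal.mem_antidiagonal.1 hp
    rcases lt_or_ge i (Nat.find hf') with hi | hi
    · rw [not_not.1 (Nat.find_min hf' hi), zero_smul]
    · have hj : j < Nat.find hb' := by
        by_contra! hj
        apply hne
        simp only [Prod.mk.injEq]
        simp only at hp
        omega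
      rw [not_not.1 (Nat.find_min hb' hj), smul_zero]
  · intro hn
    exact (hn (Finset.HasAntidiagonal.mem_antidiagonal.2 rfl)).elim
end

/-! ### Localization of the scalars, and the currents as power series. -/

open scoped TensorProduct
section
variable {R : Type*} [Ring R] [Algebra ℂ R]

/-- The ring of power series with the nonzero scalar power series inverted. -/
abbrev PSLoc (R : Type*) [Ring R] [Algebra ℂ R] : Type _ := FractionRing ℂ⟦X⟧ ⊗[ℂ⟦X⟧] R⟦X⟧

/-- The inclusion of the power series into their localization. -/
noncomputable def psLoc : R⟦X⟧ →ₐ[ℂ⟦X⟧] PSLoc R := Algebra.TensorProduct.includeRight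

/-- The power series over `R` are torsion free over the complex power series (`ps_smul_eq_zero`).
Identities proved with division by scalar series therefore descend. -/
theorem psLoc_injective : Function.Injective (psLoc : R⟦X⟧ → PSLoc R) := by
  rw [injective_iff_map_eq_zero]
  intro b hb
  have hl : IsLocalizedModule (nonZeroDivisors ℂ⟦X⟧)
      (TensorProduct.mk ℂ⟦X⟧ (FractionRing ℂ⟦X⟧) R⟦X⟧ 1) :=
    (isLocalizedModule_iff_isBaseChange (nonZeroDivisors ℂ⟦X⟧) (FractionRing ℂ⟦X⟧) _).2
      (TensorProduct.isBaseChange _ _ _)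
  obtain ⟨c, hc⟩ := (IsLocalizedModule.eq_zero_iff (nonZeroDivisors ℂ⟦X⟧)
    (TensorProduct.mk ℂ⟦X⟧ (FractionRing ℂ⟦X⟧) R⟦X⟧ 1)).1 hb
  exact ps_smul_eq_zero (nonZeroDivisors.ne_zero c.2) hc

theorem psLoc_smul (f : ℂ⟦X⟧) (b : R⟦X⟧) :
    psLoc (f • b) = algebraMap ℂ⟦X⟧ (FractionRing ℂ⟦X⟧) f • psLoc b := by
  rw [map_smul, algebraMap_smul]

/-- The sequence `G_0, G_1, …` where `G_0 = ρ / (q - q⁻¹)`, from `G_1, G_2, …`. -/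
noncomputable def withConst (q ρ : ℂ) (g : ℕ → R) : ℕ → R
  | 0 => algebraMap ℂ R (ρ / (q - q⁻¹))
  | n + 1 => g n

/-- The values of the currents at `σ`. -/
noncomputable def currentValue (q ρ : ℂ) (X : CurrentFamily R) (σ : ℂ⟦X⟧) :
    CurrentValue R⟦X⟧ where
  m := psEval σ X.wm
  p := psEval σ X.wp
  g := psEval σ (withConst q ρ X.g)
  h := psEval σ (withConst q ρ X.gt)

/-- The image of a value under a map. -/
def CurrentValue.map {A B : Type*} (f : A → B) (v : CurrentValue A) : CurrentValue B where
  m := f v.m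
  p := f v.p
  g := f v.g
  h := f v.h

/-- The scalar in the fraction field that is given by a complex number. -/
noncomputable def locC (c : ℂ) : FractionRing ℂ⟦X⟧ := algebraMap ℂ⟦X⟧ (FractionRing ℂ⟦X⟧) (C c)

theorem locC_inv (c : ℂ) : (locC c)⁻¹ = locC c⁻¹ := by
  rcases eq_or_ne c 0 with rfl | hc
  · simp [locC]
  · refine inv_eq_of_mul_eq_one_right ?_
    rw [locC, locC, ← map_mul, ← map_mul, mul_inv_cancel₀ hc, map_one, map_one]

theorem psLoc_C_smul (c : ℂ) (b : R⟦X⟧) : psLoc ((C c : ℂ⟦X⟧) • b) = locC c • psLoc b :=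
  psLoc_smul _ _

/-- The sequence `0, a_0, a_1, …`. -/
def shiftSeq (a : ℕ → R) : ℕ → R
  | 0 => 0
  | n + 1 => a n

theorem psEval_shiftSeq {σ : ℂ⟦X⟧} (hσ : constantCoeff σ = 0) (a : ℕ → R) :
    psEval σ (shiftSeq a) = σ • psEval σ a := by
  rw [psEval_succ hσ]
  simp [shiftSeq]

theorem psEval_commutator {σ τ : ℂ⟦X⟧} (hσ : constantCoeff σ = 0) (hτ : constantCoeff τ = 0)
    (a b : ℕ → R) : psEval σ a * psEval τ b - psEval τ b * psEval σ a =
      psEval₂ σ τ fun i j => aComm (a i) (b j) := by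
  rw [psEval_mul hσ hτ, psEval_mul hτ hσ, psEval₂_swap τ σ, ← psEval₂_sub]
  rfl

theorem psEval_commutator_exchange {σ τ : ℂ⟦X⟧} (hσ : constantCoeff σ = 0)
    (hτ : constantCoeff τ = 0) {a b : ℕ → R}
    (h : ∀ i j, aComm (a i) (b j) = aComm (a j) (b i)) :
    psEval σ a * psEval τ b - psEval τ b * psEval σ a =
      psEval τ a * psEval σ b - psEval σ b * psEval τ a := by
  rw [psEval_commutator hσ hτ, psEval_commutator hτ hσ, psEval₂_swap τ σ]
  congr 1
  funext i j
  exact h i j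

theorem psEval_commute {σ τ : ℂ⟦X⟧} (hσ : constantCoeff σ = 0)
    (hτ : constantCoeff τ = 0) {a : ℕ → R} (h : ∀ i j, aComm (a i) (a j) = 0) :
    psEval σ a * psEval τ a = psEval τ a * psEval σ a := by
  rw [← sub_eq_zero, psEval_commutator hσ hτ]
  simp only [h]
  ext n
  simp [psEval₂]

theorem psEval_withConst {σ : ℂ⟦X⟧} (hσ : constantCoeff σ = 0) (q ρ : ℂ) (g : ℕ → R) :
    psEval σ (withConst q ρ g) = C (algebraMap ℂ R (ρ / (q - q⁻¹))) + σ • psEval σ g :=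
  psEval_succ hσ _

theorem withConst_comm (q ρ : ℂ) {a b : ℕ → R} (h : ∀ i j, aComm (a i) (b j) = aComm (a j) (b i))
    (i j : ℕ) : aComm (withConst q ρ a i) (withConst q ρ b j) =
      aComm (withConst q ρ a j) (withConst q ρ b i) := by
  have hc : ∀ (c : ℂ) (x : R), aComm (algebraMap ℂ R c) x = 0 := fun c x =>
    sub_eq_zero.2 (Algebra.commutes c x)
  have hc' : ∀ (c : ℂ) (x : R), aComm x (algebraMap ℂ R c) = 0 := fun c x =>
    sub_eq_zero.2 (Algebra.commutes c x).symm
  cases i <;> cases j <;> simp only [withConst, hc, hc', h]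

theorem withConst_comm_zero (q ρ : ℂ) {a : ℕ → R} (h : ∀ i j, aComm (a i) (a j) = 0)
    (i j : ℕ) : aComm (withConst q ρ a i) (withConst q ρ a j) = 0 := by
  have hc : ∀ (c : ℂ) (x : R), aComm (algebraMap ℂ R c) x = 0 := fun c x =>
    sub_eq_zero.2 (Algebra.commutes c x)
  have hc' : ∀ (c : ℂ) (x : R), aComm x (algebraMap ℂ R c) = 0 := fun c x =>
    sub_eq_zero.2 (Algebra.commutes c x).symm
  cases i <;> cases j <;> simp only [withConst, hc, hc', h]

theorem C_commutes_ps (c : ℂ) (b : R⟦X⟧) :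
    C (algebraMap ℂ R c) * b = b * C (algebraMap ℂ R c) := by
  ext n
  rw [coeff_C_mul, coeff_mul_C, Algebra.commutes]

/-- The constant term of `G(τ)` is a scalar, so the commutator equals `τ` times that with the series
`∑ G_{j+1} τ^j`. Multiplication by `σ` makes the two sides symmetric in the points. -/
theorem psEval_withConst_exchange {σ τ : ℂ⟦X⟧} (hσ : constantCoeff σ = 0)
    (hτ : constantCoeff τ = 0) (q ρ : ℂ) {a b : ℕ → R}
    (h : ∀ i j, aComm (a i) (b j) = aComm (a j) (b i)) :
    σ • (psEval σ a * psEval τ (withConst q ρ b) - psEval τ (withConst q ρ b) * psEval σ a) =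
      τ • (psEval τ a * psEval σ (withConst q ρ b) - psEval σ (withConst q ρ b) * psEval τ a) := by
  have e := psEval_commutator_exchange hσ hτ h
  rw [psEval_withConst hσ, psEval_withConst hτ]
  simp only [mul_add, add_mul, C_commutes_ps, mul_smul_comm, smul_mul_assoc]
  rw [add_sub_add_left_eq_sub, add_sub_add_left_eq_sub, ← smul_sub, ← smul_sub, e, smul_comm]

theorem currentValue_pairRel {q ρ : ℂ} {X : CurrentFamily R} (hX : X.Satisfies q ρ) {σ τ : ℂ⟦X⟧}
    (hσ : constantCoeff σ = 0) (hτ : constantCoeff τ = 0) :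
    PairRel (algebraMap ℂ⟦X⟧ (FractionRing ℂ⟦X⟧) σ) (algebraMap ℂ⟦X⟧ (FractionRing ℂ⟦X⟧) τ)
      ((currentValue q ρ X σ).map psLoc) ((currentValue q ρ X τ).map psLoc) := by
  have anti : ∀ x y : R, aComm x y = - aComm y x := fun x y => by simp [aComm]
  have sw : ∀ {x y x' y' : R}, aComm x y + aComm y' x' = 0 → aComm x y = aComm x' y' := by
    intro x y x' y' h
    rw [anti y' x'] at h
    exact eq_of_sub_eq_zero (by rw [sub_eq_add_neg]; exact h)
  have gg : ∀ i j, aComm (X.g i) (X.g j) = 0 := fun i j => hX _ _ (.g_g i j)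
  have hh : ∀ i j, aComm (X.gt i) (X.gt j) = 0 := fun i j => hX _ _ (.gt_gt i j)
  refine ⟨?_, ?_, ?_, ?_, ?_, ?_, ?_, ?_, ?_, ?_⟩ <;>
    simp only [CurrentValue.map, ← map_mul, ← map_sub, ← psLoc_smul] <;> congr 1
  · exact psEval_commute hσ hτ fun i j => hX _ _ (.wm_wm i j)
  · exact psEval_commute hσ hτ fun i j => hX _ _ (.wp_wp i j)
  · exact psEval_commute hσ hτ (withConst_comm_zero q ρ gg)
  · exact psEval_commute hσ hτ (withConst_comm_zero q ρ hh)
  · exact psEval_commutator_exchange hσ hτ fun i j => sw (hX _ _ (.wm_wp i j))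
  · exact psEval_commutator_exchange hσ hτ
      (withConst_comm q ρ fun i j => sw (hX _ _ (.gt_g i j)))
  · exact psEval_withConst_exchange hσ hτ q ρ fun i j => sw (hX _ _ (.wm_g i j))
  · exact psEval_withConst_exchange hσ hτ q ρ fun i j => sw (hX _ _ (.wm_gt i j))
  · exact psEval_withConst_exchange hσ hτ q ρ fun i j => sw (hX _ _ (.wp_g i j))
  · exact psEval_withConst_exchange hσ hτ q ρ fun i j => sw (hX _ _ (.wp_gt i j))

/-- The value `G_0 = ρ/(q - q⁻¹)` is chosen so that `[W_0, G_0]_q = ρ W_0` and `[G_0, W_1]_q = ρ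
W_1`. These supply the terms of index zero, and (2), (3) become one relation for the whole series.
-/
theorem currentValue_pointRel {q ρ : ℂ} (hq : q - q⁻¹ ≠ 0) (hq' : q + q⁻¹ ≠ 0)
    {X : CurrentFamily R} (hX : X.Satisfies q ρ) {σ : ℂ⟦X⟧} (hσ : constantCoeff σ = 0) :
    PointRel (locC q) (locC ρ) (psLoc (C (X.wm 0))) (psLoc (C (X.wp 0)))
      (algebraMap ℂ⟦X⟧ (FractionRing ℂ⟦X⟧) σ) ((currentValue q ρ X σ).map psLoc) := by
  have hd : ∀ a b : ℕ → R, psEval σ (withConst q ρ a) - psEval σ (withConst q ρ b) =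
      σ • psEval σ fun i => a i - b i := fun a b => by
    rw [psEval_withConst hσ, psEval_withConst hσ, psEval_sub, add_sub_add_left_eq_sub, smul_sub]
  have hl : ∀ (w : R) (a b c : ℕ → R), w = b 0 →
      (∀ i, qComm q w (a i) = ρ • b (i + 1) - ρ • c i) →
      (C q : ℂ⟦X⟧) • (C w * psEval σ (withConst q ρ a)) -
        (C q⁻¹ : ℂ⟦X⟧) • (psEval σ (withConst q ρ a) * C w) =
      (C ρ : ℂ⟦X⟧) • (psEval σ b - σ • psEval σ c) := by
    intro w a b c h0 h
    rw [← psEval_C_mul, ← psEval_mul_C, ← psEval_smul, ← psEval_smul, ← psEval_sub,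
      ← psEval_shiftSeq hσ, ← psEval_sub, ← psEval_smul]
    congr 1
    funext i
    cases i with
    | zero =>
      simp only [withConst, shiftSeq, ← h0, ← Algebra.commutes _ w, ← Algebra.smul_def]
      rw [smul_smul, smul_smul, ← sub_smul, sub_zero]
      congr 1
      rw [← sub_mul, mul_div_cancel₀ _ hq]
    | succ i => rw [smul_sub]; exact h i
  have hr : ∀ (w : R) (a b c : ℕ → R), w = b 0 →
      (∀ i, qComm q (a i) w = ρ • b (i + 1) - ρ • c i) →
      (C q : ℂ⟦X⟧) • (psEval σ (withConst q ρ a) * C w) -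
        (C q⁻¹ : ℂ⟦X⟧) • (C w * psEval σ (withConst q ρ a)) =
      (C ρ : ℂ⟦X⟧) • (psEval σ b - σ • psEval σ c) := by
    intro w a b c h0 h
    rw [← psEval_C_mul, ← psEval_mul_C, ← psEval_smul, ← psEval_smul, ← psEval_sub,
      ← psEval_shiftSeq hσ, ← psEval_sub, ← psEval_smul]
    congr 1
    funext i
    cases i with
    | zero =>
      simp only [withConst, shiftSeq, ← h0, ← Algebra.commutes _ w, ← Algebra.smul_def]
      rw [smul_smul, smul_smul, ← sub_smul, sub_zero]
      congr 1
      rw [← sub_mul, mul_div_cancel₀ _ hq]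
    | succ i => rw [smul_sub]; exact h i
  have hw : ∀ a b c d : ℕ → R, (∀ i, a i - b i = (1 / (q + q⁻¹)) • (c i - d i)) →
      (C (q + q⁻¹) * σ) • (psEval σ a - psEval σ b) =
        psEval σ (withConst q ρ c) - psEval σ (withConst q ρ d) := by
    intro a b c d h
    rw [hd, ← psEval_sub, funext h, psEval_smul, smul_smul, mul_right_comm, ← map_mul,
      mul_one_div_cancel hq', map_one, one_mul]
  have hs : (locC q + locC q⁻¹) * algebraMap ℂ⟦X⟧ (FractionRing ℂ⟦X⟧) σ =
      algebraMap ℂ⟦X⟧ (FractionRing ℂ⟦X⟧) (C (q + q⁻¹) * σ) := by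
    rw [map_mul, map_add, map_add]
    rfl
  have wm0 : ∀ i, aComm (X.wm 0) (X.wm i) = 0 := fun i => hX _ _ (.wm_wm 0 i)
  have wp0 : ∀ i, aComm (X.wp 0) (X.wp i) = 0 := fun i => hX _ _ (.wp_wp 0 i)
  constructor <;>
    simp only [CurrentValue.map, locC_inv, hs, ← map_mul, ← map_sub, ← psLoc_smul,
      ← psLoc_C_smul] <;> congr 1 <;> simp only [currentValue]
  · rw [← psEval_C_mul, ← psEval_mul_C]
    congr 1
    funext i
    exact sub_eq_zero.1 (wm0 i)
  · rw [← psEval_C_mul, ← psEval_mul_C]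
    congr 1
    funext i
    exact sub_eq_zero.1 (wp0 i)
  · rw [← psEval_C_mul, ← psEval_mul_C]
    exact hw _ _ _ _ fun i => hX _ _ (.w0_wp i)
  · rw [← psEval_C_mul, ← psEval_mul_C]
    exact hw _ _ _ _ fun i => hX _ _ (.wm_w1 i)
  · exact hl _ _ _ _ rfl fun i => hX _ _ (.w0_g i)
  · exact hr _ _ _ _ rfl fun i => hX _ _ (.gt_w0 i)
  · exact hr _ _ _ _ rfl fun i => hX _ _ (.g_w1 i)
  · exact hl _ _ _ _ rfl fun i => hX _ _ (.w1_gt i)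
end

/-! ### Expansion along the curve and centrality of its coefficients. -/

section
/-- The quotient by `x` of the first coordinate of the point with parameter `x`. -/
noncomputable def curveS' (q : ℂ) : ℂ⟦X⟧ := C (q ^ 2 + 1) * (C (q ^ 2) + X ^ 2)⁻¹

/-- The quotient by `x` of the second coordinate of the point with parameter `x`. -/
noncomputable def curveT' (q : ℂ) : ℂ⟦X⟧ := C (q ^ 2 + 1) * (1 + C (q ^ 2) * X ^ 2)⁻¹

/-- The first coordinate of the point with parameter `x`. -/
noncomputable def curveS (q : ℂ) : ℂ⟦X⟧ := X * curveS' q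

/-- The second coordinate of the point with parameter `x`. -/
noncomputable def curveT (q : ℂ) : ℂ⟦X⟧ := X * curveT' q

theorem sub_inv_ne {q : ℂ} (hq : q ≠ 0) (h1 : q ^ 2 - 1 ≠ 0) : q - q⁻¹ ≠ 0 := by
  rw [show q - q⁻¹ = (q ^ 2 - 1) / q by field_simp]
  exact div_ne_zero h1 hq

theorem add_inv_ne {q : ℂ} (hq : q ≠ 0) (h2 : q ^ 2 + 1 ≠ 0) : q + q⁻¹ ≠ 0 := by
  rw [show q + q⁻¹ = (q ^ 2 + 1) / q by field_simp]
  exact div_ne_zero h2 hq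

theorem constantCoeff_curveS (q : ℂ) : constantCoeff (curveS q) = 0 := by simp [curveS]

theorem constantCoeff_curveT (q : ℂ) : constantCoeff (curveT q) = 0 := by simp [curveT]

theorem curveS_mul {q : ℂ} (hq : q ≠ 0) :
    curveS q * (C (q ^ 2) + X ^ 2) = C (q ^ 2 + 1) * X := by
  have h : (C (q ^ 2) + X ^ 2 : ℂ⟦X⟧)⁻¹ * (C (q ^ 2) + X ^ 2) = 1 :=
    PowerSeries.inv_mul_cancel _ (by simpa using hq)
  rw [curveS, curveS']
  linear_combination (X * C (q ^ 2 + 1)) * h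

theorem curveT_mul (q : ℂ) :
    curveT q * (1 + C (q ^ 2) * X ^ 2) = C (q ^ 2 + 1) * X := by
  have h : (1 + C (q ^ 2) * X ^ 2 : ℂ⟦X⟧)⁻¹ * (1 + C (q ^ 2) * X ^ 2) = 1 :=
    PowerSeries.inv_mul_cancel _ (by simp)
  rw [curveT, curveT']
  linear_combination (X * C (q ^ 2 + 1)) * h

theorem constantCoeff_curveS' (q : ℂ) : constantCoeff (curveS' q) = (q ^ 2 + 1) / q ^ 2 := by
  simp [curveS', div_eq_mul_inv]

theorem constantCoeff_curveT' (q : ℂ) : constantCoeff (curveT' q) = q ^ 2 + 1 := by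
  simp [curveT']

theorem coeff_curve_pow (q : ℂ) (i j : ℕ) :
    coeff (i + j) (curveS q ^ i * curveT q ^ j) = ((q ^ 2 + 1) / q ^ 2) ^ i * (q ^ 2 + 1) ^ j := by
  have h : curveS q ^ i * curveT q ^ j = X ^ (i + j) * (curveS' q ^ i * curveT' q ^ j) := by
    rw [curveS, curveT]; ring
  rw [h, coeff_X_pow_mul', if_pos le_rfl, Nat.sub_self, coeff_zero_eq_constantCoeff, map_mul,
    map_pow, map_pow, constantCoeff_curveS', constantCoeff_curveT']

theorem rescale_curveS {q : ℂ} (hq : q ≠ 0) : rescale (-1) (curveS q) = - curveS q := by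
  have h := congrArg (rescale (-1 : ℂ)) (curveS_mul hq)
  have hX : rescale (-1 : ℂ) (X : ℂ⟦X⟧) = -X := by rw [rescale_X]; simp
  have hC : ∀ c : ℂ, rescale (-1 : ℂ) (C c) = C c := fun c => by
    ext n; rw [coeff_rescale, coeff_C]; split_ifs with h <;> simp [h]
  rw [map_mul, map_add, map_mul, map_pow _ X, hX, hC, hC] at h
  have h0 : (C (q ^ 2) + X ^ 2 : ℂ⟦X⟧) ≠ 0 := fun h => hq (by
    simpa using congrArg constantCoeff h)
  refine mul_right_cancel₀ h0 ?_
  linear_combination h + curveS_mul hq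

theorem rescale_curveT (q : ℂ) : rescale (-1) (curveT q) = - curveT q := by
  have h := congrArg (rescale (-1 : ℂ)) (curveT_mul q)
  have hX : rescale (-1 : ℂ) (X : ℂ⟦X⟧) = -X := by rw [rescale_X]; simp
  have hC : ∀ c : ℂ, rescale (-1 : ℂ) (C c) = C c := fun c => by
    ext n; rw [coeff_rescale, coeff_C]; split_ifs with h <;> simp [h]
  rw [map_mul, map_add, map_one, map_mul, map_mul, map_pow _ X, hX, hC, hC] at h
  have h0 : (1 + C (q ^ 2) * X ^ 2 : ℂ⟦X⟧) ≠ 0 := fun h => by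
    simpa using congrArg constantCoeff h
  refine mul_right_cancel₀ h0 ?_
  linear_combination h + curveT_mul q

/-- Both coordinates of the curve are odd functions of `x`. This gives the parity condition on the
indices of the quadratic combination. -/
theorem coeff_curve_pow_of_odd {q : ℂ} (hq : q ≠ 0) {i j n : ℕ} (h : Odd (i + j + n)) :
    coeff n (curveS q ^ i * curveT q ^ j) = 0 := by
  have e : coeff n (rescale (-1) (curveS q ^ i * curveT q ^ j)) =
      coeff n ((-1) ^ (i + j) * (curveS q ^ i * curveT q ^ j)) := by
    rw [map_mul, map_pow, map_pow, rescale_curveS hq, rescale_curveT]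
    congr 1
    ring
  have hc : ((-1) ^ (i + j) : ℂ⟦X⟧) = C ((-1) ^ (i + j)) := by simp
  rw [coeff_rescale, hc, coeff_C_mul] at e
  have e2 : ((-1 : ℂ) ^ (i + j)) = - (-1) ^ n := by
    rcases Nat.even_or_odd n with hn | hn
    · rw [hn.neg_one_pow, Odd.neg_one_pow ((Nat.odd_add.1 h).2 hn)]
    · rw [hn.neg_one_pow, Even.neg_one_pow (by
        rcases Nat.even_or_odd (i + j) with h' | h'
        · exact h'
        · exact absurd (h'.add_odd hn) (Nat.not_even_iff_odd.2 h))]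
      simp
  rw [e2] at e
  have e3 : ((-1 : ℂ) ^ n) * coeff n (curveS q ^ i * curveT q ^ j) = 0 := by
    linear_combination e / 2
  exact (mul_eq_zero.1 e3).resolve_left (pow_ne_zero _ (by norm_num))

variable {R : Type*} [Ring R] [Algebra ℂ R]

/-- The value of the central quadratic expression along the curve. -/
noncomputable def centralSeries (q ρ : ℂ) (Y : CurrentFamily R) : R⟦X⟧ :=
  (curveS q * curveT q) • ((C (q ^ 2) : ℂ⟦X⟧) • (psEval (curveS q) Y.wm * psEval (curveT q) Y.wm)
      + (C (q⁻¹ ^ 2) : ℂ⟦X⟧) • (psEval (curveS q) Y.wp * psEval (curveT q) Y.wp))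
    + (C ρ⁻¹ : ℂ⟦X⟧) • (psEval (curveS q) (withConst q ρ Y.g) *
        psEval (curveT q) (withConst q ρ Y.gt))
    - (C (q - q⁻¹)⁻¹ * (C q * curveT q - C q⁻¹ * curveS q)) •
      (psEval (curveS q) Y.wm * psEval (curveT q) Y.wp)
    - (C (q - q⁻¹)⁻¹ * (C q * curveS q - C q⁻¹ * curveT q)) •
      (psEval (curveS q) Y.wp * psEval (curveT q) Y.wm)

theorem psLoc_centralSeries (q ρ : ℂ) (Y : CurrentFamily R) :
    psLoc (centralSeries q ρ Y) = detForm (locC q) (locC ρ)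
      (algebraMap ℂ⟦X⟧ (FractionRing ℂ⟦X⟧) (curveS q))
      (algebraMap ℂ⟦X⟧ (FractionRing ℂ⟦X⟧) (curveT q))
      ((currentValue q ρ Y (curveS q)).map psLoc) ((currentValue q ρ Y (curveT q)).map psLoc) := by
  have h : (locC q - locC q⁻¹)⁻¹ = locC (q - q⁻¹)⁻¹ := by
    rw [← locC_inv (q - q⁻¹)]; simp [locC]
  have h2 : ∀ c, locC (c ^ 2) = locC c ^ 2 := fun c => by simp [locC]
  simp only [centralSeries, detForm, CurrentValue.map, currentValue, div_eq_mul_inv, locC_inv,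
    map_sub, map_add, psLoc_smul, map_mul, ← h2, h]
  simp only [locC, mul_comm]

theorem locC_ne {c : ℂ} (hc : c ≠ 0) : locC c ≠ 0 := by
  rw [locC, Ne, FaithfulSMul.algebraMap_eq_zero_iff]
  exact fun h => hc (by simpa using congrArg constantCoeff h)

theorem algebraMap_ps_ne {f : ℂ⟦X⟧} (n : ℕ) (h : coeff n f ≠ 0) :
    algebraMap ℂ⟦X⟧ (FractionRing ℂ⟦X⟧) f ≠ 0 := by
  rw [Ne, FaithfulSMul.algebraMap_eq_zero_iff]
  rintro rfl
  simp at h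

theorem onCurve_curve {q : ℂ} (hq : q ≠ 0) (h1 : q ^ 2 - 1 ≠ 0) (h2 : q ^ 2 + 1 ≠ 0) :
    OnCurve (locC q) (algebraMap ℂ⟦X⟧ (FractionRing ℂ⟦X⟧) X)
      (algebraMap ℂ⟦X⟧ (FractionRing ℂ⟦X⟧) (curveS q))
      (algebraMap ℂ⟦X⟧ (FractionRing ℂ⟦X⟧) (curveT q)) := by
  have e1 : locC q ^ 2 - 1 = locC (q ^ 2 - 1) := by simp [locC]
  have e2 : locC q ^ 2 + 1 = locC (q ^ 2 + 1) := by simp [locC]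
  have e3 : locC q ^ 2 + algebraMap ℂ⟦X⟧ (FractionRing ℂ⟦X⟧) X ^ 2 =
    algebraMap ℂ⟦X⟧ (FractionRing ℂ⟦X⟧) (C (q ^ 2) + X ^ 2) := by simp [locC]
  have e4 : 1 + locC q ^ 2 * algebraMap ℂ⟦X⟧ (FractionRing ℂ⟦X⟧) X ^ 2 =
    algebraMap ℂ⟦X⟧ (FractionRing ℂ⟦X⟧) (1 + C (q ^ 2) * X ^ 2) := by simp [locC]
  have d3 : locC q ^ 2 + algebraMap ℂ⟦X⟧ (FractionRing ℂ⟦X⟧) X ^ 2 ≠ 0 := by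
    rw [e3]; exact algebraMap_ps_ne 0 (by simpa using hq)
  have d4 : 1 + locC q ^ 2 * algebraMap ℂ⟦X⟧ (FractionRing ℂ⟦X⟧) X ^ 2 ≠ 0 := by
    rw [e4]; exact algebraMap_ps_ne 0 (by simp)
  refine ⟨locC_ne hq, e1 ▸ locC_ne h1, e2 ▸ locC_ne h2, algebraMap_ps_ne 1 (by simp), ?_, d3, d4,
    ?_, ?_⟩
  · rw [← map_pow, ← map_one (algebraMap ℂ⟦X⟧ (FractionRing ℂ⟦X⟧)), ← map_sub]
    exact algebraMap_ps_ne 0 (by simp)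
  · rw [eq_div_iff d3, e3, e2, ← map_mul, curveS_mul hq, map_mul]
    rfl
  · rw [eq_div_iff d4, e4, e2, ← map_mul, curveT_mul, map_mul]
    rfl

theorem CurrentFamily.Satisfies.swap {q ρ : ℂ} {Y : CurrentFamily R} (h : Y.Satisfies q ρ) :
    Y.swap.Satisfies q ρ := by
  have anti : ∀ x y : R, aComm x y = - aComm y x := fun x y => by simp [aComm]
  have hn : ∀ x y : R, (1 / (q + q⁻¹)) • (x - y) = -((1 / (q + q⁻¹)) • (y - x)) := fun x y => by
    rw [← smul_neg, neg_sub]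
  intro x y hxy
  cases hxy <;> simp only [CurrentFamily.swap]
  case w0_wp k => rw [anti, hn]; exact congrArg _ (h _ _ (.wm_w1 k))
  case wm_w1 k => rw [anti, hn]; exact congrArg _ (h _ _ (.w0_wp k))
  case w0_g k => exact h _ _ (.w1_gt k)
  case gt_w0 k => exact h _ _ (.g_w1 k)
  case g_w1 k => exact h _ _ (.gt_w0 k)
  case w1_gt k => exact h _ _ (.w0_g k)
  case wm_wm k l => exact h _ _ (.wp_wp k l)
  case wp_wp k l => exact h _ _ (.wm_wm k l)
  case wm_wp k l => rw [add_comm]; exact h _ _ (.wm_wp k l)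
  case wm_g k l => exact h _ _ (.wp_gt k l)
  case wm_gt k l => exact h _ _ (.wp_g k l)
  case wp_g k l => exact h _ _ (.wm_gt k l)
  case wp_gt k l => exact h _ _ (.wm_g k l)
  case g_g k l => exact h _ _ (.gt_gt k l)
  case gt_gt k l => exact h _ _ (.g_g k l)
  case gt_g k l => rw [add_comm]; exact h _ _ (.gt_g k l)

variable {q ρ : ℂ} {Y : CurrentFamily R}

theorem currentValue_map_swap {B : Type*} (f : R⟦X⟧ → B) (σ : ℂ⟦X⟧) :
    (currentValue q ρ Y.swap σ).map f = ((currentValue q ρ Y σ).map f).swap := rfl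

theorem centralSeries_swap (hq : q ≠ 0) (h1 : q ^ 2 - 1 ≠ 0) (h2 : q ^ 2 + 1 ≠ 0) (hρ : ρ ≠ 0)
    (hY : Y.Satisfies q ρ) : centralSeries q ρ Y.swap = centralSeries q ρ Y := by
  have hm : q - q⁻¹ ≠ 0 := sub_inv_ne hq h1
  have hp : q + q⁻¹ ≠ 0 := add_inv_ne hq h2
  apply psLoc_injective
  rw [psLoc_centralSeries, psLoc_centralSeries, currentValue_map_swap, currentValue_map_swap]
  exact detForm_swap (locC_ne hρ) (onCurve_curve hq h1 h2)
    (currentValue_pairRel hY (constantCoeff_curveS q) (constantCoeff_curveT q))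
    (currentValue_pointRel hm hp hY (constantCoeff_curveS q))
    (currentValue_pointRel hm hp hY (constantCoeff_curveT q))

theorem centralSeries_comm_w0 (hq : q ≠ 0) (h1 : q ^ 2 - 1 ≠ 0) (h2 : q ^ 2 + 1 ≠ 0) (hρ : ρ ≠ 0)
    (hY : Y.Satisfies q ρ) (n : ℕ) :
    Y.wm 0 * coeff n (centralSeries q ρ Y) = coeff n (centralSeries q ρ Y) * Y.wm 0 := by
  have hm : q - q⁻¹ ≠ 0 := sub_inv_ne hq h1
  have hp : q + q⁻¹ ≠ 0 := add_inv_ne hq h2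
  rw [← coeff_C_mul, ← coeff_mul_C]
  congr 1
  apply psLoc_injective
  rw [map_mul, map_mul, psLoc_centralSeries]
  exact detForm_comm_w0 (locC_ne hρ) (onCurve_curve hq h1 h2)
    (currentValue_pairRel hY (constantCoeff_curveS q) (constantCoeff_curveT q))
    (currentValue_pointRel hm hp hY (constantCoeff_curveS q))
    (currentValue_pointRel hm hp hY (constantCoeff_curveT q))

/-- The third point is `u = c x` with a free constant `c`, so that all three points are power series
in the one variable `x`. -/
theorem centralSeries_comm_psEval (hq : q ≠ 0) (h1 : q ^ 2 - 1 ≠ 0) (h2 : q ^ 2 + 1 ≠ 0)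
    (hρ : ρ ≠ 0) (hY : Y.Satisfies q ρ) {c : ℂ} (hc : c ≠ 0) :
    psEval (C c * X) (withConst q ρ Y.g) * centralSeries q ρ Y =
      centralSeries q ρ Y * psEval (C c * X) (withConst q ρ Y.g) := by
  have hm : q - q⁻¹ ≠ 0 := sub_inv_ne hq h1
  have hp : q + q⁻¹ ≠ 0 := add_inv_ne hq h2
  have hu : constantCoeff (C c * X : ℂ⟦X⟧) = 0 := by simp
  have e1 : algebraMap ℂ⟦X⟧ (FractionRing ℂ⟦X⟧) (C c * X) * (locC q ^ 2 +
      algebraMap ℂ⟦X⟧ (FractionRing ℂ⟦X⟧) X ^ 2) - (locC q ^ 2 + 1) *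
      algebraMap ℂ⟦X⟧ (FractionRing ℂ⟦X⟧) X = algebraMap ℂ⟦X⟧ (FractionRing ℂ⟦X⟧)
      (C (c * q ^ 2 - (q ^ 2 + 1)) * X + C c * X ^ 3) := by
    simp only [locC, map_mul, map_add, map_sub, map_pow, map_one]; ring
  have e2 : algebraMap ℂ⟦X⟧ (FractionRing ℂ⟦X⟧) (C c * X) * (1 + locC q ^ 2 *
      algebraMap ℂ⟦X⟧ (FractionRing ℂ⟦X⟧) X ^ 2) - (locC q ^ 2 + 1) *
      algebraMap ℂ⟦X⟧ (FractionRing ℂ⟦X⟧) X = algebraMap ℂ⟦X⟧ (FractionRing ℂ⟦X⟧)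
      (C (c - (q ^ 2 + 1)) * X + C (c * q ^ 2) * X ^ 3) := by
    simp only [locC, map_mul, map_add, map_sub, map_pow, map_one]; ring
  apply psLoc_injective
  rw [map_mul, map_mul, psLoc_centralSeries]
  refine detForm_comm_g (C := (currentValue q ρ Y (C c * X)).map psLoc) (locC_ne hρ)
    (onCurve_curve hq h1 h2) (algebraMap_ps_ne 1 (by simpa using hc)) ?_ ?_
    (currentValue_pairRel hY (constantCoeff_curveS q) (constantCoeff_curveT q))
    (currentValue_pairRel hY (constantCoeff_curveS q) hu)
    (currentValue_pairRel hY (constantCoeff_curveT q) hu)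
    (currentValue_pointRel hm hp hY (constantCoeff_curveS q))
    (currentValue_pointRel hm hp hY (constantCoeff_curveT q))
    (currentValue_pointRel hm hp hY hu)
  · rw [e1]
    -- The coefficient of `x` vanishes for a special `c`; that of `x³` never does, so `u` differs
    -- from `s` for all `c ≠ 0`. The same holds for `t` below.
    refine algebraMap_ps_ne 3 ?_
    rw [map_add, coeff_C_mul, coeff_C_mul, coeff_X, coeff_X_pow]
    simpa using hc
  · rw [e2]
    refine algebraMap_ps_ne 3 ?_
    rw [map_add, coeff_C_mul, coeff_C_mul, coeff_X, coeff_X_pow]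
    simpa [hc] using hq

/-- A polynomial with vector coefficients that vanishes at all nonzero scalars is zero. -/
theorem eq_zero_of_forall_sum_pow_smul {V : Type*} [AddCommGroup V] [Module ℂ V] {N : ℕ}
    {v : ℕ → V} (h : ∀ c : ℂ, c ≠ 0 → ∑ a ∈ Finset.range N, c ^ a • v a = 0) {a : ℕ} (ha : a < N) :
    v a = 0 := by
  rw [← Module.forall_dual_apply_eq_zero_iff ℂ]
  intro f
  let P : Polynomial ℂ := ∑ a ∈ Finset.range N, Polynomial.monomial a (f (v a))
  have hP : P = 0 := by
    refine Polynomial.eq_zero_of_infinite_isRoot P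
      (Set.Infinite.mono (s := {c : ℂ | c ≠ 0}) (fun c hc => ?_) ?_)
    · have := congrArg f (h c hc)
      simp only [map_sum, map_smul, map_zero, smul_eq_mul] at this
      simp only [Set.mem_ofPred_eq, Polynomial.IsRoot, P, Polynomial.eval_finsetSum,
        Polynomial.eval_monomial]
      rw [← this]
      exact Finset.sum_congr rfl fun _ _ => mul_comm _ _
    · exact Set.Finite.infinite_compl (Set.finite_singleton (0 : ℂ))
  have := congrArg (fun p => Polynomial.coeff p a) hP
  simpa [P, Polynomial.finsetSum_coeff, Polynomial.coeff_monomial, ha] using this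

theorem coeff_C_mul_X_pow' (c : ℂ) (n i : ℕ) :
    coeff n ((C c * X : ℂ⟦X⟧) ^ i) = if n = i then c ^ i else 0 := by
  rw [mul_pow, ← map_pow, coeff_C_mul, coeff_X_pow]
  simp

theorem coeff_psEval_C_mul_X (c : ℂ) (a : ℕ → R) (n : ℕ) :
    coeff n (psEval (C c * X) a) = c ^ n • a n := by
  rw [coeff_psEval (by simp) a n.lt_succ_self, Finset.sum_eq_single n]
  · rw [coeff_C_mul_X_pow', if_pos rfl]
  · intro b _ hb
    rw [coeff_C_mul_X_pow', if_neg hb.symm, zero_smul]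
  · simp

/-- A fixed coefficient of the commutation relation at `u = c x` is a polynomial in `c` whose
coefficients are the single commutators. It vanishes for all `c ≠ 0`, so each commutator vanishes.
-/
theorem centralSeries_comm_g (hq : q ≠ 0) (h1 : q ^ 2 - 1 ≠ 0) (h2 : q ^ 2 + 1 ≠ 0)
    (hρ : ρ ≠ 0) (hY : Y.Satisfies q ρ) (n m : ℕ) :
    Y.g m * coeff n (centralSeries q ρ Y) = coeff n (centralSeries q ρ Y) * Y.g m := by
  have key : ∀ c : ℂ, c ≠ 0 → ∑ a ∈ Finset.range (n + m + 1 + 1), c ^ a •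
      aComm (withConst q ρ Y.g a) (coeff (n + m + 1 - a) (centralSeries q ρ Y)) = 0 := by
    intro c hc
    have e := congrArg (coeff (n + m + 1)) (centralSeries_comm_psEval hq h1 h2 hρ hY hc)
    rw [coeff_mul, coeff_mul, ← sub_eq_zero, Finset.Nat.sum_antidiagonal_eq_sum_range_succ_mk,
      ← Finset.Nat.sum_antidiagonal_swap, Finset.Nat.sum_antidiagonal_eq_sum_range_succ_mk,
      ← Finset.sum_sub_distrib] at e
    rw [← e]
    refine Finset.sum_congr rfl fun a _ => ?_
    simp only [Prod.fst_swap, Prod.snd_swap, coeff_psEval_C_mul_X, aComm, smul_sub,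
      smul_mul_assoc, mul_smul_comm]
  -- The entry `m + 1` of the sequence with `G_0` put in front is `Y.g m`.
  have := eq_zero_of_forall_sum_pow_smul key (a := m + 1) (by omega)
  rw [show n + m + 1 - (m + 1) = n by omega] at this
  exact sub_eq_zero.1 this

/-- The element `z` commutes with all members of the family. -/
def CurrentFamily.Commutes (Y : CurrentFamily R) (z : R) : Prop :=
  ∀ k, Commute z (Y.wm k) ∧ Commute z (Y.wp k) ∧ Commute z (Y.g k) ∧ Commute z (Y.gt k)

/-- Given `W_0`, `W_1` and all `G`, relations (2) and (3) produce the other `W` recursively and (1)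
produces the `G̃`. -/
theorem CurrentFamily.Satisfies.commutes (hY : Y.Satisfies q ρ) (hρ : ρ ≠ 0)
    (hq : q + q⁻¹ ≠ 0) {z : R} (h0 : Commute z (Y.wm 0)) (h1 : Commute z (Y.wp 0)) (hg : ∀ k, Commute z (Y.g k)) :
    Y.Commutes z := by
  have hs : ∀ {x : R}, Commute z (ρ • x) → Commute z x := fun {x} h => by
    have := h.smul_right ρ⁻¹
    rwa [smul_smul, inv_mul_cancel₀ hρ, one_smul] at this
  have hw : ∀ k, Commute z (Y.wm k) ∧ Commute z (Y.wp k) := by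
    intro k
    induction k with
    | zero => exact ⟨h0, h1⟩
    | succ k ih =>
      have e1 := hY _ _ (.w0_g k)
      have e2 := hY _ _ (.g_w1 k)
      constructor
      · refine hs ?_
        rw [← sub_add_cancel (ρ • Y.wm (k + 1)) (ρ • Y.wp k), ← e1]
        exact ((((h0.mul_right (hg k)).smul_right _).sub_right
          (((hg k).mul_right h0).smul_right _)).add_right (ih.2.smul_right _))
      · refine hs ?_
        rw [← sub_add_cancel (ρ • Y.wp (k + 1)) (ρ • Y.wm k), ← e2]
        exact (((((hg k).mul_right h1).smul_right _).sub_right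
          ((h1.mul_right (hg k)).smul_right _)).add_right (ih.1.smul_right _))
  refine fun k => ⟨(hw k).1, (hw k).2, hg k, ?_⟩
  have e := hY _ _ (.w0_wp k)
  have e' : Y.gt k = Y.g k + (q + q⁻¹) • aComm (Y.wm 0) (Y.wp k) := by
    rw [e, smul_smul, mul_one_div_cancel hq, one_smul, add_sub_cancel]
  rw [e']
  exact (hg k).add_right (((h0.mul_right (hw k).2).sub_right ((hw k).2.mul_right h0)).smul_right _)

/-- Commutation with `W_1` is commutation with `W_0` for the exchanged family, since the series is
exchange invariant. -/
theorem centralSeries_commutes (hq : q ≠ 0) (h1 : q ^ 2 - 1 ≠ 0) (h2 : q ^ 2 + 1 ≠ 0)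
    (hρ : ρ ≠ 0) (hY : Y.Satisfies q ρ) (n : ℕ) :
    Y.Commutes (coeff n (centralSeries q ρ Y)) := by
  refine hY.commutes hρ (add_inv_ne hq h2) (centralSeries_comm_w0 hq h1 h2 hρ hY n).symm ?_
    fun m => (centralSeries_comm_g hq h1 h2 hρ hY n m).symm
  have := centralSeries_comm_w0 hq h1 h2 hρ hY.swap n
  rw [centralSeries_swap hq h1 h2 hρ hY] at this
  exact this.symm
end

/-! ### Coefficient identities and the span of quadratic combinations. -/

section
variable {R : Type*} [Ring R] [Algebra ℂ R]

theorem coeff_psEval₂_C_mul_X (c : ℂ) (M : ℕ → ℕ → R) (n : ℕ) :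
    coeff n (psEval₂ (C c * X) X M) = ∑ i ∈ Finset.range (n + 1), c ^ i • M i (n - i) := by
  rw [psEval₂, coeff_mk]
  refine Finset.sum_congr rfl fun i hi => ?_
  have hi := Finset.mem_range.1 hi
  have e : ∀ j, coeff n ((C c * X : ℂ⟦X⟧) ^ i * X ^ j) = if n = i + j then c ^ i else 0 := by
    intro j
    rw [mul_pow, ← map_pow, mul_assoc, ← pow_add, coeff_C_mul, coeff_X_pow]
    simp
  rw [Finset.sum_eq_single (n - i)]
  · rw [e, if_pos (by omega)]
  · intro j _ hj
    rw [e, if_neg (by omega), zero_smul]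
  · intro h
    simp only [Finset.mem_range] at h
    omega

/-- At the points `(c x, x)` the coefficient of `x^n` is the polynomial `∑ c^i M_{i,n-i}` in `c`, so
varying `c` separates the entries of equal degree. -/
theorem array_eq_of_psEval₂_eq {M M' : ℕ → ℕ → R}
    (h : ∀ c : ℂ, c ≠ 0 → psEval₂ (C c * X) X M = psEval₂ (C c * X) X M') (i j : ℕ) :
    M i j = M' i j := by
  have key : ∀ c : ℂ, c ≠ 0 → ∑ a ∈ Finset.range (i + j + 1),
      c ^ a • (M a (i + j - a) - M' a (i + j - a)) = 0 := by
    intro c hc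
    have e := congrArg (coeff (i + j)) (h c hc)
    rw [coeff_psEval₂_C_mul_X, coeff_psEval₂_C_mul_X, ← sub_eq_zero, ← Finset.sum_sub_distrib] at e
    simpa only [smul_sub] using e
  have := eq_zero_of_forall_sum_pow_smul key (a := i) (by omega)
  rw [add_tsub_cancel_left] at this
  exact sub_eq_zero.1 this

theorem coeff_smul_psEval₂ {σ τ : ℂ⟦X⟧} (hσ : constantCoeff σ = 0) (hτ : constantCoeff τ = 0)
    (f : ℂ⟦X⟧) (M : ℕ → ℕ → R) {n N : ℕ} (h : n < N) :
    coeff n (f • psEval₂ σ τ M) =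
      ∑ i ∈ Finset.range N, ∑ j ∈ Finset.range N, coeff n (f * (σ ^ i * τ ^ j)) • M i j := by
  rw [coeff_ps_smul]
  have e : ∀ p ∈ Finset.HasAntidiagonal.antidiagonal n, coeff p.1 f • coeff p.2 (psEval₂ σ τ M) =
      ∑ i ∈ Finset.range N, ∑ j ∈ Finset.range N,
        (coeff p.1 f * coeff p.2 (σ ^ i * τ ^ j)) • M i j := by
    intro p hp
    have := Finset.HasAntidiagonal.mem_antidiagonal.1 hp
    rw [coeff_psEval₂ hσ hτ M (N := N) (by omega)]
    simp only [Finset.smul_sum, smul_smul]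
  rw [Finset.sum_congr rfl e, Finset.sum_comm]
  refine Finset.sum_congr rfl fun i _ => ?_
  rw [Finset.sum_comm]
  refine Finset.sum_congr rfl fun j _ => ?_
  rw [coeff_mul, Finset.sum_smul]

variable {q ρ : ℂ} {Y : CurrentFamily R}

theorem psEval_g_mul_gt_sub (hq : q ≠ 0) (h1 : q ^ 2 - 1 ≠ 0) (h2 : q ^ 2 + 1 ≠ 0)
    (hY : Y.Satisfies q ρ) {σ τ : ℂ⟦X⟧} (hσ : constantCoeff σ = 0) (hτ : constantCoeff τ = 0) :
    (C (q - q⁻¹) : ℂ⟦X⟧) • (psEval τ (withConst q ρ Y.g) * psEval σ (withConst q ρ Y.gt) -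
        psEval σ (withConst q ρ Y.g) * psEval τ (withConst q ρ Y.gt)) =
      (C (ρ * (q + q⁻¹)) : ℂ⟦X⟧) • ((σ - τ) •
        (psEval σ Y.wm * psEval τ Y.wp - psEval τ Y.wp * psEval σ Y.wm)) := by
  have hm := sub_inv_ne hq h1
  have hp := add_inv_ne hq h2
  apply psLoc_injective
  have e := (currentValue_pairRel hY hσ hτ).g_mul_h_sub (currentValue_pointRel hm hp hY hσ)
    (currentValue_pointRel hm hp hY hτ)
  simp only [CurrentValue.map, currentValue, ← map_mul, ← map_sub] at e
  have e1 : locC q - (locC q)⁻¹ = locC (q - q⁻¹) := by rw [locC_inv]; simp [locC]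
  have e2 : locC ρ * (locC q + (locC q)⁻¹) = locC (ρ * (q + q⁻¹)) := by
    rw [locC_inv]; simp [locC]
  rw [psLoc_C_smul, psLoc_C_smul, psLoc_smul, ← e1, e, e2, smul_smul]

/-- The exchange relation between `G` and `G̃`. -/
theorem g_mul_gt_sub (hq : q ≠ 0) (h1 : q ^ 2 - 1 ≠ 0) (h2 : q ^ 2 + 1 ≠ 0)
    (hY : Y.Satisfies q ρ) (i j : ℕ) :
    (q - q⁻¹) • (Y.g j * Y.gt i - Y.g i * Y.gt j) =
      (ρ * (q + q⁻¹)) • (aComm (Y.wm i) (Y.wp (j + 1)) - aComm (Y.wm (i + 1)) (Y.wp j)) := by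
  have key := array_eq_of_psEval₂_eq (R := R)
    (M := fun i j => (q - q⁻¹) • (withConst q ρ Y.g j * withConst q ρ Y.gt i -
      withConst q ρ Y.g i * withConst q ρ Y.gt j))
    (M' := fun i j => (ρ * (q + q⁻¹)) • (aComm (shiftSeq Y.wm i) (Y.wp j) -
      aComm (Y.wm i) (shiftSeq Y.wp j))) ?_ (i + 1) (j + 1)
  · exact key
  intro c _
  have hσ : constantCoeff (C c * X : ℂ⟦X⟧) = 0 := by simp
  have hτ : constantCoeff (X : ℂ⟦X⟧) = 0 := by simp
  have hsm : ∀ (d : ℂ) (M : ℕ → ℕ → R), psEval₂ (C c * X) X (fun i j => d • M i j) =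
      (C d : ℂ⟦X⟧) • psEval₂ (C c * X) X M := by
    intro d M
    ext n
    rw [coeff_C_ps_smul, coeff_psEval₂_C_mul_X, coeff_psEval₂_C_mul_X, Finset.smul_sum]
    exact Finset.sum_congr rfl fun _ _ => smul_comm _ _ _
  rw [hsm, hsm, psEval₂_sub, psEval₂_sub, ← psEval_mul hσ hτ, psEval₂_swap, ← psEval_mul hτ hσ,
    ← psEval_commutator hσ hτ, ← psEval_commutator hσ hτ, psEval_shiftSeq hσ, psEval_shiftSeq hτ]
  rw [smul_mul_assoc, mul_smul_comm, smul_mul_assoc, mul_smul_comm, ← smul_sub, ← smul_sub,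
    ← sub_smul]
  exact psEval_g_mul_gt_sub hq h1 h2 hY hσ hτ

/-- The pairs `(i, j)` that occur in the first sum of the quadratic combination. -/
def indexA (k : ℕ) : Finset (ℕ × ℕ) :=
  (Finset.range (k + 1) ×ˢ Finset.range (k + 1)).filter
    fun p => p.1 + p.2 ≤ k ∧ (p.1 + p.2) % 2 = k % 2

/-- The pairs `(i, j)` that occur in the second sum of the quadratic combination. -/
def indexF (k : ℕ) : Finset (ℕ × ℕ) :=
  (Finset.range (k + 1) ×ˢ Finset.range (k + 1)).filter
    fun p => p.1 ≤ p.2 ∧ p.1 + p.2 < k ∧ (p.1 + p.2) % 2 ≠ k % 2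

theorem mem_indexA {k : ℕ} {p : ℕ × ℕ} :
    p ∈ indexA k ↔ p.1 + p.2 ≤ k ∧ (p.1 + p.2) % 2 = k % 2 := by
  simp only [indexA, Finset.mem_filter, Finset.mem_product, Finset.mem_range]
  omega

theorem mem_indexF {k : ℕ} {p : ℕ × ℕ} :
    p ∈ indexF k ↔ p.1 ≤ p.2 ∧ p.1 + p.2 < k ∧ (p.1 + p.2) % 2 ≠ k % 2 := by
  simp only [indexF, Finset.mem_filter, Finset.mem_product, Finset.mem_range]
  omega

theorem indexA_eq (k : ℕ) : indexA k = (Finset.range (k / 2 + 1)).biUnion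
    fun l => Finset.HasAntidiagonal.antidiagonal (2 * l + 1 - kbar k) := by
  ext p
  simp only [mem_indexA, Finset.mem_biUnion, Finset.mem_range,
    Finset.HasAntidiagonal.mem_antidiagonal, kbar, Nat.even_iff]
  constructor
  · intro h
    refine ⟨(p.1 + p.2) / 2, ?_⟩
    split_ifs <;> omega
  · rintro ⟨l, h⟩
    split_ifs at h <;> omega

theorem indexF_eq (k : ℕ) : indexF k = (Finset.range (k / 2 + 1 - kbar k)).biUnion
    fun l => (Finset.HasAntidiagonal.antidiagonal (2 * l + kbar k)).filter
      fun p => p.1 ≤ p.2 := by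
  ext p
  simp only [mem_indexF, Finset.mem_biUnion, Finset.mem_range, Finset.mem_filter,
    Finset.HasAntidiagonal.mem_antidiagonal, kbar, Nat.even_iff]
  constructor
  · intro h
    refine ⟨(p.1 + p.2) / 2, ?_⟩
    split_ifs <;> omega
  · rintro ⟨l, h⟩
    split_ifs at h <;> omega

theorem quadComb_eq (q ρ : ℂ) (k : ℕ) (c : QuadCoeffs) (Y : CurrentFamily R) :
    quadComb q ρ k c Y = ∑ p ∈ indexA k, termA c Y p.1 p.2 +
      ∑ p ∈ indexF k, termF q ρ c Y p.1 p.2 := by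
  have hk : kbar k ≤ 1 := by unfold kbar; split_ifs <;> omega
  rw [quadComb, indexA_eq, indexF_eq, Finset.sum_biUnion, Finset.sum_biUnion]
  · intro a _ b _ hab
    rw [Function.onFun, Finset.disjoint_left]
    intro p hp hp'
    simp only [Finset.mem_filter, Finset.HasAntidiagonal.mem_antidiagonal] at hp hp'
    omega
  · intro a _ b _ hab
    rw [Function.onFun, Finset.disjoint_left]
    intro p hp hp'
    simp only [Finset.HasAntidiagonal.mem_antidiagonal] at hp hp'
    omega

/-- The sum of two coefficient systems. -/
def QuadCoeffs.add (c c' : QuadCoeffs) : QuadCoeffs where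
  a i j := c.a i j + c'.a i j
  b i j := c.b i j + c'.b i j
  e i j := c.e i j + c'.e i j

/-- A scalar multiple of a coefficient system. -/
def QuadCoeffs.smul (r : ℂ) (c : QuadCoeffs) : QuadCoeffs where
  a i j := r * c.a i j
  b i j := r * c.b i j
  e i j := r * c.e i j

theorem quadComb_add (q ρ : ℂ) (k : ℕ) (c c' : QuadCoeffs) (Y : CurrentFamily R) :
    quadComb q ρ k (c.add c') Y = quadComb q ρ k c Y + quadComb q ρ k c' Y := by
  simp only [quadComb_eq]
  rw [add_add_add_comm, ← Finset.sum_add_distrib, ← Finset.sum_add_distrib]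
  congr 1
  · refine Finset.sum_congr rfl fun p _ => ?_
    simp only [termA, QuadCoeffs.add]
    module
  · refine Finset.sum_congr rfl fun p _ => ?_
    simp only [termF, QuadCoeffs.add, add_smul]

theorem quadComb_smul (q ρ : ℂ) (k : ℕ) (r : ℂ) (c : QuadCoeffs) (Y : CurrentFamily R) :
    quadComb q ρ k (c.smul r) Y = r • quadComb q ρ k c Y := by
  simp only [quadComb_eq, smul_add, Finset.smul_sum]
  congr 1
  · refine Finset.sum_congr rfl fun p _ => ?_
    simp only [termA, QuadCoeffs.smul]
    module
  · refine Finset.sum_congr rfl fun p _ => ?_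
    simp only [termF, QuadCoeffs.smul, mul_smul]

theorem quadComb_zero (q ρ : ℂ) (k : ℕ) (Y : CurrentFamily R) :
    quadComb q ρ k ⟨fun _ _ => 0, fun _ _ => 0, fun _ _ => 0⟩ Y = 0 := by
  simp [quadComb_eq, termA, termF]

/-- The sums of quadratic combinations and elements of `Z`. -/
def quadSpan (q ρ : ℂ) (k : ℕ) (Y : CurrentFamily R) (Z : Submodule ℂ R) : Submodule ℂ R where
  carrier := {y | ∃ c, ∃ z ∈ Z, y = quadComb q ρ k c Y + z}
  zero_mem' := ⟨_, 0, Z.zero_mem, by rw [quadComb_zero, add_zero]⟩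
  add_mem' := by
    rintro _ _ ⟨c, z, hz, rfl⟩ ⟨c', z', hz', rfl⟩
    exact ⟨c.add c', z + z', Z.add_mem hz hz', by rw [quadComb_add]; abel⟩
  smul_mem' := by
    rintro r _ ⟨c, z, hz, rfl⟩
    exact ⟨c.smul r, r • z, Z.smul_mem r hz, by rw [quadComb_smul, smul_add]⟩

variable {Z : Submodule ℂ R} {k : ℕ}

theorem le_quadSpan : Z ≤ quadSpan q ρ k Y Z := fun z hz =>
  ⟨_, z, hz, by rw [quadComb_zero, zero_add]⟩

theorem wm_mul_wp_mem {i j : ℕ} (h : i + j ≤ k) (h' : (i + j) % 2 = k % 2) :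
    Y.wm i * Y.wp j ∈ quadSpan q ρ k Y Z := by
  refine ⟨⟨fun i' j' => if (i', j') = (i, j) then 1 else 0, fun _ _ => 0, fun _ _ => 0⟩, 0,
    Z.zero_mem, ?_⟩
  have hm : (i, j) ∈ indexA k := mem_indexA.2 ⟨h, h'⟩
  rw [quadComb_eq]
  simp [termA, termF, hm]

theorem wp_mul_wm_mem {i j : ℕ} (h : i + j ≤ k) (h' : (i + j) % 2 = k % 2) :
    Y.wp i * Y.wm j ∈ quadSpan q ρ k Y Z := by
  refine ⟨⟨fun _ _ => 0, fun i' j' => if (i', j') = (i, j) then 1 else 0, fun _ _ => 0⟩, 0,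
    Z.zero_mem, ?_⟩
  have hm : (i, j) ∈ indexA k := mem_indexA.2 ⟨h, h'⟩
  rw [quadComb_eq]
  simp [termA, termF, hm]

theorem quadF_mem {i j : ℕ} (hij : i ≤ j) (h : i + j < k) (h' : (i + j) % 2 ≠ k % 2) :
    (q ^ 2) • (Y.wm i * Y.wm j) + (q⁻¹ ^ 2) • (Y.wp i * Y.wp j) + (1 / ρ) • (Y.g j * Y.gt i) ∈
      quadSpan q ρ k Y Z := by
  refine ⟨⟨fun _ _ => 0, fun _ _ => 0, fun i' j' => if (i', j') = (i, j) then 1 else 0⟩, 0,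
    Z.zero_mem, ?_⟩
  have hm : (i, j) ∈ indexF k := mem_indexF.2 ⟨hij, h, h'⟩
  rw [quadComb_eq]
  simp only [termF, termA, zero_smul, add_zero, Finset.sum_const_zero, zero_add]
  rw [Finset.sum_eq_single (i, j)]
  · simp
  · intro p _ hp
    rw [if_neg hp, zero_smul]
  · exact fun h => absurd hm h

theorem quadSpan_mono {j : ℕ} (h : j ≤ k) (h' : j % 2 = k % 2) :
    quadSpan q ρ j Y Z ≤ quadSpan q ρ k Y Z := by
  rintro _ ⟨c, z, hz, rfl⟩
  rw [quadComb_eq]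
  refine Submodule.add_mem _ (Submodule.add_mem _ (Submodule.sum_mem _ fun p hp => ?_)
    (Submodule.sum_mem _ fun p hp => ?_)) (le_quadSpan hz)
  · have := mem_indexA.1 hp
    exact Submodule.add_mem _ (Submodule.smul_mem _ _ (wm_mul_wp_mem (by omega) (by omega)))
      (Submodule.smul_mem _ _ (wp_mul_wm_mem (by omega) (by omega)))
  · have := mem_indexF.1 hp
    exact Submodule.smul_mem _ _ (quadF_mem this.1 (by omega) (by omega))

theorem commutator_mem {i j : ℕ} (h : i + j ≤ k) (h' : (i + j) % 2 = k % 2) :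
    aComm (Y.wm i) (Y.wp j) ∈ quadSpan q ρ k Y Z :=
  Submodule.sub_mem _ (wm_mul_wp_mem h h') (wp_mul_wm_mem (by omega) (by omega))

/-- The second sum contains `G_{j+1} G̃_{i+1}` only for `i ≤ j`. The opposite order differs from it
by commutators of `W` currents of total index `i + j + 1`, which belong to the first sum. -/
theorem quadF_mem' (hq : q ≠ 0) (h1 : q ^ 2 - 1 ≠ 0) (h2 : q ^ 2 + 1 ≠ 0)
    (hY : Y.Satisfies q ρ) {i j : ℕ} (h : i + j < k) (h' : (i + j) % 2 ≠ k % 2) :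
    (q ^ 2) • (Y.wm i * Y.wm j) + (q⁻¹ ^ 2) • (Y.wp i * Y.wp j) + ρ⁻¹ • (Y.g i * Y.gt j) ∈
      quadSpan q ρ k Y Z := by
  have hmm : ∀ i j, Y.wm i * Y.wm j = Y.wm j * Y.wm i := fun i j => sub_eq_zero.1 (hY _ _ (.wm_wm i j))
  have hpp : ∀ i j, Y.wp i * Y.wp j = Y.wp j * Y.wp i := fun i j => sub_eq_zero.1 (hY _ _ (.wp_wp i j))
  rcases le_total j i with hij | hij
  · rw [hmm, hpp, ← one_div ρ]
    exact quadF_mem (k := k) (i := j) (j := i) hij (by omega) (by omega)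
  · have e := g_mul_gt_sub hq h1 h2 hY i j
    have e' : Y.g i * Y.gt j = Y.g j * Y.gt i - ((q - q⁻¹)⁻¹ * (ρ * (q + q⁻¹))) •
        (aComm (Y.wm i) (Y.wp (j + 1)) - aComm (Y.wm (i + 1)) (Y.wp j)) := by
      rw [mul_smul, ← e, inv_smul_smul₀ (sub_inv_ne hq h1), sub_sub_cancel]
    rw [e', smul_sub, ← add_sub_assoc, ← one_div ρ]
    exact Submodule.sub_mem _ (quadF_mem hij h h') (Submodule.smul_mem _ _ (Submodule.smul_mem _ _
      (Submodule.sub_mem _ (commutator_mem (by omega) (by omega))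
        (commutator_mem (by omega) (by omega)))))
end

/-! ### Solving the central coefficients for `G`. -/

section
variable {R : Type*} [Ring R] [Algebra ℂ R] {q ρ : ℂ} {Y : CurrentFamily R}

/-- The coefficient of `s^i t^j` at the parameter power `n`. -/
noncomputable def curveCoeff (q : ℂ) (n i j : ℕ) : ℂ := coeff n (curveS q ^ i * curveT q ^ j)

theorem coeff_centralSeries (q ρ : ℂ) (Y : CurrentFamily R) (n : ℕ) :
    coeff n (centralSeries q ρ Y) =
      (∑ i ∈ Finset.range (n + 1), ∑ j ∈ Finset.range (n + 1), curveCoeff q n (i + 1) (j + 1) •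
        ((q ^ 2) • (Y.wm i * Y.wm j) + (q⁻¹ ^ 2) • (Y.wp i * Y.wp j)))
      + ρ⁻¹ • (∑ i ∈ Finset.range (n + 1 + 1), ∑ j ∈ Finset.range (n + 1 + 1), curveCoeff q n i j •
        (withConst q ρ Y.g i * withConst q ρ Y.gt j))
      - (∑ i ∈ Finset.range (n + 1), ∑ j ∈ Finset.range (n + 1),
        ((q - q⁻¹)⁻¹ * (q * curveCoeff q n i (j + 1) - q⁻¹ * curveCoeff q n (i + 1) j)) •
          (Y.wm i * Y.wp j))
      - ∑ i ∈ Finset.range (n + 1), ∑ j ∈ Finset.range (n + 1),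
        ((q - q⁻¹)⁻¹ * (q * curveCoeff q n (i + 1) j - q⁻¹ * curveCoeff q n i (j + 1))) •
          (Y.wp i * Y.wm j) := by
  have hS := constantCoeff_curveS q
  have hT := constantCoeff_curveT q
  have h1 : n < n + 1 := n.lt_succ_self
  have h2 : n < n + 1 + 1 := by omega
  rw [centralSeries]
  simp only [psEval_mul hS hT]
  rw [map_sub, map_sub, map_add, coeff_C_ps_smul ρ⁻¹, coeff_psEval₂ hS hT _ h2, smul_add, map_add,
    smul_comm _ (C (q ^ 2) : ℂ⟦X⟧), coeff_C_ps_smul (q ^ 2), smul_comm _ (C (q⁻¹ ^ 2) : ℂ⟦X⟧),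
    coeff_C_ps_smul (q⁻¹ ^ 2), coeff_smul_psEval₂ hS hT _ _ h1, coeff_smul_psEval₂ hS hT _ _ h1,
    coeff_smul_psEval₂ hS hT _ _ h1, coeff_smul_psEval₂ hS hT _ _ h1]
  congr 1
  · congr 1
    · congr 1
      simp only [Finset.smul_sum, ← Finset.sum_add_distrib]
      refine Finset.sum_congr rfl fun i _ => Finset.sum_congr rfl fun j _ => ?_
      rw [curveCoeff, show curveS q ^ (i + 1) * curveT q ^ (j + 1) = curveS q * curveT q *
        (curveS q ^ i * curveT q ^ j) by ring]
      module
    · refine Finset.sum_congr rfl fun i _ => Finset.sum_congr rfl fun j _ => ?_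
      congr 1
      rw [show C (q - q⁻¹)⁻¹ * (C q * curveT q - C q⁻¹ * curveS q) * (curveS q ^ i * curveT q ^ j)
        = C (q - q⁻¹)⁻¹ * (C q * (curveS q ^ i * curveT q ^ (j + 1)) -
          C q⁻¹ * (curveS q ^ (i + 1) * curveT q ^ j)) by ring, coeff_C_mul, map_sub, coeff_C_mul,
        coeff_C_mul]
      rfl
  · refine Finset.sum_congr rfl fun i _ => Finset.sum_congr rfl fun j _ => ?_
    congr 1
    rw [show C (q - q⁻¹)⁻¹ * (C q * curveS q - C q⁻¹ * curveT q) * (curveS q ^ i * curveT q ^ j)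
      = C (q - q⁻¹)⁻¹ * (C q * (curveS q ^ (i + 1) * curveT q ^ j) -
        C q⁻¹ * (curveS q ^ i * curveT q ^ (j + 1))) by ring, coeff_C_mul, map_sub, coeff_C_mul,
      coeff_C_mul]
    rfl

theorem curveCoeff_ne (hq : q ≠ 0) {n i j : ℕ} (h : curveCoeff q n i j ≠ 0) :
    i + j ≤ n ∧ (i + j) % 2 = n % 2 := by
  constructor
  · by_contra! hn
    exact h (coeff_pow_mul_pow_eq_zero (constantCoeff_curveS q) (constantCoeff_curveT q) hn)
  · by_contra hn
    refine h (coeff_curve_pow_of_odd hq ?_)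
    rw [Nat.odd_iff]
    omega

/-- The leading coefficients of `t^n` and `s^n` are `(q² + 1)^n` and `(q² + 1)^n / q^{2n}`. -/
theorem lead_ne (hq : q ≠ 0) (h2 : q ^ 2 + 1 ≠ 0) {n : ℕ} (hn : q ^ (2 * n) + 1 ≠ 0) :
    curveCoeff q n 0 n + curveCoeff q n n 0 ≠ 0 := by
  have e1 := coeff_curve_pow q 0 n
  have e2 := coeff_curve_pow q n 0
  rw [zero_add] at e1
  rw [add_zero] at e2
  rw [curveCoeff, curveCoeff, e1, e2, pow_zero, pow_zero, one_mul, mul_one, div_pow, ← pow_mul]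
  have : (q ^ 2 + 1) ^ n + (q ^ 2 + 1) ^ n / q ^ (2 * n) =
      (q ^ 2 + 1) ^ n * (q ^ (2 * n) + 1) / q ^ (2 * n) := by
    field_simp
  rw [this]
  exact div_ne_zero (mul_ne_zero (pow_ne_zero _ h2) hn) (pow_ne_zero _ hq)

/-- Each `G` is a quadratic combination of earlier generators up to an element of `Z`. -/
theorem g_mem_quadSpan (hq : q ≠ 0) (h1 : q ^ 2 - 1 ≠ 0) (h2 : q ^ 2 + 1 ≠ 0) (hρ : ρ ≠ 0)
    (hn : ∀ n, q ^ (2 * n) + 1 ≠ 0) (hY : Y.Satisfies q ρ) {Z : Submodule ℂ R}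
    (hZ1 : 1 ∈ Z) (hZ : ∀ n, coeff n (centralSeries q ρ Y) ∈ Z) (k : ℕ) :
    Y.g k ∈ quadSpan q ρ k Y Z := by
  induction k using Nat.strong_induction_on with
  | _ k ih =>
  have hT : ∀ {c : ℂ} {y : R}, (c ≠ 0 → y ∈ quadSpan q ρ k Y Z) → c • y ∈ quadSpan q ρ k Y Z := by
    intro c y h
    rcases eq_or_ne c 0 with rfl | hc
    · rw [zero_smul]; exact Submodule.zero_mem _
    · exact Submodule.smul_mem _ _ (h hc)
  have hgt : ∀ j, Y.gt j = Y.g j + (q + q⁻¹) • aComm (Y.wm 0) (Y.wp j) := fun j => by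
    rw [hY _ _ (.w0_wp j), smul_smul, mul_one_div_cancel (add_inv_ne hq h2), one_smul,
      add_sub_cancel]
  set g0 := ρ / (q - q⁻¹) with hg0
  have g0ne : g0 ≠ 0 := div_ne_zero hρ (sub_inv_ne hq h1)
  have hφ : coeff (k + 1) (centralSeries q ρ Y) ∈ quadSpan q ρ k Y Z := le_quadSpan (hZ (k + 1))
  set κ := curveCoeff q (k + 1) with hκ
  have hκne : ∀ {i j}, κ i j ≠ 0 → i + j ≤ k + 1 ∧ (i + j) % 2 = (k + 1) % 2 :=
    fun h => curveCoeff_ne hq h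
  -- The part of the central coefficient that is linear in `G` and `G̃`. It arises from the products
  -- with `G_0` or `G̃_0`, that is, from row and column zero of the double sum, split off in `eGH`.
  have lin : ∑ j ∈ Finset.range (k + 1 + 1), (κ 0 (j + 1) • Y.gt j + κ (j + 1) 0 • Y.g j) ∈
      quadSpan q ρ k Y Z := by
    have e := coeff_centralSeries q ρ Y (k + 1)
    simp only [← hκ] at e
    set L := ∑ j ∈ Finset.range (k + 1 + 1), (κ 0 (j + 1) • Y.gt j + κ (j + 1) 0 • Y.g j) with hL
    have eGH : ∑ i ∈ Finset.range (k + 1 + 1 + 1), ∑ j ∈ Finset.range (k + 1 + 1 + 1), κ i j •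
        (withConst q ρ Y.g i * withConst q ρ Y.gt j) =
        (∑ i ∈ Finset.range (k + 1 + 1), ∑ j ∈ Finset.range (k + 1 + 1), κ (i + 1) (j + 1) •
          (Y.g i * Y.gt j)) + g0 • L + (g0 * (κ 0 0 * g0)) • (1 : R) := by
      simp only [Finset.sum_range_succ' _ (k + 1 + 1), Finset.sum_add_distrib, withConst, ← hg0, hL,
        Finset.smul_sum, smul_add, ← Algebra.commutes g0, ← Algebra.smul_def]
      rw [Algebra.algebraMap_eq_smul_one, smul_smul, mul_smul g0 (κ 0 0 * g0)]
      simp only [smul_comm _ g0, add_assoc]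
      abel
    rw [eGH] at e
    refine (Submodule.smul_mem_iff _ (mul_ne_zero (inv_ne_zero hρ) g0ne)).1 ?_
    have e' : (ρ⁻¹ * g0) • L = coeff (k + 1) (centralSeries q ρ Y)
        - (∑ i ∈ Finset.range (k + 1 + 1), ∑ j ∈ Finset.range (k + 1 + 1), κ (i + 1) (j + 1) •
          ((q ^ 2) • (Y.wm i * Y.wm j) + (q⁻¹ ^ 2) • (Y.wp i * Y.wp j) + ρ⁻¹ • (Y.g i * Y.gt j)))
        - (ρ⁻¹ * (g0 * (κ 0 0 * g0))) • (1 : R)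
        + (∑ i ∈ Finset.range (k + 1 + 1), ∑ j ∈ Finset.range (k + 1 + 1),
          ((q - q⁻¹)⁻¹ * (q * κ i (j + 1) - q⁻¹ * κ (i + 1) j)) • (Y.wm i * Y.wp j))
        + ∑ i ∈ Finset.range (k + 1 + 1), ∑ j ∈ Finset.range (k + 1 + 1),
          ((q - q⁻¹)⁻¹ * (q * κ (i + 1) j - q⁻¹ * κ i (j + 1))) • (Y.wp i * Y.wm j) := by
      simp only [smul_add (κ _ _) (_ + _) _, Finset.sum_add_distrib, smul_comm (κ _ _) ρ⁻¹,
        ← Finset.smul_sum]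
      rw [e]
      module
    rw [e']
    refine Submodule.add_mem _ (Submodule.add_mem _ (Submodule.sub_mem _ (Submodule.sub_mem _ hφ
      ?_) (Submodule.smul_mem _ _ (le_quadSpan hZ1))) ?_) ?_
    · refine Submodule.sum_mem _ fun i _ => Submodule.sum_mem _ fun j _ => hT fun h => ?_
      have := hκne h
      exact quadF_mem' hq h1 h2 hY (by omega) (by omega)
    · refine Submodule.sum_mem _ fun i _ => Submodule.sum_mem _ fun j _ => hT fun h => ?_
      have : i + j ≤ k ∧ (i + j) % 2 = k % 2 := by
        by_contra hn
        refine h ?_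
        rw [not_imp_comm.1 (@hκne i (j + 1)) (by omega), not_imp_comm.1 (@hκne (i + 1) j) (by omega)]
        ring
      exact wm_mul_wp_mem this.1 this.2
    · refine Submodule.sum_mem _ fun i _ => Submodule.sum_mem _ fun j _ => hT fun h => ?_
      have : i + j ≤ k ∧ (i + j) % 2 = k % 2 := by
        by_contra hn
        refine h ?_
        rw [not_imp_comm.1 (@hκne i (j + 1)) (by omega), not_imp_comm.1 (@hκne (i + 1) j) (by omega)]
        ring
      exact wp_mul_wm_mem this.1 this.2
  -- The term with `j = k + 1` has degree `k + 2` and vanishes. The earlier ones are covered by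
  -- induction, and each `G̃` is replaced by `G` plus a multiple of a commutator `[W_0, W_{j+1}]`.
  have lin' : ∑ j ∈ Finset.range (k + 1 + 1), (κ 0 (j + 1) • Y.gt j + κ (j + 1) 0 • Y.g j) -
      (κ 0 (k + 1) + κ (k + 1) 0) • Y.g k ∈ quadSpan q ρ k Y Z := by
    rw [Finset.sum_range_succ, Finset.sum_range_succ,
      not_imp_comm.1 (@hκne 0 (k + 1 + 1)) (by omega), not_imp_comm.1 (@hκne (k + 1 + 1) 0) (by omega),
      zero_smul, zero_smul, add_zero, add_zero, add_sub_assoc]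
    refine Submodule.add_mem _ (Submodule.sum_mem _ fun j hj => ?_) ?_
    · have hj := Finset.mem_range.1 hj
      refine Submodule.add_mem _ (hT fun h => ?_) (hT fun h => ?_)
      · have := hκne h
        rw [hgt]
        exact Submodule.add_mem _ (quadSpan_mono (by omega) (by omega) (ih j hj))
          (Submodule.smul_mem _ _ (commutator_mem (by omega) (by omega)))
      · have := hκne h
        exact quadSpan_mono (by omega) (by omega) (ih j hj)
    · have : κ 0 (k + 1) • Y.gt k + κ (k + 1) 0 • Y.g k - (κ 0 (k + 1) + κ (k + 1) 0) • Y.g k =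
          (κ 0 (k + 1) * (q + q⁻¹)) • aComm (Y.wm 0) (Y.wp k) := by
        rw [hgt]; module
      rw [this]
      exact Submodule.smul_mem _ _ (commutator_mem (by omega) (by omega))
  have := Submodule.sub_mem _ lin lin'
  rw [sub_sub_cancel] at this
  exact (Submodule.smul_mem_iff _ (lead_ne hq h2 (hn _))).1 this
end

/-! ### Coefficients common to `G`, `G̃` and to all families. -/

section
variable {R : Type*} [Ring R] [Algebra ℂ R] {A : Type*} [Ring A] [Algebra ℂ A] {q ρ : ℂ}

/-- The image of a family under a map. -/
def CurrentFamily.map {R A : Type*} (f : R → A) (Y : CurrentFamily R) : CurrentFamily A where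
  wm k := f (Y.wm k)
  wp k := f (Y.wp k)
  g k := f (Y.g k)
  gt k := f (Y.gt k)

theorem CurrentRel.map (f : R →ₐ[ℂ] A) {Y : CurrentFamily R} {x y : R} (h : CurrentRel q ρ Y x y) :
    CurrentRel q ρ (Y.map f) (f x) (f y) := by
  cases h <;>
    simp only [aComm, qComm, map_add, map_sub, map_mul, map_smul, map_zero]
  case w0_wp k => exact .w0_wp k
  case wm_w1 k => exact .wm_w1 k
  case w0_g k => exact .w0_g k
  case gt_w0 k => exact .gt_w0 k
  case g_w1 k => exact .g_w1 k
  case w1_gt k => exact .w1_gt k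
  case wm_wm k l => exact .wm_wm k l
  case wp_wp k l => exact .wp_wp k l
  case wm_wp k l => exact .wm_wp k l
  case wm_g k l => exact .wm_g k l
  case wm_gt k l => exact .wm_gt k l
  case wp_g k l => exact .wp_g k l
  case wp_gt k l => exact .wp_gt k l
  case g_g k l => exact .g_g k l
  case gt_gt k l => exact .gt_gt k l
  case gt_g k l => exact .gt_g k l

theorem quadComb_map (f : R →ₐ[ℂ] A) (k : ℕ) (c : QuadCoeffs) (Y : CurrentFamily R) :
    f (quadComb q ρ k c Y) = quadComb q ρ k c (Y.map f) := by
  simp only [quadComb, termA, termF, map_add, map_sum, map_smul, map_mul, CurrentFamily.map]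

theorem withConst_map (f : R →ₐ[ℂ] A) (g : ℕ → R) (n : ℕ) :
    f (withConst q ρ g n) = withConst q ρ (fun k => f (g k)) n := by
  cases n <;> simp [withConst]

theorem coeff_centralSeries_map (f : R →ₐ[ℂ] A) (Y : CurrentFamily R) (n : ℕ) :
    f (coeff n (centralSeries q ρ Y)) = coeff n (centralSeries q ρ (Y.map f)) := by
  simp only [coeff_centralSeries, map_add, map_sub, map_sum, map_smul, map_mul, withConst_map,
    CurrentFamily.map]

/-- The family in `R × R` formed by a family and its exchange. -/
def CurrentFamily.pair (Y : CurrentFamily R) : CurrentFamily (R × R) where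
  wm k := (Y.wm k, Y.wp k)
  wp k := (Y.wp k, Y.wm k)
  g k := (Y.g k, Y.gt k)
  gt k := (Y.gt k, Y.g k)

theorem CurrentFamily.Satisfies.pair {Y : CurrentFamily R} (hY : Y.Satisfies q ρ) :
    Y.pair.Satisfies q ρ := fun _ _ h =>
  Prod.ext (hY _ _ (h.map (AlgHom.fst ℂ R R))) (hY.swap _ _ (h.map (AlgHom.snd ℂ R R)))

theorem CurrentFamily.Commutes.add {Y : CurrentFamily R} {z z' : R} (h : Y.Commutes z)
    (h' : Y.Commutes z') : Y.Commutes (z + z') := fun k =>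
  ⟨(h k).1.add_left (h' k).1, (h k).2.1.add_left (h' k).2.1, (h k).2.2.1.add_left (h' k).2.2.1,
    (h k).2.2.2.add_left (h' k).2.2.2⟩

/-- The elements `(z, z)` of `R × R` where `z` commutes with the family. -/
def CurrentFamily.diagCentralizer (Y : CurrentFamily R) : Submodule ℂ (R × R) where
  carrier := {z | Y.Commutes z.1 ∧ z.2 = z.1}
  zero_mem' := ⟨fun _ => ⟨.zero_left _, .zero_left _, .zero_left _, .zero_left _⟩, rfl⟩
  add_mem' := by
    rintro z z' ⟨h, e⟩ ⟨h', e'⟩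
    exact ⟨h.add h', by rw [Prod.snd_add, Prod.fst_add, e, e']⟩
  smul_mem' := by
    rintro r z ⟨h, e⟩
    exact ⟨fun k => ⟨(h k).1.smul_left r, (h k).2.1.smul_left r, (h k).2.2.1.smul_left r,
      (h k).2.2.2.smul_left r⟩, by rw [Prod.smul_snd, Prod.smul_fst, e]⟩

/-- For each family that satisfies the relations the elements `G` and `G̃` are quadratic
combinations up to an element of the centralizer. -/
theorem exists_quadComb (hq : q ≠ 0) (h1 : q ^ 2 - 1 ≠ 0) (h2 : q ^ 2 + 1 ≠ 0) (hρ : ρ ≠ 0)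
    (hn : ∀ n, q ^ (2 * n) + 1 ≠ 0) {Y : CurrentFamily R} (hY : Y.Satisfies q ρ) (k : ℕ) :
    ∃ c z, Y.Commutes z ∧ Y.g k = quadComb q ρ k c Y + z ∧
      Y.gt k = quadComb q ρ k c Y.swap + z := by
  -- Working in `R × R` makes the coefficients for `G` and `G̃` coincide. The central coefficients
  -- lie on the diagonal because the series is exchange invariant, so one `z` serves both.
  obtain ⟨c, z, ⟨hz, hz'⟩, e⟩ := g_mem_quadSpan hq h1 h2 hρ hn hY.pair (Z := Y.diagCentralizer)
    ⟨fun k => ⟨.one_left _, .one_left _, .one_left _, .one_left _⟩, rfl⟩ (fun n => by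
      have e1 := coeff_centralSeries_map (q := q) (ρ := ρ) (AlgHom.fst ℂ R R) Y.pair n
      have e2 := coeff_centralSeries_map (q := q) (ρ := ρ) (AlgHom.snd ℂ R R) Y.pair n
      have e3 : Y.pair.map (AlgHom.fst ℂ R R) = Y := rfl
      have e4 : Y.pair.map (AlgHom.snd ℂ R R) = Y.swap := rfl
      rw [e3] at e1
      rw [e4, centralSeries_swap hq h1 h2 hρ hY] at e2
      refine ⟨?_, e2.trans e1.symm⟩
      rw [AlgHom.fst_apply] at e1
      rw [e1]
      exact centralSeries_commutes hq h1 h2 hρ hY n) k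
  refine ⟨c, z.1, hz, ?_, ?_⟩
  · have := congrArg (AlgHom.fst ℂ R R) e
    rw [map_add, quadComb_map] at this
    exact this
  · have := congrArg (AlgHom.snd ℂ R R) e
    rw [map_add, quadComb_map, show AlgHom.snd ℂ R R z = z.1 from hz'] at this
    exact this

/-- The values of a family on the names of the generators. -/
def CurrentFamily.onGen {A : Type*} (Y : CurrentFamily A) : CurrentGen → A
  | .wm k => Y.wm k
  | .wp k => Y.wp k
  | .g k => Y.g k
  | .gt k => Y.gt k

/-- The homomorphism from `O_q(sl₂^)` given by a family that satisfies the relations. -/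
noncomputable def CurrentFamily.Satisfies.lift {Y : CurrentFamily A} (hY : Y.Satisfies q ρ) :
    CurrentAlgebra q ρ →ₐ[ℂ] A :=
  RingQuot.liftAlgHom ℂ ⟨FreeAlgebra.lift ℂ Y.onGen, fun _ _ h => by
    have e : freeFamily.map (FreeAlgebra.lift ℂ Y.onGen) = Y := by
      simp only [CurrentFamily.map, freeFamily, FreeAlgebra.lift_ι_apply, CurrentFamily.onGen]
    have := h.map (FreeAlgebra.lift ℂ Y.onGen)
    rw [e] at this
    exact hY _ _ this⟩

theorem CurrentFamily.Satisfies.map_lift {Y : CurrentFamily A} (hY : Y.Satisfies q ρ) :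
    (currentGens q ρ).map hY.lift = Y := by
  have key : ∀ x, hY.lift (RingQuot.mkAlgHom ℂ (CurrentRel q ρ freeFamily)
      (FreeAlgebra.ι ℂ x)) = Y.onGen x := fun x =>
    (RingQuot.liftAlgHom_mkAlgHom_apply ..).trans (FreeAlgebra.lift_ι_apply ..)
  change CurrentFamily.mk _ _ _ _ = CurrentFamily.mk _ _ _ _
  congr 1 <;> funext k
  · exact key (.wm k)
  · exact key (.wp k)
  · exact key (.g k)
  · exact key (.gt k)

theorem CurrentFamily.Commutes.map {Y : CurrentFamily R} {z : R} (h : Y.Commutes z)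
    (f : R →ₐ[ℂ] A) : (Y.map f).Commutes (f z) := fun k =>
  ⟨(h k).1.map f, (h k).2.1.map f, (h k).2.2.1.map f, (h k).2.2.2.map f⟩

theorem mem_center_of_commutes {z : CurrentAlgebra q ρ} (h : (currentGens q ρ).Commutes z) :
    z ∈ Subalgebra.center ℂ (CurrentAlgebra q ρ) := by
  rw [Subalgebra.mem_center_iff]
  intro b
  obtain ⟨a, rfl⟩ := RingQuot.mkAlgHom_surjective ℂ (CurrentRel q ρ freeFamily) b
  change Commute _ z
  induction a using FreeAlgebra.induction with
  | grade0 r => rw [AlgHom.commutes]; exact Algebra.commutes r z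
  | grade1 x =>
    cases x with
    | wm k => exact (h k).1.symm
    | wp k => exact (h k).2.1.symm
    | g k => exact (h k).2.2.1.symm
    | gt k => exact (h k).2.2.2.symm
  | mul a b ha hb => rw [map_mul]; exact ha.mul_left hb
  | add a b ha hb => rw [map_add]; exact ha.add_left hb

/-- Coefficients that serve for all families that satisfy the relations. -/
theorem exists_universal_quadComb (hq : q ≠ 0) (h1 : q ^ 2 - 1 ≠ 0) (h2 : q ^ 2 + 1 ≠ 0)
    (hρ : ρ ≠ 0) (hn : ∀ n, q ^ (2 * n) + 1 ≠ 0) : ∃ c : ℕ → QuadCoeffs,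
      ∀ {A : Type} [Ring A] [Algebra ℂ A] {Y : CurrentFamily A}, Y.Satisfies q ρ → ∀ k,
        ∃ z, Y.Commutes z ∧ Y.g k = quadComb q ρ k (c k) Y + z ∧
          Y.gt k = quadComb q ρ k (c k) Y.swap + z := by
  -- The coefficients are fixed once in the presented algebra; every other solution is the image of
  -- its generators.
  choose c z hz e e' using exists_quadComb hq h1 h2 hρ hn (currentGens_satisfies q ρ)
  refine ⟨c, fun {A} _ _ {Y} hY k => ⟨hY.lift (z k), ?_, ?_, ?_⟩⟩
  · have := (hz k).map hY.lift
    rwa [hY.map_lift] at this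
  · have := congrArg hY.lift (e k)
    rw [map_add, quadComb_map, hY.map_lift] at this
    rw [← this]
    exact (congrArg (fun Y => CurrentFamily.g Y k) hY.map_lift).symm
  · have := congrArg hY.lift (e' k)
    have hs : (currentGens q ρ).swap.map hY.lift = Y.swap :=
      congrArg CurrentFamily.swap hY.map_lift
    rw [map_add, quadComb_map, hs] at this
    rw [← this]
    exact (congrArg (fun Y => CurrentFamily.gt Y k) hY.map_lift).symm
end

/-! ### Multiplication by a central series and prescribed constants. -/

section
variable {R : Type*} [Ring R] [Algebra ℂ R] {q ρ : ℂ}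

/-- The convolution of two sequences. -/
def conv (f a : ℕ → R) (k : ℕ) : R :=
  ∑ p ∈ Finset.HasAntidiagonal.antidiagonal k, f p.1 * a p.2

theorem conv_add (f a b : ℕ → R) (k : ℕ) :
    conv f (fun i => a i + b i) k = conv f a k + conv f b k := by
  simp only [conv, mul_add, Finset.sum_add_distrib]

theorem conv_sub (f a b : ℕ → R) (k : ℕ) :
    conv f (fun i => a i - b i) k = conv f a k - conv f b k := by
  simp only [conv, mul_sub, Finset.sum_sub_distrib]

theorem conv_smul (f a : ℕ → R) (c : ℂ) (k : ℕ) :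
    conv f (fun i => c • a i) k = c • conv f a k := by
  simp only [conv, mul_smul_comm, Finset.smul_sum]

theorem conv_zero (f a : ℕ → R) : conv f a 0 = f 0 * a 0 := by
  simp [conv]

theorem conv_succ (f a : ℕ → R) (k : ℕ) :
    conv f a (k + 1) = conv f (fun i => a (i + 1)) k + f (k + 1) * a 0 := by
  rw [conv, Finset.Nat.sum_antidiagonal_succ', add_comm]
  rfl

theorem conv_congr {f f' : ℕ → R} (a : ℕ → R) {k : ℕ} (h : ∀ i, i ≤ k → f i = f' i) :
    conv f a k = conv f' a k := by
  refine Finset.sum_congr rfl fun p hp => ?_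
  have := Finset.HasAntidiagonal.mem_antidiagonal.1 hp
  rw [h p.1 (by omega)]

variable {f : ℕ → R}

theorem mul_conv (hf : ∀ i x, f i * x = x * f i) (w : R) (a : ℕ → R) (k : ℕ) :
    w * conv f a k = conv f (fun i => w * a i) k := by
  rw [conv, Finset.mul_sum]
  refine Finset.sum_congr rfl fun p _ => ?_
  rw [← mul_assoc, ← hf, mul_assoc]

theorem conv_mul (w : R) (a : ℕ → R) (k : ℕ) :
    conv f a k * w = conv f (fun i => a i * w) k := by
  rw [conv, Finset.sum_mul]
  exact Finset.sum_congr rfl fun p _ => mul_assoc _ _ _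

theorem aComm_conv_conv (hf : ∀ i x, f i * x = x * f i) (a b : ℕ → R) (k l : ℕ) :
    aComm (conv f a k) (conv f b l) = conv f (fun i => conv f (fun j => aComm (a i) (b j)) l) k := by
  have e1 : conv f a k * conv f b l = conv f (fun i => conv f (fun j => a i * b j) l) k := by
    rw [conv_mul]
    congr 1
    funext i
    exact mul_conv hf _ _ _
  have e2 : conv f b l * conv f a k = conv f (fun i => conv f (fun j => b j * a i) l) k := by
    rw [mul_conv hf]
    congr 1
    funext i
    exact conv_mul _ _ _
  simp only [aComm, conv_sub, e1, e2]

theorem aComm_conv_eq_zero (hf : ∀ i x, f i * x = x * f i) {a b : ℕ → R}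
    (h : ∀ i j, aComm (a i) (b j) = 0) (k l : ℕ) : aComm (conv f a k) (conv f b l) = 0 := by
  rw [aComm_conv_conv hf]
  simp [h, conv]

theorem aComm_conv_add_eq_zero (hf : ∀ i x, f i * x = x * f i) {a b a' b' : ℕ → R}
    (h : ∀ i j, aComm (a i) (b j) + aComm (a' i) (b' j) = 0) (k l : ℕ) :
    aComm (conv f a k) (conv f b l) + aComm (conv f a' k) (conv f b' l) = 0 := by
  simp only [aComm_conv_conv hf, ← conv_add, h]
  simp [conv]

/-- The multiple of the currents by the generating function of `f`. -/
noncomputable def CurrentFamily.twist (q ρ : ℂ) (f : ℕ → R) (Y : CurrentFamily R) :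
    CurrentFamily R where
  wm := conv f Y.wm
  wp := conv f Y.wp
  g k := conv f Y.g k + (ρ / (q - q⁻¹)) • f (k + 1)
  gt k := conv f Y.gt k + (ρ / (q - q⁻¹)) • f (k + 1)

theorem aComm_add_central_left {z : R} (hz : ∀ x, z * x = x * z) (y x : R) :
    aComm (y + z) x = aComm y x := by
  simp only [aComm, add_mul, mul_add, hz]
  abel

theorem aComm_add_central_right {z : R} (hz : ∀ x, z * x = x * z) (y x : R) :
    aComm x (y + z) = aComm x y := by
  simp only [aComm, add_mul, mul_add, hz]
  abel

theorem qComm_conv_left (hq : q - q⁻¹ ≠ 0) (hf : ∀ i x, f i * x = x * f i) {w : R}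
    {a b c : ℕ → R} (hw : w = b 0) (h : ∀ k, qComm q w (a k) = ρ • b (k + 1) - ρ • c k) (k : ℕ) :
    qComm q w (conv f a k + (ρ / (q - q⁻¹)) • f (k + 1)) =
      ρ • conv f b (k + 1) - ρ • conv f c k := by
  have e : q • conv f (fun i => w * a i) k - q⁻¹ • conv f (fun i => a i * w) k =
      ρ • conv f (fun i => b (i + 1)) k - ρ • conv f c k := by
    rw [← conv_smul, ← conv_smul, ← conv_smul, ← conv_smul, ← conv_sub, ← conv_sub]
    congr 1
    funext i
    exact h i
  -- The `q`-commutator of `w` with the added multiple of `f (k + 1)` is `ρ f (k + 1) w`, the term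
  -- by which the shifted convolution falls short of `conv f b (k + 1)`.
  have e2 : ρ = q * (ρ / (q - q⁻¹)) - q⁻¹ * (ρ / (q - q⁻¹)) := by
    rw [← sub_mul, mul_div_cancel₀ _ hq]
  rw [conv_succ, ← hw, qComm, mul_add, add_mul, mul_conv hf, conv_mul, mul_smul_comm,
    smul_mul_assoc, hf (k + 1) w]
  linear_combination (norm := module) e - e2 • (w * f (k + 1))

theorem qComm_conv_right (hq : q - q⁻¹ ≠ 0) (hf : ∀ i x, f i * x = x * f i) {w : R}
    {a b c : ℕ → R} (hw : w = b 0) (h : ∀ k, qComm q (a k) w = ρ • b (k + 1) - ρ • c k) (k : ℕ) :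
    qComm q (conv f a k + (ρ / (q - q⁻¹)) • f (k + 1)) w =
      ρ • conv f b (k + 1) - ρ • conv f c k := by
  have e : q • conv f (fun i => a i * w) k - q⁻¹ • conv f (fun i => w * a i) k =
      ρ • conv f (fun i => b (i + 1)) k - ρ • conv f c k := by
    rw [← conv_smul, ← conv_smul, ← conv_smul, ← conv_smul, ← conv_sub, ← conv_sub]
    congr 1
    funext i
    exact h i
  have e2 : ρ = q * (ρ / (q - q⁻¹)) - q⁻¹ * (ρ / (q - q⁻¹)) := by
    rw [← sub_mul, mul_div_cancel₀ _ hq]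
  rw [conv_succ, ← hw, qComm, mul_add, add_mul, mul_conv hf, conv_mul, mul_smul_comm,
    smul_mul_assoc, hf (k + 1) w]
  linear_combination (norm := module) e - e2 • (w * f (k + 1))

/-- All relations are linear or bilinear in the currents, and a central series may be pulled out of
commutators. The condition `f 0 = 1` keeps `W_0` and `W_1`, and the term in `f (k + 1)` is the
contribution of `G_0`. -/
theorem CurrentFamily.Satisfies.twist {Y : CurrentFamily R} (hY : Y.Satisfies q ρ)
    (hq : q - q⁻¹ ≠ 0) (hf : ∀ i x, f i * x = x * f i) (hf0 : f 0 = 1) :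
    (Y.twist q ρ f).Satisfies q ρ := by
  have hc : ∀ k x, ((ρ / (q - q⁻¹)) • f (k + 1)) * x = x * ((ρ / (q - q⁻¹)) • f (k + 1)) :=
    fun k x => by rw [smul_mul_assoc, mul_smul_comm, hf]
  have hm0 : conv f Y.wm 0 = Y.wm 0 := by rw [conv_zero, hf0, one_mul]
  have hp0 : conv f Y.wp 0 = Y.wp 0 := by rw [conv_zero, hf0, one_mul]
  have hsub : ∀ k, (1 / (q + q⁻¹)) • (conv f Y.gt k - conv f Y.g k) =
      conv f (fun i => (1 / (q + q⁻¹)) • (Y.gt i - Y.g i)) k := fun k => by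
    rw [conv_smul, conv_sub]
  intro x y h
  cases h <;> simp only [CurrentFamily.twist, hm0, hp0, add_sub_add_right_eq_sub, hsub,
    aComm_add_central_left (hc _), aComm_add_central_right (hc _)]
  case w0_wp k =>
    rw [aComm, mul_conv hf, conv_mul, ← conv_sub]
    exact congrArg (conv f · k) (funext fun i => hY _ _ (.w0_wp i))
  case wm_w1 k =>
    rw [aComm, mul_conv hf, conv_mul, ← conv_sub]
    exact congrArg (conv f · k) (funext fun i => hY _ _ (.wm_w1 i))
  case w0_g k => exact qComm_conv_left hq hf rfl (fun k => hY _ _ (.w0_g k)) k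
  case gt_w0 k => exact qComm_conv_right hq hf rfl (fun k => hY _ _ (.gt_w0 k)) k
  case g_w1 k => exact qComm_conv_right hq hf rfl (fun k => hY _ _ (.g_w1 k)) k
  case w1_gt k => exact qComm_conv_left hq hf rfl (fun k => hY _ _ (.w1_gt k)) k
  case wm_wm k l => exact aComm_conv_eq_zero hf (fun i j => hY _ _ (.wm_wm i j)) k l
  case wp_wp k l => exact aComm_conv_eq_zero hf (fun i j => hY _ _ (.wp_wp i j)) k l
  case wm_wp k l => exact aComm_conv_add_eq_zero hf (fun i j => hY _ _ (.wm_wp i j)) k l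
  case wm_g k l => exact aComm_conv_add_eq_zero hf (fun i j => hY _ _ (.wm_g i j)) k l
  case wm_gt k l => exact aComm_conv_add_eq_zero hf (fun i j => hY _ _ (.wm_gt i j)) k l
  case wp_g k l => exact aComm_conv_add_eq_zero hf (fun i j => hY _ _ (.wp_g i j)) k l
  case wp_gt k l => exact aComm_conv_add_eq_zero hf (fun i j => hY _ _ (.wp_gt i j)) k l
  case g_g k l => exact aComm_conv_eq_zero hf (fun i j => hY _ _ (.g_g i j)) k l
  case gt_gt k l => exact aComm_conv_eq_zero hf (fun i j => hY _ _ (.gt_gt i j)) k l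
  case gt_g k l => exact aComm_conv_add_eq_zero hf (fun i j => hY _ _ (.gt_g i j)) k l

/-- Since `f 0 = 1`, the twisted `G` is the original one plus central multiples of earlier ones and
a central term, so induction recovers the original `G`. -/
theorem commutes_of_twist {Y : CurrentFamily R} (hY : Y.Satisfies q ρ) (hρ : ρ ≠ 0)
    (hq : q + q⁻¹ ≠ 0) (hf : ∀ i x, f i * x = x * f i) (hf0 : f 0 = 1) {z : R}
    (h : (Y.twist q ρ f).Commutes z) : Y.Commutes z := by
  refine hY.commutes hρ hq ?_ ?_ fun k => ?_
  · have := (h 0).1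
    simp only [CurrentFamily.twist] at this
    rwa [conv_zero, hf0, one_mul] at this
  · have := (h 0).2.1
    simp only [CurrentFamily.twist] at this
    rwa [conv_zero, hf0, one_mul] at this
  · induction k using Nat.strong_induction_on with
    | _ k ih =>
    have e := (h k).2.2.1
    have hfc : ∀ i, Commute z (f i) := fun i => (hf i z).symm
    simp only [CurrentFamily.twist] at e
    have e1 := e.sub_right ((hfc (k + 1)).smul_right (ρ / (q - q⁻¹)))
    rw [add_sub_cancel_right, conv, ← Finset.sum_erase_add _ _
      (Finset.HasAntidiagonal.mem_antidiagonal.2 (zero_add k) :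
        (0, k) ∈ Finset.HasAntidiagonal.antidiagonal k)] at e1
    have e2 : Commute z (∑ p ∈ (Finset.HasAntidiagonal.antidiagonal k).erase (0, k),
        f p.1 * Y.g p.2) := by
      refine Commute.sum_right _ _ _ fun p hp => (hfc _).mul_right (ih _ ?_)
      obtain ⟨hne, hp⟩ := Finset.mem_erase.1 hp
      have := Finset.HasAntidiagonal.mem_antidiagonal.1 hp
      by_contra hlt
      exact hne (Prod.ext (by simp only; omega) (by simp only; omega))
    have e3 := e1.sub_right e2
    rwa [add_sub_cancel_left, hf0, one_mul] at e3

theorem quadComb_congr {Y Y' : CurrentFamily R} {k : ℕ} (c : QuadCoeffs)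
    (hm : ∀ i, i ≤ k → Y.wm i = Y'.wm i) (hp : ∀ i, i ≤ k → Y.wp i = Y'.wp i)
    (hg : ∀ i, i < k → Y.g i = Y'.g i) (hh : ∀ i, i < k → Y.gt i = Y'.gt i) :
    quadComb q ρ k c Y = quadComb q ρ k c Y' := by
  rw [quadComb_eq, quadComb_eq]
  congr 1
  · refine Finset.sum_congr rfl fun p hp' => ?_
    have := mem_indexA.1 hp'
    rw [termA, termA, hm _ (by omega), hm p.2 (by omega), hp _ (by omega), hp p.1 (by omega)]
  · refine Finset.sum_congr rfl fun p hp' => ?_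
    have := mem_indexF.1 hp'
    rw [termF, termF, hm _ (by omega), hm p.2 (by omega), hp p.1 (by omega), hp p.2 (by omega),
      hg _ (by omega), hh _ (by omega)]

/-- The sequence with `f 0 = 1` and `f (k + 1) = Φ k (f 0, …, f k, 0, …)`. -/
def recSeq (Φ : ℕ → (ℕ → R) → R) : ℕ → R
  | 0 => 1
  | k + 1 => Φ k fun i => if _h : i < k + 1 then recSeq Φ i else 0

/-- The central multiple of the currents whose residual constants are prescribed. -/
theorem exists_twist (hq : q ≠ 0) (h1 : q ^ 2 - 1 ≠ 0) (h2 : q ^ 2 + 1 ≠ 0) (hρ : ρ ≠ 0)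
    {c : ℕ → QuadCoeffs} (hc : ∀ {A : Type} [Ring A] [Algebra ℂ A] {Y : CurrentFamily A},
      Y.Satisfies q ρ → ∀ k, ∃ z, Y.Commutes z ∧ Y.g k = quadComb q ρ k (c k) Y + z ∧
          Y.gt k = quadComb q ρ k (c k) Y.swap + z) (s : ℕ → ℂ) :
    ∃ Y : CurrentFamily (CurrentAlgebra q ρ), Y.Satisfies q ρ ∧
        Y.wm 0 = (currentGens q ρ).wm 0 ∧ Y.wp 0 = (currentGens q ρ).wp 0 ∧
        ∀ k : ℕ,
          Y.g k = quadComb q ρ k (c k) Y + algebraMap ℂ (CurrentAlgebra q ρ) (s k) ∧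
          Y.gt k = quadComb q ρ k (c k) Y.swap + algebraMap ℂ (CurrentAlgebra q ρ) (s k) := by
  have hm := sub_inv_ne hq h1
  set X := currentGens q ρ with hX
  have hXs : X.Satisfies q ρ := currentGens_satisfies q ρ
  set g0 := ρ / (q - q⁻¹) with hg0
  have g0ne : g0 ≠ 0 := div_ne_zero hρ hm
  let res : ℕ → (ℕ → CurrentAlgebra q ρ) → CurrentAlgebra q ρ := fun k f =>
    (X.twist q ρ f).g k - quadComb q ρ k (c k) (X.twist q ρ f)
  -- With `f (k + 1) = 0` the residual constant is `res k`; the entry `f (k + 1)` adds `g0 • f (k +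
  -- 1)`. This choice makes the total equal to `s k`.
  let Φ : ℕ → (ℕ → CurrentAlgebra q ρ) → CurrentAlgebra q ρ := fun k f =>
    g0⁻¹ • (algebraMap ℂ _ (s k) - res k f)
  set f := recSeq Φ with hfdef
  let trunc : ℕ → ℕ → CurrentAlgebra q ρ := fun k i => if _h : i < k + 1 then f i else 0
  have f0 : f 0 = 1 := by rw [hfdef, recSeq]
  have fs : ∀ k, f (k + 1) = Φ k (trunc k) := fun k => by rw [hfdef, recSeq]
  have hres : ∀ k (f : ℕ → CurrentAlgebra q ρ), (∀ i x, f i * x = x * f i) → f 0 = 1 →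
      ∀ x, res k f * x = x * res k f := by
    intro k f hf hf0 x
    obtain ⟨z, hz, e, -⟩ := hc (hXs.twist hm hf hf0) k
    have e1 : res k f = z := by
      simp only [res]
      rw [e, add_sub_cancel_left]
    rw [e1]
    exact (Subalgebra.mem_center_iff.1 (mem_center_of_commutes
      (commutes_of_twist hXs hρ (add_inv_ne hq h2) hf hf0 hz)) x).symm
  have hf : ∀ i x, f i * x = x * f i := by
    intro i
    induction i using Nat.strong_induction_on with
    | _ i ih =>
    cases i with
    | zero => intro x; rw [f0, one_mul, mul_one]
    | succ k =>
      intro x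
      -- The truncated series is itself central with first entry one, so twisting by it gives a
      -- solution of the relations, whose residual is central.
      have hr := hres k (trunc k) (fun i x => by
        simp only [trunc]
        split_ifs with h
        · exact ih i h x
        · rw [zero_mul, mul_zero]) (by simp [trunc, f0]) x
      rw [fs]
      simp only [Φ]
      rw [smul_mul_assoc, mul_smul_comm, sub_mul, mul_sub, hr, Algebra.commutes]
  have hYs := hXs.twist hm hf f0
  refine ⟨X.twist q ρ f, hYs, ?_, ?_, fun k => ?_⟩
  · simp only [CurrentFamily.twist]
    rw [conv_zero, f0, one_mul]
  · simp only [CurrentFamily.twist]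
    rw [conv_zero, f0, one_mul]
  obtain ⟨z, hz, e, e'⟩ := hc hYs k
  have htr : ∀ {i}, i ≤ k → f i = trunc k i := fun {i} h => by
    simp only [trunc]
    rw [dif_pos (by omega)]
  -- The combination involves `W` only up to index `k` and `G` only below it, hence only `f 0, …, f
  -- k`.
  have hquad : quadComb q ρ k (c k) (X.twist q ρ f) =
      quadComb q ρ k (c k) (X.twist q ρ (trunc k)) := by
    refine quadComb_congr _ ?_ ?_ ?_ ?_ <;> intro i hi <;> simp only [CurrentFamily.twist]
    · exact conv_congr _ fun j hj => htr (by omega)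
    · exact conv_congr _ fun j hj => htr (by omega)
    · rw [conv_congr _ fun j hj => htr (by omega), htr (by omega)]
    · rw [conv_congr _ fun j hj => htr (by omega), htr (by omega)]
  have hg : (X.twist q ρ f).g k = (X.twist q ρ (trunc k)).g k + g0 • f (k + 1) := by
    simp only [CurrentFamily.twist]
    rw [conv_congr X.g fun j hj => htr (by omega), show trunc k (k + 1) = 0 by simp [trunc],
      smul_zero, add_zero]
  have ez : z = algebraMap ℂ _ (s k) := by
    have e1 : (X.twist q ρ f).g k = res k (trunc k) + quadComb q ρ k (c k) (X.twist q ρ f) +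
        g0 • f (k + 1) := by
      rw [hg, hquad]
      simp only [res]
      rw [sub_add_cancel]
    rw [fs] at e1
    simp only [Φ] at e1
    rw [smul_inv_smul₀ g0ne, e] at e1
    have e2 : z = quadComb q ρ k (c k) (X.twist q ρ f) + z -
      quadComb q ρ k (c k) (X.twist q ρ f) := by abel
    rw [e2, e1]
    abel
  rw [← ez]
  exact ⟨e, e'⟩
end

/-! ### A two-dimensional representation with a free scalar series. -/

section
/-- A two-dimensional representation of `O_q(sl₂^)`, multiplied by a scalar series `φ`. -/
noncomputable def repFamily (q r : ℂ) (φ : ℕ → ℂ) : CurrentFamily (Matrix (Fin 2) (Fin 2) ℂ) where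
  wm k := !![r * φ k, 0; 0, r * shiftSeq φ k]
  wp k := !![r * shiftSeq φ k, φ k - shiftSeq φ k; 0, r * φ k]
  g k := !![r ^ 2 / (q - q⁻¹) * (φ (k + 1) - shiftSeq φ k), -(q⁻¹ * r * (φ k - shiftSeq φ k));
    0, r ^ 2 / (q - q⁻¹) * (φ (k + 1) - shiftSeq φ k)]
  gt k := !![r ^ 2 / (q - q⁻¹) * (φ (k + 1) - shiftSeq φ k), q * r * (φ k - shiftSeq φ k);
    0, r ^ 2 / (q - q⁻¹) * (φ (k + 1) - shiftSeq φ k)]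

variable {q r : ℂ} {φ : ℕ → ℂ}

theorem upper_mul (a b d a' b' d' : ℂ) :
    !![a, b; 0, d] * !![a', b'; 0, d'] = !![a * a', a * b' + b * d'; 0, d * d'] := by
  simp

theorem upper_sub (a b d a' b' d' : ℂ) :
    !![a, b; 0, d] - !![a', b'; 0, d'] = !![a - a', b - b'; 0, d - d'] := by
  simp

theorem upper_add (a b d a' b' d' : ℂ) :
    !![a, b; 0, d] + !![a', b'; 0, d'] = !![a + a', b + b'; 0, d + d'] := by
  simp

theorem upper_smul (c a b d : ℂ) : c • !![a, b; 0, d] = !![c * a, c * b; 0, c * d] := by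
  simp

theorem upper_eq {a b d a' b' d' : ℂ} (h1 : a = a') (h2 : b = b') (h3 : d = d') :
    !![a, b; 0, d] = !![a', b'; 0, d'] := by rw [h1, h2, h3]

theorem zero_eq_upper : (0 : Matrix (Fin 2) (Fin 2) ℂ) = !![0, 0; 0, 0] := by
  ext i j; fin_cases i <;> fin_cases j <;> rfl

/-- With `φ(s) = ∑ φ_k s^k` the currents are `φ(s)` times fixed upper triangular matrices, for
instance `W_-(s) = r φ(s) diag(1, s)`, and the relations are checked entry by entry with `ρ = r²`.
-/
theorem repFamily_satisfies (hq : q ≠ 0) (hm : q - q⁻¹ ≠ 0) (hp : q + q⁻¹ ≠ 0) (h0 : φ 0 = 1) :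
    (repFamily q r φ).Satisfies q (r ^ 2) := by
  have hs0 : shiftSeq φ 0 = 0 := rfl
  have hs : ∀ k, shiftSeq φ (k + 1) = φ k := fun _ => rfl
  have hr : r ^ 2 / (q - q⁻¹) * (q - q⁻¹) = r ^ 2 := div_mul_cancel₀ _ hm
  have hpi : 1 / (q + q⁻¹) * (q + q⁻¹) = 1 := one_div_mul_cancel hp
  have hqi : q * q⁻¹ = 1 := mul_inv_cancel₀ hq
  intro x y h
  cases h <;> simp only [repFamily, aComm, qComm, hs0, hs, h0, zero_eq_upper, upper_mul, upper_sub,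
    upper_add, upper_smul] <;> refine upper_eq ?_ ?_ ?_ <;>
    try ring1
  case w0_wp k => linear_combination (-(r * (φ k - shiftSeq φ k))) * hpi
  case wm_w1 k => linear_combination (-(r * (φ k - shiftSeq φ k))) * hpi
  case w0_g.refine_1 k => linear_combination (r * (φ (k + 1) - shiftSeq φ k)) * hr
  case w0_g.refine_2 k => linear_combination (-(r ^ 2 * (φ k - shiftSeq φ k))) * hqi
  case gt_w0.refine_1 k => linear_combination (r * (φ (k + 1) - shiftSeq φ k)) * hr
  case gt_w0.refine_2 k => linear_combination (-(r ^ 2 * (φ k - shiftSeq φ k))) * hqi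
  case g_w1.refine_2 k =>
    linear_combination (φ (k + 1) - shiftSeq φ k) * hr - r ^ 2 * (φ k - shiftSeq φ k) * hqi
  case g_w1.refine_3 k => linear_combination (r * (φ (k + 1) - shiftSeq φ k)) * hr
  case w1_gt.refine_2 k =>
    linear_combination (φ (k + 1) - shiftSeq φ k) * hr - r ^ 2 * (φ k - shiftSeq φ k) * hqi
  case w1_gt.refine_3 k => linear_combination (r * (φ (k + 1) - shiftSeq φ k)) * hr
end

/-! ### Polarization, recurrences and matrix entries. -/

section
/-- The linear form `φ ↦ φ_{i-1}`, where `φ_{-1} = 0`. -/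
def prevCoord : ℕ → ((ℕ → ℂ) →ₗ[ℂ] ℂ)
  | 0 => 0
  | i + 1 => LinearMap.proj i

theorem prevCoord_apply (i : ℕ) (φ : ℕ → ℂ) : prevCoord i φ = shiftSeq φ i := by
  cases i <;> rfl

/-- The product of two linear forms. -/
noncomputable def formMul (l m : (ℕ → ℂ) →ₗ[ℂ] ℂ) : (ℕ → ℂ) →ₗ[ℂ] (ℕ → ℂ) →ₗ[ℂ] ℂ :=
  (LinearMap.mul ℂ ℂ).compl₁₂ l m

theorem formMul_apply (l m : (ℕ → ℂ) →ₗ[ℂ] ℂ) (φ χ : ℕ → ℂ) : formMul l m φ χ = l φ * m χ := rfl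

/-- A bilinear form whose quadratic form vanishes on an affine hyperplane is alternating. -/
theorem polarization {B : (ℕ → ℂ) →ₗ[ℂ] (ℕ → ℂ) →ₗ[ℂ] ℂ} (h : ∀ φ, φ 0 = 1 → B φ φ = 0)
    (u v : ℕ → ℂ) : B u v + B v u = 0 := by
  set e : ℕ → ℂ := Pi.single 0 1 with he
  have he0 : e 0 = 1 := by simp [he]
  have hee := h e he0
  -- The points `e + u` and `e - u` lie on the hyperplane; adding and subtracting the two identities
  -- separates the even and the odd part in `u`.
  have h0 : ∀ u : ℕ → ℂ, u 0 = 0 → B u u = 0 ∧ B e u + B u e = 0 := by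
    intro u hu
    have h1 := h (e + u) (by simp [he0, hu])
    have h2 := h (e - u) (by simp [he0, hu])
    simp only [map_add, map_sub, LinearMap.add_apply, LinearMap.sub_apply] at h1 h2
    constructor
    · linear_combination (h1 + h2) / 2 - hee
    · linear_combination (h1 - h2) / 2
  have hq : ∀ u, B u u = 0 := by
    intro u
    obtain ⟨h1, h2⟩ := h0 (u - u 0 • e) (by simp [he0])
    simp only [map_sub, map_smul, LinearMap.sub_apply, LinearMap.smul_apply, smul_eq_mul] at h1 h2
    linear_combination h1 + u 0 * h2 + u 0 ^ 2 * hee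
  have := hq (u + v)
  simp only [map_add, LinearMap.add_apply] at this
  linear_combination this - hq u - hq v

/-- The array that agrees with `f` on `I` and vanishes elsewhere. -/
def restrictArr (I : Finset (ℕ × ℕ)) (f : ℕ → ℕ → ℂ) (i j : ℕ) : ℂ := if (i, j) ∈ I then f i j else 0

theorem sum_single (I : Finset (ℕ × ℕ)) (f : ℕ → ℕ → ℂ) (i j : ℕ) :
    ∑ p ∈ I, f p.1 p.2 * ((Pi.single i 1 : ℕ → ℂ) p.1 * (Pi.single j 1 : ℕ → ℂ) p.2) =
      restrictArr I f i j := by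
  rw [restrictArr]
  split_ifs with h
  · rw [Finset.sum_eq_single (i, j)]
    · simp
    · intro p _ hp
      by_cases h1 : p.1 = i
      · have : p.2 ≠ j := fun h2 => hp (Prod.ext h1 h2)
        simp [Pi.single_eq_of_ne this]
      · simp [Pi.single_eq_of_ne h1]
    · exact fun h' => absurd h h'
  · refine Finset.sum_eq_zero fun p hp => ?_
    by_cases h1 : p.1 = i
    · have : p.2 ≠ j := fun h2 => h (by rwa [← h1, ← h2])
      simp [Pi.single_eq_of_ne this]
    · simp [Pi.single_eq_of_ne h1]

theorem sum_single' (I : Finset (ℕ × ℕ)) (f : ℕ → ℕ → ℂ) (i j : ℕ) :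
    ∑ p ∈ I, f p.1 p.2 * ((Pi.single i 1 : ℕ → ℂ) p.2 * (Pi.single j 1 : ℕ → ℂ) p.1) =
      restrictArr I f j i := by
  simp only [mul_comm ((Pi.single i 1 : ℕ → ℂ) _), sum_single]

theorem prevCoord_single (i p : ℕ) :
    prevCoord i (Pi.single p 1) = (Pi.single (p + 1) 1 : ℕ → ℂ) i := by
  cases i <;> simp [prevCoord, Pi.single_apply]

/-- The array with the first index lowered. -/
def lowerArr (M : ℕ → ℕ → ℂ) : ℕ → ℕ → ℂ
  | 0, _ => 0
  | i + 1, j => M i j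

theorem sum_single_succ (I : Finset (ℕ × ℕ)) (f : ℕ → ℕ → ℂ) (i j : ℕ) :
    ∑ p ∈ I, f p.1 p.2 * ((Pi.single i 1 : ℕ → ℂ) (p.1 + 1) * (Pi.single j 1 : ℕ → ℂ) p.2) =
      lowerArr (restrictArr I f) i j := by
  cases i with
  | zero => simp [lowerArr]
  | succ i =>
    rw [lowerArr, ← sum_single]
    simp [Pi.single_apply]

theorem sum_single_succ' (I : Finset (ℕ × ℕ)) (f : ℕ → ℕ → ℂ) (i j : ℕ) :
    ∑ p ∈ I, f p.1 p.2 * ((Pi.single i 1 : ℕ → ℂ) (p.2 + 1) * (Pi.single j 1 : ℕ → ℂ) p.1) =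
      lowerArr (fun i j => restrictArr I f j i) i j := by
  cases i with
  | zero => simp [lowerArr]
  | succ i =>
    rw [lowerArr, ← sum_single']
    simp [Pi.single_apply]

/-- The solutions that vanish at `0` are the multiples of `q^{2n} - q^{-2n}`, which is nonzero at `n
= m + 2` as `q` is not a root of unity. -/
theorem eq_zero_of_recurrence {q : ℂ} (hq0 : q ≠ 0) (hq : ∀ n : ℕ, 0 < n → q ^ n ≠ 1) {v : ℕ → ℂ}
    {m : ℕ} (h0 : v 0 = 0)
    (hr : ∀ n, n ≤ m → v (n + 2) = (q ^ 2 + q⁻¹ ^ 2) * v (n + 1) - v n) (hm : v (m + 2) = 0) {n : ℕ}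
    (hn : n ≤ m + 2) : v n = 0 := by
  have key : ∀ n, n + 1 ≤ m + 2 →
      v n * (q ^ 2 - q⁻¹ ^ 2) = v 1 * (q ^ (2 * n) - q⁻¹ ^ (2 * n)) ∧
      v (n + 1) * (q ^ 2 - q⁻¹ ^ 2) = v 1 * (q ^ (2 * (n + 1)) - q⁻¹ ^ (2 * (n + 1))) := by
    intro n
    induction n with
    | zero => intro _; simp [h0]
    | succ n ih =>
      intro hn
      obtain ⟨e1, e2⟩ := ih (by omega)
      refine ⟨e2, ?_⟩
      rw [hr n (by omega)]
      have hqi : q * q⁻¹ = 1 := mul_inv_cancel₀ hq0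
      have hqi2 : q ^ 2 * q⁻¹ ^ 2 = 1 := by rw [← mul_pow, hqi, one_pow]
      have p1 : q ^ (2 * (n + 1 + 1)) = q ^ (2 * n) * q ^ 2 * q ^ 2 := by ring
      have p2 : q⁻¹ ^ (2 * (n + 1 + 1)) = q⁻¹ ^ (2 * n) * q⁻¹ ^ 2 * q⁻¹ ^ 2 := by ring
      have p3 : q ^ (2 * (n + 1)) = q ^ (2 * n) * q ^ 2 := by ring
      have p4 : q⁻¹ ^ (2 * (n + 1)) = q⁻¹ ^ (2 * n) * q⁻¹ ^ 2 := by ring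
      rw [p3, p4] at e2
      rw [p1, p2]
      linear_combination (q ^ 2 + q⁻¹ ^ 2) * e2 - e1 +
        v 1 * (q ^ (2 * n) - q⁻¹ ^ (2 * n)) * hqi2
  have hne : ∀ n : ℕ, 0 < n → q ^ n - q⁻¹ ^ n ≠ 0 := by
    intro n hn h
    apply hq (n + n) (by omega)
    rw [pow_add]
    nth_rewrite 2 [sub_eq_zero.1 h]
    rw [← mul_pow, mul_inv_cancel₀ hq0, one_pow]
  have h1 : v 1 = 0 := by
    have := (key (m + 1) le_rfl).2
    rw [hm, zero_mul] at this
    exact (mul_eq_zero.1 this.symm).resolve_right (hne _ (by omega))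
  rcases Nat.eq_zero_or_pos n with rfl | hpos
  · exact h0
  · have := (key (n - 1) (by omega)).2
    rw [h1, zero_mul, Nat.sub_add_cancel hpos] at this
    exact (mul_eq_zero.1 this).resolve_right (hne 2 two_pos)

variable {q r : ℂ} {φ : ℕ → ℂ} {k : ℕ} {c : QuadCoeffs}

theorem quadComb_rep_entry (hr : r ≠ 0) :
    quadComb q (r ^ 2) k c (repFamily q r φ) 0 1 = r * (
      ∑ p ∈ indexA k, (c.a p.1 p.2 * (φ p.1 * (φ p.2 - shiftSeq φ p.2)) +
        c.b p.1 p.2 * ((φ p.1 - shiftSeq φ p.1) * shiftSeq φ p.2)) +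
      ∑ p ∈ indexF k, c.e p.1 p.2 * (q⁻¹ ^ 2 * (φ p.1 * φ p.2 - shiftSeq φ p.1 * shiftSeq φ p.2) +
        (q - q⁻¹)⁻¹ * (q * (φ (p.2 + 1) - shiftSeq φ p.2) * (φ p.1 - shiftSeq φ p.1) -
          q⁻¹ * (φ (p.1 + 1) - shiftSeq φ p.1) * (φ p.2 - shiftSeq φ p.2)))) := by
  rw [quadComb_eq, Matrix.add_apply, Matrix.sum_apply, Matrix.sum_apply, mul_add, Finset.mul_sum,
    Finset.mul_sum]
  congr 1
  · refine Finset.sum_congr rfl fun p _ => ?_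
    simp only [termA, repFamily, upper_mul, upper_smul, upper_add]
    simp only [Matrix.of_apply, Matrix.cons_val_zero, Matrix.cons_val_one]
    ring
  · refine Finset.sum_congr rfl fun p _ => ?_
    simp only [termF, repFamily, upper_mul, upper_smul, upper_add]
    simp only [Matrix.of_apply, Matrix.cons_val_zero, Matrix.cons_val_one]
    have h := mul_inv_cancel₀ (pow_ne_zero 2 hr)
    simp only [div_eq_mul_inv, one_mul]
    generalize (r ^ 2)⁻¹ = t at h ⊢
    generalize (q - q⁻¹)⁻¹ = d
    linear_combination (c.e p.1 p.2 * r * d * (q * (φ (p.2 + 1) - shiftSeq φ p.2) *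
      (φ p.1 - shiftSeq φ p.1) - q⁻¹ * (φ (p.1 + 1) - shiftSeq φ p.1) * (φ p.2 - shiftSeq φ p.2))) * h

theorem quadComb_rep_swap_entry (hr : r ≠ 0) :
    quadComb q (r ^ 2) k c (repFamily q r φ).swap 0 1 = r * (
      ∑ p ∈ indexA k, (c.b p.1 p.2 * (φ p.1 * (φ p.2 - shiftSeq φ p.2)) +
        c.a p.1 p.2 * ((φ p.1 - shiftSeq φ p.1) * shiftSeq φ p.2)) +
      ∑ p ∈ indexF k, c.e p.1 p.2 * (q ^ 2 * (φ p.1 * φ p.2 - shiftSeq φ p.1 * shiftSeq φ p.2) +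
        (q - q⁻¹)⁻¹ * (q * (φ (p.1 + 1) - shiftSeq φ p.1) * (φ p.2 - shiftSeq φ p.2) -
          q⁻¹ * (φ (p.2 + 1) - shiftSeq φ p.2) * (φ p.1 - shiftSeq φ p.1)))) := by
  rw [quadComb_eq, Matrix.add_apply, Matrix.sum_apply, Matrix.sum_apply, mul_add, Finset.mul_sum,
    Finset.mul_sum]
  congr 1
  · refine Finset.sum_congr rfl fun p _ => ?_
    simp only [termA, repFamily, CurrentFamily.swap, upper_mul, upper_smul, upper_add]
    simp only [Matrix.of_apply, Matrix.cons_val_zero, Matrix.cons_val_one]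
    ring
  · refine Finset.sum_congr rfl fun p _ => ?_
    simp only [termF, repFamily, CurrentFamily.swap, upper_mul, upper_smul, upper_add]
    simp only [Matrix.of_apply, Matrix.cons_val_zero, Matrix.cons_val_one]
    have h := mul_inv_cancel₀ (pow_ne_zero 2 hr)
    simp only [div_eq_mul_inv, one_mul]
    generalize (r ^ 2)⁻¹ = t at h ⊢
    generalize (q - q⁻¹)⁻¹ = d
    linear_combination (c.e p.1 p.2 * r * d * (q * (φ (p.1 + 1) - shiftSeq φ p.1) *
      (φ p.2 - shiftSeq φ p.2) - q⁻¹ * (φ (p.2 + 1) - shiftSeq φ p.2) * (φ p.1 - shiftSeq φ p.1))) * h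
end

/-! ### Vanishing of the coefficients of a trivial combination. -/

section
variable {q r : ℂ} {k : ℕ} {c : QuadCoeffs}

theorem restrictArr_indexA_eq_zero {f : ℕ → ℕ → ℂ} {i j : ℕ}
    (h : ¬(i + j ≤ k ∧ (i + j) % 2 = k % 2)) : restrictArr (indexA k) f i j = 0 :=
  if_neg fun hm => h (mem_indexA.1 hm)

theorem restrictArr_indexF_eq_zero {f : ℕ → ℕ → ℂ} {i j : ℕ}
    (h : ¬(i ≤ j ∧ i + j < k ∧ (i + j) % 2 ≠ k % 2)) : restrictArr (indexF k) f i j = 0 :=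
  if_neg fun hm => h (mem_indexF.1 hm)

/-- The bilinear form of the sum of the entries for a quadratic combination and its exchange. -/
noncomputable def entrySumForm (q : ℂ) (k : ℕ) (c : QuadCoeffs) :
    (ℕ → ℂ) →ₗ[ℂ] (ℕ → ℂ) →ₗ[ℂ] ℂ :=
  ∑ p ∈ indexA k, (c.a p.1 p.2 + c.b p.1 p.2) •
    (formMul (LinearMap.proj p.1) (LinearMap.proj p.2) -
      formMul (prevCoord p.1) (prevCoord p.2)) +
  ∑ p ∈ indexF k, c.e p.1 p.2 •
    ((q ^ 2 + q⁻¹ ^ 2) • formMul (LinearMap.proj p.1) (LinearMap.proj p.2)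
      - (q ^ 2 + q⁻¹ ^ 2 - 2) • formMul (prevCoord p.1) (prevCoord p.2)
      - formMul (LinearMap.proj (p.2 + 1)) (prevCoord p.1)
      - formMul (LinearMap.proj (p.1 + 1)) (prevCoord p.2)
      + formMul (LinearMap.proj (p.2 + 1)) (LinearMap.proj p.1)
      + formMul (LinearMap.proj (p.1 + 1)) (LinearMap.proj p.2)
      - formMul (prevCoord p.2) (LinearMap.proj p.1)
      - formMul (prevCoord p.1) (LinearMap.proj p.2))

/-- The bilinear form of the difference of the entries for a quadratic combination and its
exchange. -/
noncomputable def entryDiffForm (k : ℕ) (c : QuadCoeffs) : (ℕ → ℂ) →ₗ[ℂ] (ℕ → ℂ) →ₗ[ℂ] ℂ :=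
  ∑ p ∈ indexA k, (c.a p.1 p.2 - c.b p.1 p.2) •
    (formMul (LinearMap.proj p.1) (LinearMap.proj p.2)
      + formMul (prevCoord p.1) (prevCoord p.2)
      - (2 : ℂ) • formMul (LinearMap.proj p.1) (prevCoord p.2))

theorem entrySumForm_single (i j : ℕ) :
    entrySumForm q k c (Pi.single i 1) (Pi.single j 1) =
      restrictArr (indexA k) (fun i j => c.a i j + c.b i j) i j
      - restrictArr (indexA k) (fun i j => c.a i j + c.b i j) (i + 1) (j + 1)
      + (q ^ 2 + q⁻¹ ^ 2) * restrictArr (indexF k) c.e i j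
      - (q ^ 2 + q⁻¹ ^ 2 - 2) * restrictArr (indexF k) c.e (i + 1) (j + 1)
      - lowerArr (fun i j => restrictArr (indexF k) c.e j i) i (j + 1)
      - lowerArr (restrictArr (indexF k) c.e) i (j + 1)
      + lowerArr (fun i j => restrictArr (indexF k) c.e j i) i j
      + lowerArr (restrictArr (indexF k) c.e) i j
      - restrictArr (indexF k) c.e j (i + 1) - restrictArr (indexF k) c.e (i + 1) j := by
  have eA : ∑ p ∈ indexA k, (c.a p.1 p.2 + c.b p.1 p.2) *
      ((Pi.single i 1 : ℕ → ℂ) p.1 * (Pi.single j 1 : ℕ → ℂ) p.2 -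
        (Pi.single (i + 1) 1 : ℕ → ℂ) p.1 * (Pi.single (j + 1) 1 : ℕ → ℂ) p.2) =
      restrictArr (indexA k) (fun i j => c.a i j + c.b i j) i j
      - restrictArr (indexA k) (fun i j => c.a i j + c.b i j) (i + 1) (j + 1) := by
    rw [← sum_single (indexA k), ← sum_single (indexA k), ← Finset.sum_sub_distrib]
    exact Finset.sum_congr rfl fun p _ => mul_sub _ _ _
  simp only [entrySumForm, LinearMap.add_apply, LinearMap.sum_apply, LinearMap.smul_apply,
    LinearMap.sub_apply, formMul_apply, prevCoord_single, LinearMap.proj_apply, smul_eq_mul]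
  rw [eA, ← sum_single' (indexF k) c.e (i + 1) j, ← sum_single (indexF k) c.e (i + 1) j,
    ← sum_single (indexF k) c.e i j, ← sum_single (indexF k) c.e (i + 1) (j + 1),
    ← sum_single_succ', ← sum_single_succ', ← sum_single_succ, ← sum_single_succ]
  simp only [mul_sub, mul_add, Finset.sum_add_distrib, Finset.sum_sub_distrib, Finset.mul_sum,
    add_mul, sub_mul, mul_left_comm (c.e _ _) (q ^ 2),
    mul_left_comm (c.e _ _) (q⁻¹ ^ 2), mul_left_comm (c.e _ _) 2]
  ring

theorem entryDiffForm_single (i j : ℕ) :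
    entryDiffForm k c (Pi.single i 1) (Pi.single j 1) =
      restrictArr (indexA k) (fun i j => c.a i j - c.b i j) i j
      + restrictArr (indexA k) (fun i j => c.a i j - c.b i j) (i + 1) (j + 1)
      - 2 * restrictArr (indexA k) (fun i j => c.a i j - c.b i j) i (j + 1) := by
  rw [← sum_single (indexA k), ← sum_single (indexA k), ← sum_single (indexA k), Finset.mul_sum,
    ← Finset.sum_add_distrib, ← Finset.sum_sub_distrib]
  simp only [entryDiffForm, LinearMap.add_apply, LinearMap.sum_apply, LinearMap.smul_apply,
    LinearMap.sub_apply, formMul_apply, prevCoord_single, LinearMap.proj_apply, smul_eq_mul]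
  exact Finset.sum_congr rfl fun p _ => by ring

theorem entrySumForm_self (hr : r ≠ 0) (hm : q - q⁻¹ ≠ 0) (φ : ℕ → ℂ)
    (h : quadComb q (r ^ 2) k c (repFamily q r φ) 0 1 = 0)
    (h' : quadComb q (r ^ 2) k c (repFamily q r φ).swap 0 1 = 0) :
    entrySumForm q k c φ φ = 0 := by
  rw [quadComb_rep_entry hr] at h
  rw [quadComb_rep_swap_entry hr] at h'
  have h := (mul_eq_zero.1 h).resolve_left hr
  have h' := (mul_eq_zero.1 h').resolve_left hr
  have e := congrArg₂ (· + ·) h h'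
  simp only [add_zero] at e
  rw [add_add_add_comm, ← Finset.sum_add_distrib, ← Finset.sum_add_distrib] at e
  rw [← e]
  simp only [entrySumForm, LinearMap.add_apply, LinearMap.sum_apply, LinearMap.smul_apply,
    LinearMap.sub_apply, formMul_apply, prevCoord_apply, LinearMap.proj_apply, smul_eq_mul]
  have hd := inv_mul_cancel₀ hm
  congr 1
  · exact Finset.sum_congr rfl fun p _ => by ring
  · refine Finset.sum_congr rfl fun p _ => ?_
    generalize (q - q⁻¹)⁻¹ = d at hd ⊢
    linear_combination (-(c.e p.1 p.2 * ((φ (p.2 + 1) - shiftSeq φ p.2) * (φ p.1 - shiftSeq φ p.1) +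
      (φ (p.1 + 1) - shiftSeq φ p.1) * (φ p.2 - shiftSeq φ p.2)))) * hd

theorem entryDiffForm_self (hr : r ≠ 0) (φ : ℕ → ℂ) (hF : ∀ p ∈ indexF k, c.e p.1 p.2 = 0)
    (h : quadComb q (r ^ 2) k c (repFamily q r φ) 0 1 = 0)
    (h' : quadComb q (r ^ 2) k c (repFamily q r φ).swap 0 1 = 0) :
    entryDiffForm k c φ φ = 0 := by
  rw [quadComb_rep_entry hr] at h
  rw [quadComb_rep_swap_entry hr] at h'
  have h := (mul_eq_zero.1 h).resolve_left hr
  have h' := (mul_eq_zero.1 h').resolve_left hr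
  rw [Finset.sum_eq_zero (s := indexF k) fun p hp => by rw [hF p hp, zero_mul], add_zero] at h
  rw [Finset.sum_eq_zero (s := indexF k) fun p hp => by rw [hF p hp, zero_mul], add_zero] at h'
  have e := congrArg₂ (· - ·) h h'
  simp only [sub_zero] at e
  rw [← Finset.sum_sub_distrib] at e
  rw [← e]
  simp only [entryDiffForm, LinearMap.add_apply, LinearMap.sum_apply, LinearMap.smul_apply,
    LinearMap.sub_apply, formMul_apply, prevCoord_apply, LinearMap.proj_apply, smul_eq_mul]
  exact Finset.sum_congr rfl fun p _ => by ring

/-- Index pairs whose sum has the parity opposite to `k` isolate the `e_{ij}`. By descending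
induction on `i + j`, the symmetrized array satisfies on each antidiagonal a three-term recurrence
with characteristic roots `q^{±2}` and zero boundary values. -/
theorem quadCoeffs_e_eq_zero (hq0 : q ≠ 0) (hq : ∀ n : ℕ, 0 < n → q ^ n ≠ 1)
    (h : ∀ φ : ℕ → ℂ, φ 0 = 1 → entrySumForm q k c φ φ = 0) {i j : ℕ} (hij : (i, j) ∈ indexF k) :
    c.e i j = 0 := by
  set E := restrictArr (indexF k) c.e with hE
  set M : ℕ → ℕ → ℂ := fun i j => E i j + E j i with hM
  have hpol : ∀ i j, (i + j) % 2 ≠ k % 2 → (q ^ 2 + q⁻¹ ^ 2) * M i j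
      - (q ^ 2 + q⁻¹ ^ 2 - 2) * M (i + 1) (j + 1) - lowerArr M i (j + 1) - lowerArr M j (i + 1)
      = 0 := by
    intro i j hp
    have e := polarization h (Pi.single i 1) (Pi.single j 1)
    have low : ∀ i j, lowerArr M i j = lowerArr E i j + lowerArr (fun i j => E j i) i j := by
      intro i j
      cases i
      · simp [lowerArr]
      · rfl
    have lz : ∀ i j, (i + j) % 2 ≠ k % 2 → lowerArr M i j = 0 := by
      intro i j hp
      cases i with
      | zero => rfl
      | succ i =>
        simp only [lowerArr, hM, hE]
        rw [restrictArr_indexF_eq_zero (by omega), restrictArr_indexF_eq_zero (by omega), add_zero]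
    have l1 := lz i j hp
    have l2 := lz j i (by omega)
    have z1 : E j (i + 1) = 0 := restrictArr_indexF_eq_zero (by omega)
    have z2 : E (i + 1) j = 0 := restrictArr_indexF_eq_zero (by omega)
    have z3 : E i (j + 1) = 0 := restrictArr_indexF_eq_zero (by omega)
    have z4 : E (j + 1) i = 0 := restrictArr_indexF_eq_zero (by omega)
    rw [entrySumForm_single, entrySumForm_single, ← hE, z1, z2, z3, z4,
      restrictArr_indexA_eq_zero (by omega), restrictArr_indexA_eq_zero (by omega),
      restrictArr_indexA_eq_zero (by omega), restrictArr_indexA_eq_zero (by omega)] at e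
    rw [low] at l1 l2
    rw [low, low]
    simp only [hM]
    linear_combination e - l1 - l2
  have key : ∀ t i j, k ≤ i + j + t → M i j = 0 := by
    intro t
    induction t with
    | zero =>
      intro i j h
      simp only [hM, hE]
      rw [restrictArr_indexF_eq_zero (by omega), restrictArr_indexF_eq_zero (by omega), add_zero]
    | succ t ih =>
      intro i j h
      by_cases hp : (i + j) % 2 = k % 2
      · simp only [hM, hE]
        rw [restrictArr_indexF_eq_zero (by omega), restrictArr_indexF_eq_zero (by omega), add_zero]
      set m := i + j with hm
      -- The antidiagonal `i + j = m`, shifted by one and extended by zero at both ends.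
      let v : ℕ → ℂ := fun n => if n = m + 2 then 0 else lowerArr M n (m + 1 - n)
      have v1 : ∀ n, n ≤ m → v (n + 1) = M n (m - n) := by
        intro n hn
        simp only [v]
        rw [if_neg (by omega), lowerArr]
        congr 1
        omega
      have hv := eq_zero_of_recurrence hq0 hq (v := v) (m := m) (by simp [v, lowerArr]) (by
        intro n hn
        have e := hpol n (m - n) (by rw [Nat.add_sub_cancel' hn]; exact hp)
        rw [ih (n + 1) (m - n + 1) (by omega)] at e
        have e0 : v n = lowerArr M n (m - n + 1) := by
          simp only [v]
          rw [if_neg (by omega)]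
          congr 1
          omega
        have e2 : v (n + 2) = lowerArr M (m - n) (n + 1) := by
          rcases Nat.lt_or_ge n m with hlt | hge
          · rw [v1 (n + 1) (by omega), show m - n = (m - (n + 1)) + 1 by omega, lowerArr]
            exact add_comm _ _
          · have : n = m := le_antisymm hn hge
            subst this
            rw [Nat.sub_self, lowerArr]
            simp [v]
        rw [v1 n hn, e0, e2]
        linear_combination -e) (by simp [v]) (n := i + 1) (by omega)
      rw [v1 i (by omega)] at hv
      rwa [show m - i = j by omega] at hv
  have hM0 := key k i j (by omega)
  have hm := mem_indexF.1 hij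
  have hEij : E i j = c.e i j := if_pos hij
  simp only at hm
  rcases hm.1.lt_or_eq with hlt | heq
  · have : E j i = 0 := restrictArr_indexF_eq_zero (by omega)
    simp only [hM, this, add_zero] at hM0
    rw [← hEij, hM0]
  · subst heq
    simp only [hM] at hM0
    rw [← hEij]
    linear_combination hM0 / 2

/-- Once the `e_{ij}` vanish, the symmetric part of `a + b` is constant along diagonals and has
finite support, so it is zero. The array `a - b` is antisymmetric by descending induction and
constant along antidiagonals, so it is zero too. -/
theorem quadCoeffs_ab_eq (hF : ∀ p ∈ indexF k, c.e p.1 p.2 = 0)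
    (h : ∀ φ : ℕ → ℂ, φ 0 = 1 → entrySumForm q k c φ φ = 0)
    (h' : ∀ φ : ℕ → ℂ, φ 0 = 1 → entryDiffForm k c φ φ = 0) {i j : ℕ} (hij : (i, j) ∈ indexA k) :
    c.a i j = c.b i j ∧ c.a i j = - c.a j i := by
  have hE : restrictArr (indexF k) c.e = fun _ _ => 0 := by
    funext i j
    rw [restrictArr]
    split_ifs with hm
    · exact hF _ hm
    · rfl
  set S := restrictArr (indexA k) (fun i j => c.a i j + c.b i j) with hS
  set D := restrictArr (indexA k) (fun i j => c.a i j - c.b i j) with hD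
  have low : ∀ i j, lowerArr (fun _ _ => (0 : ℂ)) i j = 0 := by
    intro i j; cases i <;> rfl
  have s1 : ∀ i j, S i j + S j i = S (i + 1) (j + 1) + S (j + 1) (i + 1) := by
    intro i j
    have e := polarization h (Pi.single i 1) (Pi.single j 1)
    rw [entrySumForm_single, entrySumForm_single, ← hS, hE] at e
    simp only [low] at e
    linear_combination e
  have s2 : ∀ n i j, S i j + S j i = S (i + n) (j + n) + S (j + n) (i + n) := by
    intro n
    induction n with
    | zero => intro i j; rfl
    | succ n ih => intro i j; rw [ih, s1]; rfl
  have s3 : ∀ i j, S i j + S j i = 0 := by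
    intro i j
    rw [s2 (k + 1), hS, restrictArr_indexA_eq_zero (by omega),
      restrictArr_indexA_eq_zero (by omega), add_zero]
  have d1 : ∀ i j, D i j + D j i + (D (i + 1) (j + 1) + D (j + 1) (i + 1)) -
      2 * (D i (j + 1) + D j (i + 1)) = 0 := by
    intro i j
    have e := polarization h' (Pi.single i 1) (Pi.single j 1)
    rw [entryDiffForm_single, entryDiffForm_single, ← hD] at e
    linear_combination e
  have dz : ∀ i j, ¬(i + j ≤ k ∧ (i + j) % 2 = k % 2) → D i j = 0 := fun i j h =>
    restrictArr_indexA_eq_zero h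
  have d2 : ∀ t i j, k < i + j + t → D i j + D j i = 0 := by
    intro t
    induction t with
    | zero => intro i j h; rw [dz i j (by omega), dz j i (by omega), add_zero]
    | succ t ih =>
      intro i j h
      by_cases hp : (i + j) % 2 = k % 2
      · have e := d1 i j
        rw [ih (i + 1) (j + 1) (by omega), dz i (j + 1) (by omega), dz j (i + 1) (by omega)] at e
        linear_combination e
      · rw [dz i j (by omega), dz j i (by omega), add_zero]
  have d3 : ∀ i j, D i j + D j i = 0 := fun i j => d2 (k + 1) i j (by omega)
  have d4 : ∀ i j, D i (j + 1) = D (i + 1) j := by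
    intro i j
    linear_combination (d3 i j) / 2 + (d3 (i + 1) (j + 1)) / 2 - (d1 i j) / 2 - d3 j (i + 1)
  have d5 : ∀ i j, D i j = D 0 (i + j) := by
    intro i
    induction i with
    | zero => intro j; rw [zero_add]
    | succ i ih => intro j; rw [← d4, ih]; congr 1; omega
  have d6 : D i j = 0 := by
    have e1 := d5 i j
    have e2 := d5 j i
    rw [add_comm j i] at e2
    linear_combination (d3 i j + e1 - e2) / 2
  have hji : (j, i) ∈ indexA k := by
    rw [mem_indexA] at hij ⊢
    simp only at hij ⊢
    omega
  have d6' : D j i = 0 := by linear_combination d3 i j - d6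
  have s3' := s3 i j
  simp only [hS, hD, restrictArr, if_pos hij, if_pos hji] at d6 d6' s3'
  exact ⟨by linear_combination d6, by linear_combination (s3' + d6 + d6') / 2⟩
end

/-! ### Agreement of coefficient systems and the conclusion. -/

section
variable {R : Type*} [Ring R] [Algebra ℂ R] {q ρ : ℂ} {k : ℕ} {c c' : QuadCoeffs}

theorem agree_iff : QuadCoeffs.Agree k c c' ↔ (∀ p ∈ indexF k, c'.e p.1 p.2 = c.e p.1 p.2) ∧
    ∀ p ∈ indexA k, c'.a p.1 p.2 - c.a p.1 p.2 = c'.b p.1 p.2 - c.b p.1 p.2 ∧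
      c'.a p.1 p.2 - c.a p.1 p.2 = -(c'.a p.2 p.1 - c.a p.2 p.1) := by
  rw [indexF_eq, indexA_eq]
  simp only [Finset.mem_biUnion, Finset.mem_range, Finset.mem_filter,
    Finset.HasAntidiagonal.mem_antidiagonal]
  constructor
  · rintro ⟨h1, h2⟩
    exact ⟨fun p ⟨l, hl, hp, hle⟩ => h1 l _ _ hl hp hle, fun p ⟨l, hl, hp⟩ => h2 l _ _ hl hp⟩
  · rintro ⟨h1, h2⟩
    exact ⟨fun l i j hl hp hle => h1 (i, j) ⟨l, hl, hp, hle⟩,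
      fun l i j hl hp => h2 (i, j) ⟨l, hl, hp⟩⟩

theorem quadComb_sub (q ρ : ℂ) (k : ℕ) (c c' : QuadCoeffs) (Y : CurrentFamily R) :
    quadComb q ρ k (c'.add (c.smul (-1))) Y = quadComb q ρ k c' Y - quadComb q ρ k c Y := by
  rw [quadComb_add, quadComb_smul, neg_one_smul, sub_eq_add_neg]

theorem quadComb_eq_of_agree {Y : CurrentFamily R} (hY : Y.Satisfies q ρ)
    (h : QuadCoeffs.Agree k c c') : quadComb q ρ k c' Y = quadComb q ρ k c Y := by
  obtain ⟨h1, h2⟩ := agree_iff.1 h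
  rw [quadComb_eq, quadComb_eq]
  congr 1
  · rw [← sub_eq_zero, ← Finset.sum_sub_distrib]
    set d : ℕ → ℕ → ℂ := fun i j => c'.a i j - c.a i j with hd
    have e1 : ∀ p ∈ indexA k, termA c' Y p.1 p.2 - termA c Y p.1 p.2 =
        d p.1 p.2 • (Y.wm p.1 * Y.wp p.2 + Y.wp p.1 * Y.wm p.2) := by
      intro p hp
      have hb : c'.b p.1 p.2 = c.b p.1 p.2 + d p.1 p.2 := by linear_combination -(h2 p hp).1
      have ha : c'.a p.1 p.2 = c.a p.1 p.2 + d p.1 p.2 := by simp [hd]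
      rw [termA, termA, ha, hb]
      module
    have hsw : ∀ F : ℕ → ℕ → R, ∑ p ∈ indexA k, F p.1 p.2 = ∑ p ∈ indexA k, F p.2 p.1 := by
      intro F
      refine Finset.sum_nbij' Prod.swap Prod.swap ?_ ?_ ?_ ?_ ?_ <;> intro p hp <;>
        simp only [mem_indexA, Prod.swap_swap, Prod.fst_swap, Prod.snd_swap] at hp ⊢ <;> omega
    rw [Finset.sum_congr rfl e1]
    set T := ∑ p ∈ indexA k, d p.1 p.2 • (Y.wm p.1 * Y.wp p.2 + Y.wp p.1 * Y.wm p.2) with hT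
    -- Adding the sum with `i`, `j` exchanged pairs the antisymmetric `d` with the relation
    -- `[W_{-i}, W_{j+1}] + [W_{i+1}, W_{-j}] = 0`.
    have e2 : T + T = 0 := by
      nth_rewrite 2 [hT]
      rw [hsw fun i j => d i j • (Y.wm i * Y.wp j + Y.wp i * Y.wm j), hT,
        ← Finset.sum_add_distrib]
      refine Finset.sum_eq_zero fun p hp => ?_
      have hanti : d p.1 p.2 = - d p.2 p.1 := (h2 p hp).2
      have hc := hY _ _ (.wm_wp p.1 p.2)
      simp only [aComm] at hc
      rw [hanti]
      linear_combination (norm := module) (-d p.2 p.1) • hc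
    rw [← two_smul ℂ T] at e2
    exact (smul_eq_zero.1 e2).resolve_left two_ne_zero
  · exact Finset.sum_congr rfl fun p hp => by rw [termF, termF, h1 p hp]

theorem CurrentFamily.Satisfies.solvesNext {Y : CurrentFamily R} (hY : Y.Satisfies q ρ) {z : R}
    (hz : Y.Commutes z) (k : ℕ) : SolvesNext q Y k (Y.g k + z) (Y.gt k + z) := by
  have h1 : ∀ w : R, Commute z w → ∀ x, qComm q w (x + z) = qComm q w x + (q - q⁻¹) • (w * z) := by
    intro w hw x
    simp only [qComm, mul_add, add_mul, hw.eq]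
    module
  have h2 : ∀ w : R, Commute z w → ∀ x, qComm q (x + z) w = qComm q x w + (q - q⁻¹) • (w * z) := by
    intro w hw x
    simp only [qComm, mul_add, add_mul, hw.eq]
    module
  refine ⟨?_, ?_, ?_, ?_⟩
  · rw [add_sub_add_right_eq_sub]; exact hY _ _ (.w0_wp k)
  · rw [add_sub_add_right_eq_sub]; exact hY _ _ (.wm_w1 k)
  · rw [h1 _ (hz 0).1, h2 _ (hz 0).1, hY _ _ (.w0_g k), hY _ _ (.gt_w0 k)]
  · rw [h1 _ (hz 0).2.1, h2 _ (hz 0).2.1, hY _ _ (.g_w1 k), hY _ _ (.w1_gt k)]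

/-- Relation (1) fixes `y - x`, so both differences are one element `d`. Then `[W_0, d]_q = [d,
W_0]_q` says that `(q + q⁻¹) [W_0, d] = 0`. -/
theorem solvesNext_sub (hp : q + q⁻¹ ≠ 0) {Y : CurrentFamily R} {x y u v : R}
    (h : SolvesNext q Y k x y) (h' : SolvesNext q Y k u v) :
    x - u = y - v ∧ Y.wm 0 * (x - u) = (x - u) * Y.wm 0 := by
  obtain ⟨h1, -, h3, -⟩ := h
  obtain ⟨h1', -, h3', -⟩ := h'
  have e1 : x - u = y - v := by
    have := h1.symm.trans h1'
    have := smul_right_injective R (one_div_ne_zero hp) this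
    linear_combination (norm := abel) -this
  refine ⟨e1, ?_⟩
  have e2 : qComm q (Y.wm 0) (x - u) = qComm q (x - u) (Y.wm 0) := by
    nth_rewrite 2 [e1]
    simp only [qComm, mul_sub, sub_mul] at h3 h3' ⊢
    linear_combination (norm := module) h3 - h3'
  rw [← sub_eq_zero]
  refine (smul_eq_zero.1 (?_ : (q + q⁻¹) • _ = _)).resolve_left hp
  simp only [qComm] at e2
  linear_combination (norm := module) e2

theorem agree_of_quadComb_eq (hq0 : q ≠ 0) (hq : ∀ n : ℕ, 0 < n → q ^ n ≠ 1)
    (hm : q - q⁻¹ ≠ 0) (hp : q + q⁻¹ ≠ 0) (hρ : ρ ≠ 0)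
    (h : quadComb q ρ k c (currentGens q ρ) = quadComb q ρ k c (currentGens q ρ).swap)
    (h' : (currentGens q ρ).wm 0 * quadComb q ρ k c (currentGens q ρ) =
      quadComb q ρ k c (currentGens q ρ) * (currentGens q ρ).wm 0) :
    (∀ p ∈ indexF k, c.e p.1 p.2 = 0) ∧
      ∀ p ∈ indexA k, c.a p.1 p.2 = c.b p.1 p.2 ∧ c.a p.1 p.2 = - c.a p.2 p.1 := by
  -- The representation requires a square root of `ρ`.
  obtain ⟨r, rfl⟩ := IsAlgClosed.exists_pow_nat_eq ρ (n := 2) two_pos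
  have hr : r ≠ 0 := by rintro rfl; exact hρ (zero_pow two_ne_zero)
  have key : ∀ φ : ℕ → ℂ, φ 0 = 1 → quadComb q (r ^ 2) k c (repFamily q r φ) 0 1 = 0 ∧
      quadComb q (r ^ 2) k c (repFamily q r φ).swap 0 1 = 0 := by
    intro φ hφ
    have hY : (repFamily q r φ).Satisfies q (r ^ 2) := repFamily_satisfies hq0 hm hp hφ
    have hs : (currentGens q (r ^ 2)).swap.map hY.lift = (repFamily q r φ).swap :=
      congrArg CurrentFamily.swap hY.map_lift
    have e := congrArg hY.lift h
    have e' := congrArg hY.lift h'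
    have h0 : hY.lift ((currentGens q (r ^ 2)).wm 0) = (repFamily q r φ).wm 0 :=
      congrArg (fun Y => CurrentFamily.wm Y 0) hY.map_lift
    rw [quadComb_map, quadComb_map, hY.map_lift, hs] at e
    rw [map_mul, map_mul, quadComb_map, hY.map_lift, h0] at e'
    -- Here `W_0` acts as `diag(r, 0)`, so a matrix that commutes with it has zero upper right
    -- entry.
    have e0 : quadComb q (r ^ 2) k c (repFamily q r φ) 0 1 = 0 := by
      have := congrFun (congrFun e' 0) 1
      simpa [Matrix.mul_apply, Fin.sum_univ_two, repFamily, shiftSeq, hφ, hr] using this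
    exact ⟨e0, by rw [← e, e0]⟩
  have hS : ∀ φ : ℕ → ℂ, φ 0 = 1 → entrySumForm q k c φ φ = 0 := fun φ hφ =>
    entrySumForm_self hr hm φ (key φ hφ).1 (key φ hφ).2
  have hF : ∀ p ∈ indexF k, c.e p.1 p.2 = 0 := fun p hp => quadCoeffs_e_eq_zero hq0 hq hS hp
  exact ⟨hF, fun p hp => quadCoeffs_ab_eq hF hS
    (fun φ hφ => entryDiffForm_self hr φ hF (key φ hφ).1 (key φ hφ).2) hp⟩

theorem proposition2p1 (q ρ : ℂ) (hq0 : q ≠ 0) (hq : ∀ n : ℕ, 0 < n → q ^ n ≠ 1) (hρ : ρ ≠ 0) :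
    ∃ c : ℕ → QuadCoeffs,
      -- with arbitrary constants `s k`, the recursive formula solves all the defining relations
      (∀ s : ℕ → ℂ, ∃ X : CurrentFamily (CurrentAlgebra q ρ),
        X.Satisfies q ρ ∧
        X.wm 0 = (currentGens q ρ).wm 0 ∧ X.wp 0 = (currentGens q ρ).wp 0 ∧
        ∀ k : ℕ,
          X.g k = quadComb q ρ k (c k) X + algebraMap ℂ (CurrentAlgebra q ρ) (s k) ∧
          X.gt k = quadComb q ρ k (c k) X.swap + algebraMap ℂ (CurrentAlgebra q ρ) (s k)) ∧
      -- the generators themselves have this form, up to a central term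
      (∀ k : ℕ, ∃ z ∈ Subalgebra.center ℂ (CurrentAlgebra q ρ),
        (currentGens q ρ).g k = quadComb q ρ k (c k) (currentGens q ρ) + z ∧
        (currentGens q ρ).gt k = quadComb q ρ k (c k) (currentGens q ρ).swap + z) ∧
      -- the coefficients are uniquely determined up to the relations
      (∀ (k : ℕ) (c' : QuadCoeffs) (s : ℂ),
        SolvesNext q (currentGens q ρ) k
          (quadComb q ρ k c' (currentGens q ρ) + algebraMap ℂ (CurrentAlgebra q ρ) s)
          (quadComb q ρ k c' (currentGens q ρ).swap + algebraMap ℂ (CurrentAlgebra q ρ) s) ↔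
        QuadCoeffs.Agree k (c k) c') := by
  -- If `q^{2n} = -1` with `n > 0`, then `q^{4n} = 1`.
  have hn : ∀ n : ℕ, q ^ (2 * n) + 1 ≠ 0 := by
    intro n h
    rcases Nat.eq_zero_or_pos n with rfl | hpos
    · norm_num at h
    · refine hq (2 * n + 2 * n) (by omega) ?_
      rw [pow_add]
      linear_combination (q ^ (2 * n) - 1) * h
  have h1 : q ^ 2 - 1 ≠ 0 := sub_ne_zero.2 (hq 2 two_pos)
  have h2 : q ^ 2 + 1 ≠ 0 := hn 1
  have hm := sub_inv_ne hq0 h1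
  have hp := add_inv_ne hq0 h2
  have hX := currentGens_satisfies q ρ
  obtain ⟨c, hc⟩ := exists_universal_quadComb hq0 h1 h2 hρ hn
  refine ⟨c, exists_twist hq0 h1 h2 hρ hc, fun k => ?_, fun k c' s => ?_⟩
  · obtain ⟨z, hz, e⟩ := hc hX k
    exact ⟨z, mem_center_of_commutes hz, e⟩
  obtain ⟨z, hz, e, e'⟩ := hc hX k
  have hs : (currentGens q ρ).Commutes (algebraMap ℂ (CurrentAlgebra q ρ) s) := fun k =>
    ⟨Algebra.commutes _ _, Algebra.commutes _ _, Algebra.commutes _ _, Algebra.commutes _ _⟩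
  -- The combination with coefficients `c k` plus `s` equals `G_{k+1} + (s - z)`, the actual
  -- generator shifted by a central element, and so it is a solution with which the given one can be
  -- compared.
  have hz' : (currentGens q ρ).Commutes (algebraMap ℂ (CurrentAlgebra q ρ) s - z) := fun k =>
    ⟨(hs k).1.sub_left (hz k).1, (hs k).2.1.sub_left (hz k).2.1,
      (hs k).2.2.1.sub_left (hz k).2.2.1, (hs k).2.2.2.sub_left (hz k).2.2.2⟩
  have hsol := hX.solvesNext hz' k
  rw [e, e', add_assoc, add_assoc, add_sub_cancel] at hsol
  constructor
  · intro h
    obtain ⟨e1, e2⟩ := solvesNext_sub hp h hsol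
    rw [add_sub_add_right_eq_sub, ← quadComb_sub] at e1 e2
    rw [add_sub_add_right_eq_sub, ← quadComb_sub] at e1
    obtain ⟨f1, f2⟩ := agree_of_quadComb_eq hq0 hq hm hp hρ e1 e2
    refine agree_iff.2 ⟨fun p hp => ?_, fun p hp => ?_⟩
    · have := f1 p hp
      simp only [QuadCoeffs.add, QuadCoeffs.smul] at this
      linear_combination this
    · have := f2 p hp
      simp only [QuadCoeffs.add, QuadCoeffs.smul] at this
      exact ⟨by linear_combination this.1, by linear_combination this.2⟩
  · intro h
    rwa [quadComb_eq_of_agree hX h, quadComb_eq_of_agree hX.swap h]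
end
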